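/- **Theorem (Consistency of revised Split LBISS).** *Setting.* Let $n\ge 1$, $m\ge 2$, $X\in\mathbb R^{n\times p}$, $D\in\mathbb R^{m\times p}$, $y=X\beta^\star+\epsilon$, where $\epsilon$ has i.i.d. components with $\mathbb E\,e^{t\epsilon_i}\le e^{\sigma^2t^2/2}$ for all $t\in\mathbb R$ ($\sigma>0$). Put $\gamma^\star=D\beta^\star$, $S=\mathrm{supp}(\gamma^\star)$, $s=|S|$, and assume $s\ge 1$ and $\beta^\star\in\mathcal L:=\mathrm{Im}(X^T)+\mathrm{Im}(D^T)$. Write $X^*=X^T/n$, write $D_J$ for the submatrix of the rows of $D$ in $J$ and $Q^\dagger$ for the Moore–Penrose pseudoinverse. Let $\nu>0$ and $$\ell(\beta,\gamma)=\tfrac1{2n}\|y-X\beta\|_2^2+\tfrac1{2\nu}\|\gamma-D\beta\|_2^2,\qquad H=\nabla^2\ell=\begin{pmatrix}X^*X+D^TD/\nu&-D^T/\nu\\-D/\nu&I/\nu\end{pmatrix}.$$ Let $\lambda_D,\Lambda_D,\Lambda_X>0$ be such that every nonzero singular value of $D$ and of $D_{S^c}$ is at least $\lambda_D$, the largest singular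 value of $D$ is at most $\Lambda_D$, and that of $X^*X$ is at most $\Lambda_X^2$. Let $\lambda_1$ be the smallest nonzero singular value of $X\tilde V/\sqrt n$, where the columns of $\tilde V$ form an orthonormal basis of $\ker D$ ($\lambda_1=+\infty$ if there is none), and $r'=\dim\{X\beta:\beta\in\ker D\}$. *Assumptions.* (RSC) There is $\lambda>0$ with $\beta^TX^*X\beta\ge\lambda\|\beta\|_2^2$ for all $\beta\in\mathcal L$ with $D_{S^c}\beta=0$. Let $\lambda_H=C/(1+\nu)$, where $C>0$ satisfies $$(\beta^T,\gamma_S^T)\,H_{(\beta,S),(\beta,S)}\begin{pmatrix}\beta\\\gamma_S\end{pmatrix}\ge\frac{C}{1+\nu}\left\|\begin{pmatrix}\beta\\\gamma_S\end{pmatrix}\right\|_2^2\qquad(\beta\in\mathcal L,\ \gamma_S\in\mathbb R^S).$$ (IRR) There is $\eta\in(0,1]$ with $\sup_{\rho\in[-1,1]^S}\big\|H_{S^c,(\beta,S)}H_{(\beta,S),(\beta,S)}^\dagger\binom{0}{\rho}\big\|_\infty\le1-\eta$. Moreover $$\kappa\ge\frac4\eta\Big(1+\frac1{\lambda_D}+\frac{\Lambda_X}{\lambda_1\lambda_D}\Big)\Big(1+\sqrt{\tfrac{2(1+\nu\Lambda_X^2+\Lambda_D^2)}{\lambda_H\nu}}\Big)\Big((1+\Lambda_D)\|\beta^\star\|_2+\frac{2\sigma}{\lambda_H}\Big(\frac{\Lambda_X}{\lambda_D}+\frac{\Lambda_X}{\lambda_D^2}+\frac{\lambda_H\lambda_D^2+\Lambda_X^2}{\lambda_1\lambda_D^2}\Big)\Big).$$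 *Dynamics.* Let $(\rho,\beta,\gamma)$ be the solution on $[0,\infty)$ of $$\dot\beta/\kappa=-\nabla_\beta\ell(\beta,\gamma),\qquad\dot\rho+\dot\gamma/\kappa=-\nabla_\gamma\ell(\beta,\gamma),\qquad\rho(t)\in\partial\|\gamma(t)\|_1,\qquad\rho(0)=\gamma(0)=0,\ \beta(0)=0,$$ where $\rho,\beta,\gamma$ are continuous and right continuously differentiable and the dots denote right derivatives. Put $$\bar\tau=\frac{\eta}{8\sigma}\frac{\lambda_D}{\Lambda_X}\sqrt{\frac n{\log m}},\qquad S(t)=\mathrm{supp}(\gamma(t)),\qquad\tilde\beta(t)=\big(I-D_{S(t)^c}^\dagger D_{S(t)^c}\big)\beta(t),$$ i.e. $\tilde\beta(t)$ is the orthogonal projection of $\beta(t)$ onto $\ker(D_{S(t)^c})$ (and $\tilde\beta(t)=\beta(t)$ if $S(t)^c=\varnothing$). *Conclusion.* 1. If $$\min_{j\in S}|(D\beta^\star)_j|\ge\frac{16\sigma}{\eta\lambda_H}\cdot\frac{\Lambda_X\Lambda_D}{\lambda_D^2}\Big(2\log s+5+\max\{0,\log(8\Lambda_D)\}\Big)\sqrt{\frac{\log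 m}n},$$ then $\mathrm{sign}(D\tilde\beta(\bar\tau))=\mathrm{sign}(D\beta^\star)$ with probability at least $1-8/m-3e^{-4n/5}$. 2. With probability at least $1-8/m-2r'/m^2-3e^{-4n/5}$, $$\|\tilde\beta(\bar\tau)-\beta^\star\|_2\le\frac{80\sigma}{\eta\lambda_H}\cdot\frac{\Lambda_X(\Lambda_D+\lambda_D^2)}{\lambda_D^3}\sqrt{\frac{s\log m}n}+\frac{2\sigma}{\lambda_H}\Big(\frac{\Lambda_X}{\lambda_D^2}+\frac{\lambda_H\lambda_D^2+\Lambda_X^2}{\lambda_1\lambda_D^2}\Big)\sqrt{\frac{r'\log m}n}+2\big\|D_{S(\bar\tau)^c}^\dagger D_{S(\bar\tau)^c\cap S}\beta^\star\big\|_2,$$ where $D_{S(\bar\tau)^c\cap S}\beta^\star$ is regarded as a vector indexed by $S(\bar\tau)^c$ that vanishes outside $S$; and if in addition $S(\bar\tau)\supseteq S$, then the bound holds without the last term. -/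

import Mathlib

open MeasureTheory ProbabilityTheory
open scoped Matrix ENNReal NNReal

noncomputable section

namespace SplitLBISS

/-! ### Linear algebra -/

/-- The Euclidean norm of a real vector. -/
def l2 {ι : Type*} [Fintype ι] (v : ι → ℝ) : ℝ :=
  ‖(WithLp.toLp 2 v : EuclideanSpace ℝ ι)‖

/-- The `ℓ¹` norm of a real vector. -/
def l1 {ι : Type*} [Fintype ι] (v : ι → ℝ) : ℝ := ∑ i, |v i|

/-- The support of a vector. -/
def supp {m : ℕ} (v : Fin m → ℝ) : Finset (Fin m) := Finset.univ.filter fun j => v j ≠ 0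

/-- The submatrix formed by the rows with index in `J`. -/
def rows {m p : ℕ} (D : Matrix (Fin m) (Fin p) ℝ) (J : Finset (Fin m)) : Matrix J (Fin p) ℝ :=
  D.submatrix Subtype.val id

/-- `X⋆ = Xᵀ / n`, for a matrix `X` with `n` rows. -/
def scaledTranspose {n p : ℕ} (X : Matrix (Fin n) (Fin p) ℝ) : Matrix (Fin p) (Fin n) ℝ :=
  (n : ℝ)⁻¹ • Xᵀ

lemma gram_isHermitian {α β : Type*} [Fintype α] (Q : Matrix α β ℝ) : (Qᵀ * Q).IsHermitian := by
  simpa [Matrix.conjTranspose_eq_transpose_of_trivial] using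
    Matrix.isHermitian_conjTranspose_mul_self Q

/-- The Moore–Penrose pseudoinverse `Q† = (Qᵀ Q)† Qᵀ`. The pseudoinverse of the symmetric matrix
`Qᵀ Q` inverts its nonzero eigenvalues and keeps its eigenvectors and its kernel
(functional calculus with `x ↦ x⁻¹`, where `0⁻¹ = 0`).
The four Penrose equations are proved in `pinv_penrose`. -/
def pinv {α β : Type*} [Fintype α] [Fintype β] [DecidableEq β] (Q : Matrix α β ℝ) :
    Matrix β α ℝ :=
  (gram_isHermitian Q).cfc (fun x => x⁻¹) * Qᵀ

theorem pinv_penrose {α β : Type*} [Fintype α] [Fintype β] [DecidableEq β]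
    (Q : Matrix α β ℝ) :
    Q * pinv Q * Q = Q ∧ pinv Q * Q * pinv Q = pinv Q ∧
      (Q * pinv Q)ᵀ = Q * pinv Q ∧ (pinv Q * Q)ᵀ = pinv Q * Q := by
  have hA := gram_isHermitian Q
  have hsa : IsSelfAdjoint (Qᵀ * Q) := hA
  set A : Matrix β β ℝ := Qᵀ * Q with hAdef
  set P : Matrix β β ℝ := hA.cfc (fun x => x⁻¹) with hPdef
  have hPc : P = cfc (fun x : ℝ => x⁻¹) A := (hA.cfc_eq _).symm
  have hcont : ∀ f : ℝ → ℝ, ContinuousOn f (spectrum ℝ A) := fun f => by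
    rw [continuousOn_iff_continuous_domRestrict]; fun_prop
  have hid : cfc (fun x : ℝ => x) A = A := cfc_id' ℝ A
  have hAP : A * P = cfc (fun x : ℝ => x * x⁻¹) A := by
    rw [hPc, cfc_mul (fun x : ℝ => x) (fun x : ℝ => x⁻¹) A (hcont _) (hcont _), hid]
  have hPA : P * A = cfc (fun x : ℝ => x * x⁻¹) A := by
    have h : cfc (fun x : ℝ => x⁻¹ * x) A = P * A := by
      rw [cfc_mul (fun x : ℝ => x⁻¹) (fun x : ℝ => x) A (hcont _) (hcont _), hid, ← hPc]
    rw [← h]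
    simp only [mul_comm]
  have hcomm : A * P = P * A := hAP.trans hPA.symm
  have hAPA : A * P * A = A := by
    have h : cfc (fun x : ℝ => x * x⁻¹ * x) A = A * P * A := by
      rw [cfc_mul (fun x : ℝ => x * x⁻¹) (fun x : ℝ => x) A (hcont _) (hcont _), hid, hAP]
    rw [← h]
    simp only [mul_inv_mul_cancel, hid]
  have hPAP : P * A * P = P := by
    have h : cfc (fun x : ℝ => x * x⁻¹ * x⁻¹) A = P * A * P := by
      rw [cfc_mul (fun x : ℝ => x * x⁻¹) (fun x : ℝ => x⁻¹) A (hcont _) (hcont _), hPA, ← hPc]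
    rw [← h, hPc]
    congr 1
    ext x
    by_cases hx : x = 0 <;> simp [hx]
  have hPt : Pᵀ = P := by
    have h : IsSelfAdjoint P := by rw [hPc]; exact cfc_predicate _ A
    have h' : Pᴴ = P := h
    rwa [Matrix.conjTranspose_eq_transpose_of_trivial] at h'
  have hAt : Aᵀ = A := by simp [hAdef]
  have hpinv : pinv Q = P * Qᵀ := rfl
  have hQ : Q * P * A = Q := by
    have h0 : (Q * P * A - Q)ᵀ * (Q * P * A - Q) = 0 := by
      have e1 : (Q * P * A - Q)ᵀ * (Q * P * A - Q)
          = A * P * A * P * A - A * P * A - (A * P * A - A) := by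
        simp only [Matrix.transpose_sub, Matrix.transpose_mul, hPt, hAt, Matrix.sub_mul,
          Matrix.mul_sub]
        simp only [hAdef, Matrix.mul_assoc]
      rw [e1, hAPA, hAPA]; simp
    have h1 := (Matrix.conjTranspose_mul_self_eq_zero (A := Q * P * A - Q)).1
      (by rw [Matrix.conjTranspose_eq_transpose_of_trivial]; exact h0)
    exact sub_eq_zero.1 h1
  refine ⟨?_, ?_, ?_, ?_⟩
  · rw [hpinv]
    calc Q * (P * Qᵀ) * Q = Q * P * A := by simp only [hAdef, Matrix.mul_assoc]
      _ = Q := hQ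
  · rw [hpinv]
    calc P * Qᵀ * Q * (P * Qᵀ) = P * A * P * Qᵀ := by simp only [hAdef, Matrix.mul_assoc]
      _ = P * Qᵀ := by rw [hPAP]
  · rw [hpinv]; simp [Matrix.transpose_mul, hPt, Matrix.mul_assoc]
  · rw [hpinv]
    have e : P * Qᵀ * Q = P * A := by simp only [hAdef, Matrix.mul_assoc]
    rw [e, Matrix.transpose_mul, hPt, hAt, hcomm]

/-- The singular values of a matrix, in decreasing order, followed by zeros. -/
def singVals {α β : Type*} [Fintype α] [Fintype β] [DecidableEq β] (Q : Matrix α β ℝ) : ℕ →₀ ℝ :=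
  (Matrix.toEuclideanLin Q).singularValues

/-- The largest singular value. -/
def maxSing {α β : Type*} [Fintype α] [Fintype β] [DecidableEq β] (Q : Matrix α β ℝ) : ℝ :=
  singVals Q 0

/-- The smallest nonzero singular value; it is `∞` if there is none. -/
def minPosSing {α β : Type*} [Fintype α] [Fintype β] [DecidableEq β] (Q : Matrix α β ℝ) : ℝ≥0∞ :=
  ⨅ i ∈ (singVals Q).support, ENNReal.ofReal (singVals Q i)

/-! ### The loss function and the dynamics -/

/-- `ℓ(β, γ) = ‖y - X β‖² / (2 n) + ‖γ - D β‖² / (2 ν)`. -/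
def loss {n m p : ℕ} (X : Matrix (Fin n) (Fin p) ℝ) (D : Matrix (Fin m) (Fin p) ℝ)
    (y : Fin n → ℝ) (ν : ℝ) (β : Fin p → ℝ) (γ : Fin m → ℝ) : ℝ :=
  1 / (2 * n) * l2 (y - X *ᵥ β) ^ 2 + 1 / (2 * ν) * l2 (γ - D *ᵥ β) ^ 2

/-- The gradient of the loss in `β`. -/
def gradBeta {n m p : ℕ} (X : Matrix (Fin n) (Fin p) ℝ) (D : Matrix (Fin m) (Fin p) ℝ)
    (y : Fin n → ℝ) (ν : ℝ) (β : Fin p → ℝ) (γ : Fin m → ℝ) : Fin p → ℝ :=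
  scaledTranspose X *ᵥ (X *ᵥ β - y) + ν⁻¹ • (Dᵀ *ᵥ (D *ᵥ β - γ))

/-- The gradient of the loss in `γ`. -/
def gradGamma {m p : ℕ} (D : Matrix (Fin m) (Fin p) ℝ)
    (ν : ℝ) (β : Fin p → ℝ) (γ : Fin m → ℝ) : Fin m → ℝ :=
  ν⁻¹ • (γ - D *ᵥ β)

lemma l2_sq {ι : Type*} [Fintype ι] (v : ι → ℝ) : l2 v ^ 2 = v ⬝ᵥ v := by
  rw [l2, EuclideanSpace.norm_sq_eq]
  simp [dotProduct, sq]

/-- `gradBeta` and `gradGamma` are the two blocks of the gradient of `loss`. -/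
lemma hasDerivAt_loss {n m p : ℕ} (X : Matrix (Fin n) (Fin p) ℝ) (D : Matrix (Fin m) (Fin p) ℝ)
    (y : Fin n → ℝ) (ν : ℝ) (β u : Fin p → ℝ) (γ v : Fin m → ℝ) :
    HasDerivAt (fun s : ℝ => loss X D y ν (β + s • u) (γ + s • v))
      (gradBeta X D y ν β γ ⬝ᵥ u + gradGamma D ν β γ ⬝ᵥ v) 0 := by
  have quad : ∀ {ι : Type} [Fintype ι] (a b : ι → ℝ),
      HasDerivAt (fun s : ℝ => l2 (a + s • b) ^ 2) (2 * (a ⬝ᵥ b)) 0 := by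
    intro ι _ a b
    have e : (fun s : ℝ => l2 (a + s • b) ^ 2)
        = fun s : ℝ => a ⬝ᵥ a + 2 * (a ⬝ᵥ b) * s + (b ⬝ᵥ b) * s ^ 2 := by
      funext s
      rw [l2_sq]
      simp only [dotProduct_add, add_dotProduct, dotProduct_smul, smul_dotProduct, smul_eq_mul,
        dotProduct_comm b a]
      ring
    rw [e]
    have h1 := ((hasDerivAt_id (0 : ℝ)).const_mul (2 * (a ⬝ᵥ b))).const_add (a ⬝ᵥ a)
    have h2 := (hasDerivAt_pow 2 (0 : ℝ)).const_mul (b ⬝ᵥ b)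
    have h3 := h1.add h2
    simp only [mul_one, Nat.cast_ofNat, Nat.add_one_sub_one, pow_one, mul_zero, add_zero] at h3
    exact h3
  have h := ((quad (y - X *ᵥ β) (-(X *ᵥ u))).const_mul (1 / (2 * (n : ℝ)))).add
    ((quad (γ - D *ᵥ β) (v - D *ᵥ u)).const_mul (1 / (2 * ν)))
  have ht : ∀ {q : ℕ} (Q : Matrix (Fin q) (Fin p) ℝ) (w : Fin q → ℝ),
      (Qᵀ *ᵥ w) ⬝ᵥ u = w ⬝ᵥ (Q *ᵥ u) := by
    intro q Q w
    rw [Matrix.mulVec_transpose, Matrix.dotProduct_mulVec]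
  have e : (fun s : ℝ => loss X D y ν (β + s • u) (γ + s • v))
      = (fun s : ℝ => 1 / (2 * (n : ℝ)) * l2 (y - X *ᵥ β + s • (-(X *ᵥ u))) ^ 2)
        + fun s : ℝ => 1 / (2 * ν) * l2 (γ - D *ᵥ β + s • (v - D *ᵥ u)) ^ 2 := by
    funext s
    simp only [loss, Pi.add_apply, Matrix.mulVec_add, Matrix.mulVec_smul]
    congr 4 <;> module
  have hval : gradBeta X D y ν β γ ⬝ᵥ u + gradGamma D ν β γ ⬝ᵥ v
      = 1 / (2 * (n : ℝ)) * (2 * ((y - X *ᵥ β) ⬝ᵥ (-(X *ᵥ u))))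
        + 1 / (2 * ν) * (2 * ((γ - D *ᵥ β) ⬝ᵥ (v - D *ᵥ u))) := by
    simp only [gradBeta, gradGamma, scaledTranspose, add_dotProduct, smul_dotProduct, ht,
      Matrix.smul_mulVec, sub_dotProduct, dotProduct_sub, dotProduct_neg, smul_eq_mul]
    ring
  rw [e, hval]
  exact h

/-- The subdifferential of the `ℓ¹` norm at `γ`. -/
def subdiffL1 {m : ℕ} (γ : Fin m → ℝ) : Set (Fin m → ℝ) :=
  {ρ | ∀ g : Fin m → ℝ, l1 γ + ρ ⬝ᵥ (g - γ) ≤ l1 g}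

/-- `f` is continuous on `[0, ∞)` and `f'` is its right derivative there, which is right
continuous. -/
def RightC1 {d : ℕ} (f f' : ℝ → Fin d → ℝ) : Prop :=
  ContinuousOn f (Set.Ici 0) ∧
    ∀ t : ℝ, 0 ≤ t →
      HasDerivWithinAt f (f' t) (Set.Ici t) t ∧ ContinuousWithinAt f' (Set.Ici t) t

/-- `(ρ, β, γ)` solves the Split LBISS differential inclusion on `[0, ∞)`, started at zero. -/
def IsSplitLBISS {n m p : ℕ} (X : Matrix (Fin n) (Fin p) ℝ) (D : Matrix (Fin m) (Fin p) ℝ)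
    (y : Fin n → ℝ) (ν κ : ℝ) (ρ : ℝ → Fin m → ℝ) (β : ℝ → Fin p → ℝ) (γ : ℝ → Fin m → ℝ) :
    Prop :=
  ρ 0 = 0 ∧ β 0 = 0 ∧ γ 0 = 0 ∧
    ∃ (ρ' : ℝ → Fin m → ℝ) (β' : ℝ → Fin p → ℝ) (γ' : ℝ → Fin m → ℝ),
      RightC1 ρ ρ' ∧ RightC1 β β' ∧ RightC1 γ γ' ∧
      ∀ t : ℝ, 0 ≤ t →
        κ⁻¹ • β' t = -gradBeta X D y ν (β t) (γ t) ∧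
        ρ' t + κ⁻¹ • γ' t = -gradGamma D ν (β t) (γ t) ∧
        ρ t ∈ subdiffL1 (γ t)

/-! ### Assumptions -/

/-- `ℒ = Im Xᵀ + Im Dᵀ`, the orthogonal complement of `ker X ∩ ker D`. -/
def ambient {n m p : ℕ} (X : Matrix (Fin n) (Fin p) ℝ) (D : Matrix (Fin m) (Fin p) ℝ) :
    Submodule ℝ (Fin p → ℝ) :=
  LinearMap.range Xᵀ.mulVecLin ⊔ LinearMap.range Dᵀ.mulVecLin

/-- The model subspace `ℳ = ker D_{Sᶜ}`. -/
def modelSpace {m p : ℕ} (D : Matrix (Fin m) (Fin p) ℝ) (S : Finset (Fin m)) :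
    Submodule ℝ (Fin p → ℝ) :=
  LinearMap.ker (rows D Sᶜ).mulVecLin

/-- The Hessian of the loss. -/
def hess {n m p : ℕ} (X : Matrix (Fin n) (Fin p) ℝ) (D : Matrix (Fin m) (Fin p) ℝ) (ν : ℝ) :
    Matrix (Fin p ⊕ Fin m) (Fin p ⊕ Fin m) ℝ :=
  Matrix.fromBlocks (scaledTranspose X * X + ν⁻¹ • (Dᵀ * D)) (-(ν⁻¹ • Dᵀ)) (-(ν⁻¹ • D)) (ν⁻¹ • 1)

/-- The block `H_{(β,S),(β,S)}` of the Hessian. -/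
def hessOracle {n m p : ℕ} (X : Matrix (Fin n) (Fin p) ℝ) (D : Matrix (Fin m) (Fin p) ℝ) (ν : ℝ)
    (S : Finset (Fin m)) : Matrix (Fin p ⊕ S) (Fin p ⊕ S) ℝ :=
  (hess X D ν).submatrix (Sum.map id Subtype.val) (Sum.map id Subtype.val)

/-- The block `H_{Sᶜ,(β,S)}` of the Hessian. -/
def hessCross {n m p : ℕ} (X : Matrix (Fin n) (Fin p) ℝ) (D : Matrix (Fin m) (Fin p) ℝ) (ν : ℝ)
    (S : Finset (Fin m)) : Matrix (Sᶜ : Finset (Fin m)) (Fin p ⊕ S) ℝ :=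
  (hess X D ν).submatrix (fun j => Sum.inr j.1) (Sum.map id Subtype.val)

/-- Restricted strong convexity. -/
def RSC {n m p : ℕ} (X : Matrix (Fin n) (Fin p) ℝ) (D : Matrix (Fin m) (Fin p) ℝ)
    (S : Finset (Fin m)) : Prop :=
  ∃ lam : ℝ, 0 < lam ∧ ∀ β ∈ ambient X D ⊓ modelSpace D S,
    lam * l2 β ^ 2 ≤ β ⬝ᵥ ((scaledTranspose X * X) *ᵥ β)

/-- `lamH` is a strong convexity constant of the loss with parameter `ν` on `ℒ ⊕ ℝ^S`. -/
def RSCLoss {n m p : ℕ} (X : Matrix (Fin n) (Fin p) ℝ) (D : Matrix (Fin m) (Fin p) ℝ) (ν : ℝ)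
    (S : Finset (Fin m)) (lamH : ℝ) : Prop :=
  ∀ β ∈ ambient X D, ∀ g : S → ℝ,
    lamH * l2 (Sum.elim β g) ^ 2 ≤ Sum.elim β g ⬝ᵥ (hessOracle X D ν S *ᵥ Sum.elim β g)

/-- The irrepresentable condition with constant `η`; `‖·‖` is here the maximum norm. -/
def IRR {n m p : ℕ} (X : Matrix (Fin n) (Fin p) ℝ) (D : Matrix (Fin m) (Fin p) ℝ) (ν : ℝ)
    (S : Finset (Fin m)) (η : ℝ) : Prop :=
  ∀ ρ : S → ℝ, (∀ j, ρ j ∈ Set.Icc (-1 : ℝ) 1) →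
    ‖(hessCross X D ν S * pinv (hessOracle X D ν S)) *ᵥ Sum.elim (0 : Fin p → ℝ) ρ‖ ≤ 1 - η

/-! ### Quantities in the bounds -/

/-- The orthogonal projection onto `ker Q`. -/
def kerProj {α β : Type*} [Fintype α] [Fintype β] [DecidableEq β] (Q : Matrix α β ℝ) :
    Matrix β β ℝ :=
  1 - pinv Q * Q

/-- `1 / λ₁`, where `λ₁` is the smallest nonzero singular value of `X Ṽ / √n` and the columns of
`Ṽ` are an orthonormal basis of `ker D`. The matrix `X P / √n`, with `P = Ṽ Ṽᵀ` the orthogonal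
projection onto `ker D`, has the same nonzero singular values. If there are none, then `λ₁ = ∞`
and `1 / λ₁ = 0`. -/
def invLamOne {n m p : ℕ} (X : Matrix (Fin n) (Fin p) ℝ) (D : Matrix (Fin m) (Fin p) ℝ) : ℝ :=
  ((minPosSing ((√(n : ℝ))⁻¹ • (X * kerProj D)))⁻¹).toReal

/-- `r' = dim {X β : β ∈ ker D}`. -/
def rPrime {n m p : ℕ} (X : Matrix (Fin n) (Fin p) ℝ) (D : Matrix (Fin m) (Fin p) ℝ) : ℕ :=
  Module.finrank ℝ ((LinearMap.ker D.mulVecLin).map X.mulVecLin)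

/-- The stopping time `τ̄`. -/
def tauBar (n m : ℕ) (lamD LamX σ η : ℝ) : ℝ :=
  η / (8 * σ) * (lamD / LamX) * √(n / Real.log m)

/-- The lower bound on `κ`; `i₁` stands for `1 / λ₁` and `b` for `‖β⋆‖₂`. -/
def kappaBound (lamD LamD LamX lamH i₁ ν σ η b : ℝ) : ℝ :=
  4 / η * (1 + 1 / lamD + LamX / lamD * i₁)
    * (1 + √(2 * (1 + ν * LamX ^ 2 + LamD ^ 2) / (lamH * ν)))
    * ((1 + LamD) * b
      + 2 * σ / lamH
        * (LamX / lamD + LamX / lamD ^ 2 + (lamH * lamD ^ 2 + LamX ^ 2) / lamD ^ 2 * i₁))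

/-- The lower bound on the signal strength, with the nonnegative part of `log (8 Λ_D)`. -/
def signalBound (n m s : ℕ) (lamD LamD LamX lamH σ η : ℝ) : ℝ :=
  16 * σ / (η * lamH) * (LamX * LamD / lamD ^ 2)
    * (2 * Real.log s + 5 + max 0 (Real.log (8 * LamD))) * √(Real.log m / n)

/-- The part of the `ℓ²` error bound that does not involve the support mismatch; `i₁` stands
for `1 / λ₁`. -/
def errorBound (n m s r' : ℕ) (lamD LamD LamX lamH i₁ σ η : ℝ) : ℝ :=
  80 * σ / (η * lamH) * (LamX * (LamD + lamD ^ 2) / lamD ^ 3) * √(s * Real.log m / n)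
    + 2 * σ / lamH * (LamX / lamD ^ 2 + (lamH * lamD ^ 2 + LamX ^ 2) / lamD ^ 2 * i₁)
      * √(r' * Real.log m / n)

/-- The revised estimator `β̃ = P β`, with `P` the projection onto `ker D_{(supp γ)ᶜ}`. -/
def revised {m p : ℕ} (D : Matrix (Fin m) (Fin p) ℝ) (β : Fin p → ℝ) (γ : Fin m → ℝ) :
    Fin p → ℝ :=
  kerProj (rows D (supp γ)ᶜ) *ᵥ β

/-- `D_{T}† D_{T ∩ S} β⋆` with `T = (supp γ)ᶜ` and `S = supp (D β⋆)`, where the vector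
`D_{T ∩ S} β⋆` is regarded as a vector indexed by `T` that vanishes outside `S`. -/
def mismatch {m p : ℕ} (D : Matrix (Fin m) (Fin p) ℝ) (βs : Fin p → ℝ) (γ : Fin m → ℝ) :
    Fin p → ℝ :=
  pinv (rows D (supp γ)ᶜ) *ᵥ
    fun j : ((supp γ)ᶜ : Finset (Fin m)) => if j.1 ∈ supp (D *ᵥ βs) then (D *ᵥ βs) j.1 else 0

end SplitLBISS

end

/-! Write `A = X/√n`, `w = ε/√n` and `B = D_{Sᶜ}`. The path is compared not with `β⋆` but with an
oracle `(βo, γo)`: `βo = β⋆ + b`, where `b` solves `(AᵀA + ν⁻¹BᵀB) b = Aᵀw`, and `γo` is `D βo` cut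
off to `S`. The gradient of the loss vanishes there in `β` and in the `S`-coordinates of `γ`. All
noise enters through `b`, and the argument is deterministic once `w` satisfies the four bounds of
`NoiseBound`.

No false positives (`Regular.no_false_positives`). While `γ` vanishes off `S`, integrating the
equations of motion expresses `ρ` off `S` as a response of the normal equation to three sources: `ρ
+ γ/κ` on `S`, the damping term `β/κ`, and the noise accumulated up to time `t`. Irrepresentability
limits the first, the size of `κ` the second, and the choice of `τ̄` the third, so that `|ρ| ≤ 1 -
η/4`. By `IsPath.support_subset` the path then cannot leave `S` before `τ̄`.

Decay. On paths supported in `S`, the squared distance to the oracle divided by `2κ`, plus the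
Bregman distance of the `ℓ¹` norm, decreases at a rate given exactly by twice the excess loss
(`IsPath.potential_hasDeriv`). Strong convexity bounds this rate below by `λ_H` times the squared
distance, and the potential is in turn at most of order `√(s · distance²)`. The resulting
differential inequality gives distance `O(√s/(λ_H τ̄))` (`decay_sq_le`). If the oracle signal has
size `G` well above `log s/(λ_H τ̄)`, the distance drops below a prescribed fraction of `G`
(`decay_below_threshold`).

Return to `β⋆`. Projecting onto `ker D_{S(t)ᶜ}` removes the components of `D β` outside the selected
support. The error is the projected distance to the oracle, the projected `b`, and the part of `β⋆`
lost through missed support (`Regular.sign_consistent`, `Regular.l2_consistent`).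

Probability. The linear statistics of the noise are bounded by sub-Gaussian tails and a union bound,
and `‖w‖` by a Chernoff bound for `∑ ε_i²` (`Regular.noiseBound_of_event`). The component of `b` in
`ker D` depends on the noise only through `r'` coordinates, whence the additional `2r'/m²`
(`Regular.kernel_of_event`). -/

noncomputable section
namespace SplitLBISS

/-! ### Euclidean norm of vectors and matrix bounds -/

section Norm
variable {ι : Type*} [Fintype ι]

lemma l2_nonneg (v : ι → ℝ) : 0 ≤ l2 v := norm_nonneg _

lemma l2_add_le (u v : ι → ℝ) : l2 (u + v) ≤ l2 u + l2 v := by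
  simp only [l2, WithLp.toLp_add]; exact norm_add_le _ _

lemma l2_sub_le (u v : ι → ℝ) : l2 (u - v) ≤ l2 u + l2 v := by
  simp only [l2, WithLp.toLp_sub]; exact norm_sub_le _ _

lemma l2_smul (c : ℝ) (v : ι → ℝ) : l2 (c • v) = |c| * l2 v := by
  simp only [l2, WithLp.toLp_smul, norm_smul, Real.norm_eq_abs]

lemma l2_neg (v : ι → ℝ) : l2 (-v) = l2 v := by
  simp only [l2, WithLp.toLp_neg, norm_neg]

@[simp] lemma l2_zero : l2 (0 : ι → ℝ) = 0 := by simp [l2]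

lemma l2_eq_zero {v : ι → ℝ} (h : l2 v = 0) : v = 0 := by
  have : (WithLp.toLp 2 v : EuclideanSpace ℝ ι) = 0 := norm_eq_zero.1 h
  simpa using congrArg WithLp.ofLp this

lemma dot_eq_inner (u v : ι → ℝ) :
    u ⬝ᵥ v = inner ℝ (WithLp.toLp 2 u : EuclideanSpace ℝ ι) (WithLp.toLp 2 v) := by
  simp [dotProduct, PiLp.inner_apply, mul_comm]

lemma dot_le_l2 (u v : ι → ℝ) : u ⬝ᵥ v ≤ l2 u * l2 v := by
  rw [dot_eq_inner]; exact real_inner_le_norm _ _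

lemma abs_le_l2 (v : ι → ℝ) (i : ι) : |v i| ≤ l2 v := by
  simpa [l2] using PiLp.norm_apply_le (WithLp.toLp 2 v : EuclideanSpace ℝ ι) i

lemma l2_sq_eq_sum (v : ι → ℝ) : l2 v ^ 2 = ∑ i, v i ^ 2 := by
  rw [l2_sq]; simp [dotProduct, sq]

/-- Cancels one factor of the norm without a separate treatment of zero; most operator bounds below
come from pairing a vector with itself and ending here. -/
lemma l2_le_of_sq_le {v : ι → ℝ} {c : ℝ} (hc : 0 ≤ c) (h : l2 v ^ 2 ≤ c * l2 v) : l2 v ≤ c := by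
  rcases (l2_nonneg v).eq_or_lt with h0 | h0
  · rw [← h0]; exact hc
  · nlinarith

lemma l2_le_of_sq_le_sq {v : ι → ℝ} {c : ℝ} (hc : 0 ≤ c) (h : l2 v ^ 2 ≤ c ^ 2) : l2 v ≤ c :=
  abs_le_of_sq_le_sq' h hc |>.2

end Norm

section Transpose
variable {α β : Type*} [Fintype α] [Fintype β]

lemma transpose_mulVec_dot (Q : Matrix α β ℝ) (u : α → ℝ) (v : β → ℝ) :
    (Qᵀ *ᵥ u) ⬝ᵥ v = u ⬝ᵥ (Q *ᵥ v) := by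
  rw [Matrix.mulVec_transpose, Matrix.dotProduct_mulVec]

lemma dot_transpose_mulVec (Q : Matrix α β ℝ) (u : α → ℝ) (v : β → ℝ) :
    v ⬝ᵥ (Qᵀ *ᵥ u) = (Q *ᵥ v) ⬝ᵥ u := by
  rw [dotProduct_comm, transpose_mulVec_dot, dotProduct_comm]

/-- A bound for a matrix as an operator passes to its transpose. -/
lemma l2_transpose_le {Q : Matrix α β ℝ} {c : ℝ} (hc : 0 ≤ c) (h : ∀ x, l2 (Q *ᵥ x) ≤ c * l2 x)
    (y : α → ℝ) : l2 (Qᵀ *ᵥ y) ≤ c * l2 y := by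
  apply l2_le_of_sq_le (mul_nonneg hc (l2_nonneg _))
  rw [l2_sq, transpose_mulVec_dot]
  calc _ ≤ l2 y * l2 (Q *ᵥ (Qᵀ *ᵥ y)) := dot_le_l2 _ _
    _ ≤ l2 y * (c * l2 (Qᵀ *ᵥ y)) := mul_le_mul_of_nonneg_left (h _) (l2_nonneg _)
    _ = _ := by ring

/-- The rows of a matrix are bounded by its operator norm. -/
lemma l2_row_le {Q : Matrix α β ℝ} {c : ℝ} (hc : 0 ≤ c) (h : ∀ x, l2 (Q *ᵥ x) ≤ c * l2 x)
    (i : α) : l2 (Q i) ≤ c := by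
  apply l2_le_of_sq_le hc
  calc l2 (Q i) ^ 2 = (Q *ᵥ (Q i)) i := by rw [l2_sq]; rfl
    _ ≤ |(Q *ᵥ (Q i)) i| := le_abs_self _
    _ ≤ l2 (Q *ᵥ (Q i)) := abs_le_l2 _ _
    _ ≤ c * l2 (Q i) := h _

end Transpose

/-! ### The pseudoinverse and projections onto kernels -/

section Pinv
variable {α β : Type*} [Fintype α] [Fintype β] [DecidableEq β] (Q : Matrix α β ℝ)

lemma mul_pinv_mul : Q * pinv Q * Q = Q := (pinv_penrose Q).1
lemma pinv_mul_pinv : pinv Q * Q * pinv Q = pinv Q := (pinv_penrose Q).2.1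
lemma mul_pinv_symm : (Q * pinv Q)ᵀ = Q * pinv Q := (pinv_penrose Q).2.2.1
lemma pinv_mul_symm : (pinv Q * Q)ᵀ = pinv Q * Q := (pinv_penrose Q).2.2.2

/-- `Q Q†` is the orthogonal projection onto the range of `Q`, whose complement `Qᵀ` kills. In this
form it says that `Q† y` solves the normal equation. -/
lemma transpose_mul_pinv : Qᵀ * (Q * pinv Q) = Qᵀ := by
  conv_rhs => rw [← mul_pinv_mul Q, Matrix.transpose_mul, mul_pinv_symm]

lemma pinv_mul_eq : pinv Q * Q = Qᵀ * (pinv Q)ᵀ := by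
  rw [← pinv_mul_symm, Matrix.transpose_mul]

lemma pinv_eq_transpose_mul : pinv Q = Qᵀ * ((pinv Q)ᵀ * pinv Q) := by
  rw [← Matrix.mul_assoc, ← pinv_mul_eq, pinv_mul_pinv]

lemma mul_pinv_mul_pinv_transpose : Q * pinv Q * (pinv Q)ᵀ = (pinv Q)ᵀ := by
  conv_rhs => rw [← pinv_mul_pinv Q, Matrix.mul_assoc, Matrix.transpose_mul, mul_pinv_symm]

lemma mul_kerProj : Q * kerProj Q = 0 := by
  rw [kerProj, Matrix.mul_sub, ← Matrix.mul_assoc, mul_pinv_mul]; simp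

lemma kerProj_symm : (kerProj Q)ᵀ = kerProj Q := by
  rw [kerProj, Matrix.transpose_sub, pinv_mul_symm]; simp

lemma kerProj_mul_self : kerProj Q * kerProj Q = kerProj Q := by
  conv_lhs => enter [1]; rw [kerProj]
  rw [Matrix.sub_mul, Matrix.mul_assoc, mul_kerProj]; simp

lemma kerProj_mulVec_of_ker {x : β → ℝ} (h : Q *ᵥ x = 0) : kerProj Q *ᵥ x = x := by
  rw [kerProj, Matrix.sub_mulVec, ← Matrix.mulVec_mulVec, h]; simp

lemma mulVec_kerProj (x : β → ℝ) : Q *ᵥ (kerProj Q *ᵥ x) = 0 := by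
  rw [Matrix.mulVec_mulVec, mul_kerProj]; simp

/-- Symmetric idempotent matrices are contractions. -/
lemma l2_proj_le {ι : Type*} [Fintype ι] {P : Matrix ι ι ℝ} (hs : Pᵀ = P) (hi : P * P = P)
    (x : ι → ℝ) : l2 (P *ᵥ x) ≤ l2 x := by
  apply l2_le_of_sq_le (l2_nonneg _)
  rw [l2_sq]
  conv_lhs => enter [1, 1]; rw [← hs]
  rw [transpose_mulVec_dot, Matrix.mulVec_mulVec, hi]
  exact dot_le_l2 _ _

lemma l2_kerProj_le (x : β → ℝ) : l2 (kerProj Q *ᵥ x) ≤ l2 x :=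
  l2_proj_le (kerProj_symm Q) (kerProj_mul_self Q) x

lemma l2_mul_pinv_le (y : α → ℝ) : l2 ((Q * pinv Q) *ᵥ y) ≤ l2 y :=
  l2_proj_le (mul_pinv_symm Q) (by rw [← Matrix.mul_assoc, mul_pinv_mul]) y

end Pinv

/-! ### Singular values as bounds for `Q` and its pseudoinverse -/

section SingularValues
variable {α β : Type*} [Fintype α] [Fintype β] [DecidableEq β] (Q : Matrix α β ℝ)

/-- Singular value decomposition: an orthonormal basis of the domain whose image is orthogonal,
with the singular values as lengths. -/
lemma exists_singular_basis :
    ∃ (k : ℕ) (e : OrthonormalBasis (Fin k) ℝ (EuclideanSpace ℝ β)),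
      (∀ i, Qᵀ *ᵥ (Q *ᵥ (e i).ofLp) = (singVals Q i) ^ 2 • (e i).ofLp) ∧ k = Fintype.card β := by
  classical
  set T := Matrix.toEuclideanLin Q with hT
  have hsym := T.isSymmetric_adjoint_comp_self
  have hfr : Module.finrank ℝ (EuclideanSpace ℝ β) = Fintype.card β := by simp
  refine ⟨Fintype.card β, hsym.eigenvectorBasis hfr, fun i => ?_, rfl⟩
  have h := hsym.apply_eigenvectorBasis hfr i
  rw [← T.sq_singularValues_fin hfr i] at h
  have h' := congrArg WithLp.ofLp h
  have hadj : T.adjoint = Matrix.toEuclideanLin Qᵀ := by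
    rw [hT, ← Matrix.conjTranspose_eq_transpose_of_trivial,
      Matrix.toEuclideanLin_conjTranspose_eq_adjoint]
  have h2 : (T.adjoint (T (hsym.eigenvectorBasis hfr i))).ofLp
      = Qᵀ *ᵥ (Q *ᵥ (hsym.eigenvectorBasis hfr i).ofLp) := by
    generalize hsym.eigenvectorBasis hfr i = v
    rw [hadj, hT]
    simp [Matrix.toLpLin_apply]
  rw [← h2]
  exact h'

/-- Lengths of a vector and of its image in terms of singular values. -/
lemma exists_singular_coords :
    ∃ k : ℕ, ∀ x : β → ℝ, ∃ c : Fin k → ℝ, l2 x ^ 2 = ∑ i, c i ^ 2 ∧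
      l2 (Q *ᵥ x) ^ 2 = ∑ i : Fin k, (singVals Q i) ^ 2 * c i ^ 2 ∧
      ∀ y, x = Qᵀ *ᵥ y → ∀ i : Fin k, singVals Q i = 0 → c i = 0 := by
  obtain ⟨k, e, he, -⟩ := exists_singular_basis Q
  refine ⟨k, fun x => ⟨fun i => (e i).ofLp ⬝ᵥ x, ?_, ?_, ?_⟩⟩
  · have := e.sum_sq_norm_inner_right (WithLp.toLp 2 x)
    rw [l2, ← this]
    refine Finset.sum_congr rfl fun i _ => ?_
    simp only [dot_eq_inner, Real.norm_eq_abs, sq_abs]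
  · have h1 : l2 (Q *ᵥ x) ^ 2 = (Qᵀ *ᵥ (Q *ᵥ x)) ⬝ᵥ x := by
      rw [transpose_mulVec_dot, l2_sq]
    rw [h1, dot_eq_inner, ← e.sum_inner_mul_inner]
    refine Finset.sum_congr rfl fun i _ => ?_
    have h2 : inner ℝ (WithLp.toLp 2 (Qᵀ *ᵥ (Q *ᵥ x)) : EuclideanSpace ℝ β) (e i)
        = (Qᵀ *ᵥ (Q *ᵥ x)) ⬝ᵥ (e i).ofLp := by rw [dot_eq_inner]
    have h3 : inner ℝ (e i) (WithLp.toLp 2 x : EuclideanSpace ℝ β) = (e i).ofLp ⬝ᵥ x := by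
      rw [dot_eq_inner]
    have h4 : (Qᵀ *ᵥ (Q *ᵥ x)) ⬝ᵥ (e i).ofLp = singVals Q i ^ 2 * ((e i).ofLp ⬝ᵥ x) := by
      rw [transpose_mulVec_dot, ← dot_transpose_mulVec, he i, dotProduct_smul, smul_eq_mul,
        dotProduct_comm]
    rw [h2, h3, h4]; ring
  · rintro y rfl i hi
    have h0 : Q *ᵥ (e i).ofLp = 0 := by
      apply l2_eq_zero
      have : l2 (Q *ᵥ (e i).ofLp) ^ 2 = 0 := by
        rw [l2_sq, ← transpose_mulVec_dot, he i, hi]; simp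
      exact pow_eq_zero_iff (two_ne_zero) |>.1 this
    simp only
    rw [dot_transpose_mulVec, h0, zero_dotProduct]

lemma l2_mulVec_le_maxSing (x : β → ℝ) : l2 (Q *ᵥ x) ≤ maxSing Q * l2 x := by
  have hnn : ∀ i, 0 ≤ singVals Q i := fun i => LinearMap.singularValues_nonneg _ i
  obtain ⟨k, hk⟩ := exists_singular_coords Q
  obtain ⟨c, h1, h2, -⟩ := hk x
  apply l2_le_of_sq_le_sq (mul_nonneg (hnn 0) (l2_nonneg _))
  rw [h2, mul_pow, h1, Finset.mul_sum]
  refine Finset.sum_le_sum fun i _ => mul_le_mul_of_nonneg_right ?_ (sq_nonneg _)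
  exact pow_le_pow_left₀ (hnn i) (LinearMap.singularValues_antitone _ (Nat.zero_le _)) 2

/-- Only finitely many singular values are nonzero, so the infimum stays away from zero. Hence its
inverse is finite, and `toReal` does not return the default value at `∞`. -/
lemma minPosSing_ne_zero : minPosSing Q ≠ 0 := by
  have hnn : ∀ i, 0 ≤ singVals Q i := fun i => LinearMap.singularValues_nonneg _ i
  intro h
  have : ∃ δ : ℝ≥0∞, 0 < δ ∧ ∀ i ∈ (singVals Q).support, δ ≤ ENNReal.ofReal (singVals Q i) := by
    rcases (singVals Q).support.eq_empty_or_nonempty with h0 | h0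
    · exact ⟨1, one_pos, by simp [h0]⟩
    · obtain ⟨i, hi, hmin⟩ := (singVals Q).support.exists_min_image
        (fun i => ENNReal.ofReal (singVals Q i)) h0
      refine ⟨_, ?_, hmin⟩
      rw [ENNReal.ofReal_pos]
      exact lt_of_le_of_ne (hnn i) (Ne.symm (Finsupp.mem_support_iff.1 hi))
  obtain ⟨δ, hδ, hall⟩ := this
  have : δ ≤ minPosSing Q := le_iInf₂ hall
  rw [h] at this
  exact absurd hδ (not_lt.2 this)

lemma one_le_inv_minPosSing_mul {i : ℕ} (hi : singVals Q i ≠ 0) :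
    1 ≤ ((minPosSing Q)⁻¹).toReal * singVals Q i := by
  have hnn : 0 ≤ singVals Q i := LinearMap.singularValues_nonneg _ i
  have hpos : 0 < singVals Q i := lt_of_le_of_ne hnn (Ne.symm hi)
  have h1 : minPosSing Q ≤ ENNReal.ofReal (singVals Q i) :=
    iInf₂_le i (Finsupp.mem_support_iff.2 hi)
  have h2 : (ENNReal.ofReal (singVals Q i))⁻¹ ≤ (minPosSing Q)⁻¹ := ENNReal.inv_le_inv.2 h1
  have h3 : (singVals Q i)⁻¹ ≤ ((minPosSing Q)⁻¹).toReal := by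
    rw [← ENNReal.ofReal_inv_of_pos hpos] at h2
    exact (ENNReal.ofReal_le_iff_le_toReal
      (ENNReal.inv_ne_top.2 (minPosSing_ne_zero Q))).1 h2
  calc (1 : ℝ) = (singVals Q i)⁻¹ * singVals Q i := (inv_mul_cancel₀ hi).symm
    _ ≤ _ := mul_le_mul_of_nonneg_right h3 hnn

/-- Vectors in the range of `Qᵀ` have no component along right singular directions with value zero,
and every other direction is stretched by at least the least nonzero value. -/
lemma l2_le_of_mem_range_transpose (y : α → ℝ) :
    l2 (Qᵀ *ᵥ y) ≤ ((minPosSing Q)⁻¹).toReal * l2 (Q *ᵥ (Qᵀ *ᵥ y)) := by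
  obtain ⟨k, hk⟩ := exists_singular_coords Q
  obtain ⟨c, h1, h2, h3⟩ := hk (Qᵀ *ᵥ y)
  apply l2_le_of_sq_le_sq (mul_nonneg ENNReal.toReal_nonneg (l2_nonneg _))
  rw [mul_pow, h1, h2, Finset.mul_sum]
  refine Finset.sum_le_sum fun i _ => ?_
  by_cases hi : singVals Q i = 0
  · rw [h3 y rfl i hi]; simp
  · have := one_le_inv_minPosSing_mul Q hi
    rw [← mul_assoc, ← mul_pow]
    nlinarith [sq_nonneg (c i), one_le_pow₀ this (n := 2)]

/-- The operator norm of the pseudoinverse is the inverse of the least nonzero singular value. -/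
lemma l2_pinv_le (y : α → ℝ) : l2 (pinv Q *ᵥ y) ≤ ((minPosSing Q)⁻¹).toReal * l2 y := by
  have h : pinv Q *ᵥ y = Qᵀ *ᵥ (((pinv Q)ᵀ * pinv Q) *ᵥ y) := by
    rw [Matrix.mulVec_mulVec, ← pinv_eq_transpose_mul]
  calc l2 (pinv Q *ᵥ y) ≤ ((minPosSing Q)⁻¹).toReal * l2 (Q *ᵥ (pinv Q *ᵥ y)) := by
        rw [h]; exact l2_le_of_mem_range_transpose Q _
    _ ≤ _ := by
        refine mul_le_mul_of_nonneg_left ?_ ENNReal.toReal_nonneg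
        rw [Matrix.mulVec_mulVec]; exact l2_mul_pinv_le Q y

lemma l2_pinv_le_of_le_minPosSing {lam : ℝ} (hlam : 0 < lam)
    (h : ENNReal.ofReal lam ≤ minPosSing Q) (y : α → ℝ) : l2 (pinv Q *ᵥ y) ≤ lam⁻¹ * l2 y := by
  refine (l2_pinv_le Q y).trans (mul_le_mul_of_nonneg_right ?_ (l2_nonneg _))
  have h2 := ENNReal.inv_le_inv.2 h
  rw [← ENNReal.ofReal_inv_of_pos hlam] at h2
  exact ENNReal.toReal_le_of_le_ofReal (inv_nonneg.2 hlam.le) h2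

end SingularValues

/-! ### Splitting vectors and rows along a support -/

section Mask
variable {m p : ℕ}

/-- The vector `v` with the coordinates outside `S` replaced by zero. -/
def mask (S : Finset (Fin m)) (v : Fin m → ℝ) : Fin m → ℝ := fun j => if j ∈ S then v j else 0

lemma mask_of_mem {S : Finset (Fin m)} (v : Fin m → ℝ) {j : Fin m} (hj : j ∈ S) :
    mask S v j = v j := if_pos hj

lemma mask_of_notMem {S : Finset (Fin m)} (v : Fin m → ℝ) {j : Fin m} (hj : j ∉ S) :
    mask S v j = 0 := if_neg hj

lemma rows_mulVec (D : Matrix (Fin m) (Fin p) ℝ) (J : Finset (Fin m)) (x : Fin p → ℝ) (j : J) :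
    (rows D J *ᵥ x) j = (D *ᵥ x) j.1 := rfl

lemma l2_sq_split (S : Finset (Fin m)) (v : Fin m → ℝ) :
    l2 v ^ 2 = l2 (mask S v) ^ 2 + l2 (fun j : (Sᶜ : Finset (Fin m)) => v j.1) ^ 2 := by
  simp only [l2_sq_eq_sum]
  rw [Finset.sum_coe_sort Sᶜ (fun j => v j ^ 2), ← Finset.sum_add_sum_compl S (fun j => v j ^ 2)]
  congr 1
  rw [← Finset.sum_subset (Finset.subset_univ S)]
  · exact Finset.sum_congr rfl fun j hj => by rw [mask_of_mem v hj]
  · intro j _ hj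
    rw [mask_of_notMem v hj]; simp

lemma transpose_mulVec_split (D : Matrix (Fin m) (Fin p) ℝ) (S : Finset (Fin m)) (v : Fin m → ℝ) :
    Dᵀ *ᵥ v = (rows D Sᶜ)ᵀ *ᵥ (fun j : (Sᶜ : Finset (Fin m)) => v j.1) + Dᵀ *ᵥ mask S v := by
  funext i
  simp only [Matrix.mulVec, dotProduct, Pi.add_apply, Matrix.transpose_apply]
  have h : ∑ j : (Sᶜ : Finset (Fin m)), rows D Sᶜ j i * v j.1 = ∑ j ∈ Sᶜ, D j i * v j :=
    Finset.sum_coe_sort Sᶜ (fun j => D j i * v j)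
  rw [h, ← Finset.sum_add_sum_compl S (fun j => D j i * v j), add_comm]
  congr 1
  rw [← Finset.sum_subset (Finset.subset_univ S)]
  · exact Finset.sum_congr rfl fun j hj => by rw [mask_of_mem v hj]
  · intro j _ hj
    rw [mask_of_notMem v hj]; simp

lemma rows_transpose_mulVec (D : Matrix (Fin m) (Fin p) ℝ) (S : Finset (Fin m))
    (y : (Sᶜ : Finset (Fin m)) → ℝ) : ∃ v : Fin m → ℝ, (rows D Sᶜ)ᵀ *ᵥ y = Dᵀ *ᵥ v := by
  refine ⟨fun j => if h : j ∈ Sᶜ then y ⟨j, h⟩ else 0, ?_⟩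
  rw [transpose_mulVec_split D S]
  have h1 : mask S (fun j => if h : j ∈ Sᶜ then y ⟨j, h⟩ else 0) = 0 := by
    funext j
    by_cases hj : j ∈ S
    · rw [mask_of_mem _ hj]; simp [hj]
    · rw [mask_of_notMem _ hj]; rfl
  have h2 : (fun j : (Sᶜ : Finset (Fin m)) => if h : j.1 ∈ Sᶜ then y ⟨j.1, h⟩ else 0) = y := by
    funext j; rw [dif_pos j.2]
  rw [h1, h2]; simp

end Mask

/-! ### The normal equation and its solutions -/

section Response
variable {α β ι : Type*} [Fintype α] [Fintype β] [Fintype ι]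

/-- `b` solves the normal equation `(Aᵀ A + ν⁻¹ Bᵀ B) b = u`. -/
def Resp (A : Matrix α ι ℝ) (B : Matrix β ι ℝ) (ν : ℝ) (b u : ι → ℝ) : Prop :=
  Aᵀ *ᵥ (A *ᵥ b) + ν⁻¹ • (Bᵀ *ᵥ (B *ᵥ b)) = u

variable {A : Matrix α ι ℝ} {B : Matrix β ι ℝ} {ν : ℝ}

lemma Resp.add {b u b' u' : ι → ℝ} (h : Resp A B ν b u) (h' : Resp A B ν b' u') :
    Resp A B ν (b + b') (u + u') := by
  unfold Resp at *
  rw [← h, ← h']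
  simp only [Matrix.mulVec_add, smul_add]; abel

lemma Resp.smul {b u : ι → ℝ} (h : Resp A B ν b u) (c : ℝ) : Resp A B ν (c • b) (c • u) := by
  unfold Resp at *
  rw [← h]
  simp only [Matrix.mulVec_smul, smul_add, smul_comm c]

lemma Resp.dot {b u : ι → ℝ} (h : Resp A B ν b u) (x : ι → ℝ) :
    (A *ᵥ b) ⬝ᵥ (A *ᵥ x) + ν⁻¹ * ((B *ᵥ b) ⬝ᵥ (B *ᵥ x)) = u ⬝ᵥ x := by
  rw [← h, add_dotProduct, smul_dotProduct, transpose_mulVec_dot, transpose_mulVec_dot,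
    smul_eq_mul]

/-- The difference `δ` of two solutions satisfies `‖A δ‖² + ν⁻¹‖B δ‖² = 0`. Solutions may differ on
the common kernel, but their image under `B`, which determines `ρ` off `S`, does not. -/
lemma Resp.unique (hν : 0 < ν) {b b' u : ι → ℝ} (h : Resp A B ν b u) (h' : Resp A B ν b' u) :
    B *ᵥ b = B *ᵥ b' := by
  have h0 := (h.add (h'.smul (-1))).dot (b + (-1 : ℝ) • b')
  rw [show u + (-1 : ℝ) • u = 0 by module, zero_dotProduct, ← l2_sq, ← l2_sq] at h0
  have h1 : l2 (B *ᵥ (b + (-1 : ℝ) • b')) ^ 2 = 0 := by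
    have := inv_pos.2 hν
    have h2 := mul_nonneg this.le (sq_nonneg (l2 (B *ᵥ (b + (-1 : ℝ) • b'))))
    have h3 : ν⁻¹ * l2 (B *ᵥ (b + (-1 : ℝ) • b')) ^ 2 = 0 := by
      nlinarith [sq_nonneg (l2 (A *ᵥ (b + (-1 : ℝ) • b')))]
    exact (mul_eq_zero.1 h3).resolve_left this.ne'
  have h2 := l2_eq_zero (pow_eq_zero_iff two_ne_zero |>.1 h1)
  rw [Matrix.mulVec_add, Matrix.mulVec_smul] at h2
  have h3 : B *ᵥ b - B *ᵥ b' = 0 := by rw [← h2]; module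
  exact sub_eq_zero.1 h3

lemma Resp.l2_residual_le (hν : 0 < ν) {b : ι → ℝ} {w : α → ℝ} (h : Resp A B ν b (Aᵀ *ᵥ w)) :
    l2 (w - A *ᵥ b) ≤ l2 w := by
  apply l2_le_of_sq_le_sq (l2_nonneg _)
  have h1 := h.dot b
  rw [transpose_mulVec_dot, ← l2_sq, ← l2_sq] at h1
  have h2 : l2 (w - A *ᵥ b) ^ 2 = l2 w ^ 2 - 2 * (w ⬝ᵥ (A *ᵥ b)) + l2 (A *ᵥ b) ^ 2 := by
    simp only [l2_sq, sub_dotProduct, dotProduct_sub, dotProduct_comm w]; ring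
  have h3 := mul_nonneg (inv_pos.2 hν).le (sq_nonneg (l2 (B *ᵥ b)))
  rw [h2, ← h1]
  nlinarith [sq_nonneg (l2 (A *ᵥ b))]

variable [DecidableEq ι] (A B ν)

/-- The least squares matrix whose Gram matrix is `Aᵀ A + ν⁻¹ Bᵀ B`. -/
def stacked : Matrix (α ⊕ β) ι ℝ := Matrix.fromRows A ((√ν)⁻¹ • B)

variable {ν}

/-- This is the normal equation of a least squares problem for the stacked matrix; the weight `ν⁻¹`
is shared as `(√ν)⁻¹` between the matrix and its transpose, which leaves one such factor on the data
`x`. -/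
lemma resp_pinv_stacked (hν : 0 < ν) (y : α → ℝ) (x : β → ℝ) :
    Resp A B ν (pinv (stacked A B ν) *ᵥ Sum.elim y x) (Aᵀ *ᵥ y + (√ν)⁻¹ • (Bᵀ *ᵥ x)) := by
  have key : ∀ z : ι → ℝ, (stacked A B ν)ᵀ *ᵥ (stacked A B ν *ᵥ z)
      = Aᵀ *ᵥ (A *ᵥ z) + ν⁻¹ • (Bᵀ *ᵥ (B *ᵥ z)) := by
    intro z
    rw [stacked, Matrix.fromRows_mulVec, Matrix.transpose_fromRows, Matrix.fromCols_mulVec]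
    simp only [Sum.elim_comp_inl, Sum.elim_comp_inr, Matrix.transpose_smul, Matrix.smul_mulVec,
      Matrix.mulVec_smul, smul_smul]
    congr 2
    rw [← mul_inv, Real.mul_self_sqrt hν.le]
  unfold Resp
  rw [← key, Matrix.mulVec_mulVec, Matrix.mulVec_mulVec, Matrix.mul_assoc, transpose_mul_pinv, stacked,
    Matrix.transpose_fromRows, Matrix.fromCols_mulVec]
  simp [Matrix.smul_mulVec]

/-- The pseudoinverse selects the solution in the row space. This keeps responses inside `ℒ`, where
strong convexity is available. -/
lemma exists_pinv_stacked (y : α ⊕ β → ℝ) :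
    ∃ (y' : α → ℝ) (x' : β → ℝ), pinv (stacked A B ν) *ᵥ y = Aᵀ *ᵥ y' + Bᵀ *ᵥ x' := by
  set z := ((pinv (stacked A B ν))ᵀ * pinv (stacked A B ν)) *ᵥ y with hz
  refine ⟨z ∘ Sum.inl, (√ν)⁻¹ • (z ∘ Sum.inr), ?_⟩
  rw [pinv_eq_transpose_mul, ← Matrix.mulVec_mulVec, ← hz, stacked, Matrix.transpose_fromRows,
    Matrix.fromCols_mulVec]
  simp [Matrix.smul_mulVec, Matrix.mulVec_smul]

variable (ν)

/-- The matrix which maps `w` to a solution of `(Aᵀ A + ν⁻¹ Bᵀ B) b = Aᵀ w`. -/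
def noiseResp [DecidableEq α] : Matrix ι α ℝ :=
  pinv (stacked A B ν) * Matrix.fromRows (1 : Matrix α α ℝ) (0 : Matrix β α ℝ)

variable {ν}

lemma noiseResp_mulVec [DecidableEq α] (w : α → ℝ) :
    noiseResp A B ν *ᵥ w = pinv (stacked A B ν) *ᵥ Sum.elim w 0 := by
  rw [noiseResp, ← Matrix.mulVec_mulVec, Matrix.fromRows_mulVec]; simp

lemma resp_noiseResp [DecidableEq α] (hν : 0 < ν) (w : α → ℝ) :
    Resp A B ν (noiseResp A B ν *ᵥ w) (Aᵀ *ᵥ w) := by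
  rw [noiseResp_mulVec]
  simpa using resp_pinv_stacked A B hν w 0

variable {A B}

/-- The response outside the support, controlled by the bound `c` for `B†`. -/
lemma Resp.l2_mulVec_le (hν : 0 < ν) {a c : ℝ} (ha : 0 ≤ a) (hc : 0 ≤ c)
    (hA : ∀ x, l2 (A *ᵥ x) ≤ a * l2 x) (hB : ∀ y, l2 (pinv B *ᵥ y) ≤ c * l2 y)
    {b : ι → ℝ} {w : α → ℝ} (h : Resp A B ν b (Aᵀ *ᵥ w)) :
    l2 (B *ᵥ b) ≤ ν * (a * c * l2 w) := by
  have hw := l2_nonneg w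
  apply l2_le_of_sq_le (by positivity)
  have h1 : Bᵀ *ᵥ (B *ᵥ b) = ν • (Aᵀ *ᵥ (w - A *ᵥ b)) := by
    unfold Resp at h
    rw [Matrix.mulVec_sub, ← h, add_sub_cancel_left, smul_smul, mul_inv_cancel₀ hν.ne', one_smul]
  -- Since `B B† B = B`, one factor `B b` can be moved through `B†`. The other becomes `BᵀB b`,
  -- which the normal equation turns into the residual of `w`.
  have h2 : l2 (B *ᵥ b) ^ 2 = (Bᵀ *ᵥ (B *ᵥ b)) ⬝ᵥ (pinv B *ᵥ (B *ᵥ b)) := by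
    rw [transpose_mulVec_dot, Matrix.mulVec_mulVec, Matrix.mulVec_mulVec, mul_pinv_mul,
      l2_sq]
  calc l2 (B *ᵥ b) ^ 2 ≤ l2 (Bᵀ *ᵥ (B *ᵥ b)) * l2 (pinv B *ᵥ (B *ᵥ b)) := by
        rw [h2]; exact dot_le_l2 _ _
    _ ≤ (ν * (a * l2 w)) * (c * l2 (B *ᵥ b)) := by
        refine mul_le_mul ?_ (hB _) (l2_nonneg _) (by positivity)
        rw [h1, l2_smul, abs_of_pos hν]
        refine mul_le_mul_of_nonneg_left ?_ hν.le
        exact (l2_transpose_le ha hA _).trans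
          (mul_le_mul_of_nonneg_left (h.l2_residual_le hν) ha)
    _ = _ := by ring

end Response

/-! ### Regular designs and strong convexity -/

/-- The consequences of the assumptions of the theorem which concern the design `A = X / √n`, the
transformation `D` and the support `S`, with `L` the ambient subspace. -/
structure Regular {n m p : ℕ} (A : Matrix (Fin n) (Fin p) ℝ) (D : Matrix (Fin m) (Fin p) ℝ)
    (L : Submodule ℝ (Fin p → ℝ)) (S : Finset (Fin m)) (ν η lamH lamD LamD LamX i₁ : ℝ) : Prop where
  nonempty : S.Nonempty
  nu_pos : 0 < ν
  eta_pos : 0 < η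
  eta_le : η ≤ 1
  lamH_pos : 0 < lamH
  lamD_pos : 0 < lamD
  LamD_pos : 0 < LamD
  LamX_pos : 0 < LamX
  i₁_nonneg : 0 ≤ i₁
  normA : ∀ x, l2 (A *ᵥ x) ≤ LamX * l2 x
  normD : ∀ x, l2 (D *ᵥ x) ≤ LamD * l2 x
  pinvD : ∀ y, l2 (pinv D *ᵥ y) ≤ lamD⁻¹ * l2 y
  pinvB : ∀ y, l2 (pinv (rows D Sᶜ) *ᵥ y) ≤ lamD⁻¹ * l2 y
  pinvK : ∀ y, l2 (pinv (A * kerProj D) *ᵥ y) ≤ i₁ * l2 y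
  memA : ∀ y, Aᵀ *ᵥ y ∈ L
  memD : ∀ y, Dᵀ *ᵥ y ∈ L
  rsc : ∀ b ∈ L, ∀ g : Fin m → ℝ, (∀ j ∉ S, g j = 0) →
    lamH * (l2 b ^ 2 + l2 g ^ 2) ≤ l2 (A *ᵥ b) ^ 2 + ν⁻¹ * l2 (g - D *ᵥ b) ^ 2
  irr : ∀ (v : Fin m → ℝ) (M : ℝ), (∀ j ∈ S, |v j| ≤ M) →
    ∃ b, Resp A (rows D Sᶜ) ν b (Dᵀ *ᵥ mask S v) ∧
      ∀ j, |(rows D Sᶜ *ᵥ b) j| ≤ ν * ((1 - η) * M)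

namespace Regular
variable {n m p : ℕ} {A : Matrix (Fin n) (Fin p) ℝ} {D : Matrix (Fin m) (Fin p) ℝ}
  {L : Submodule ℝ (Fin p → ℝ)} {S : Finset (Fin m)} {ν η lamH lamD LamD LamX i₁ : ℝ}

lemma memB (h : Regular A D L S ν η lamH lamD LamD LamX i₁) (y : (Sᶜ : Finset (Fin m)) → ℝ) :
    (rows D Sᶜ)ᵀ *ᵥ y ∈ L := by
  obtain ⟨v, hv⟩ := rows_transpose_mulVec D S y
  rw [hv]; exact h.memD v

lemma noiseResp_mem (h : Regular A D L S ν η lamH lamD LamD LamX i₁) (w : Fin n → ℝ) :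
    noiseResp A (rows D Sᶜ) ν *ᵥ w ∈ L := by
  obtain ⟨y, x, hyx⟩ := exists_pinv_stacked A (rows D Sᶜ) (ν := ν) (Sum.elim w 0)
  rw [noiseResp_mulVec, hyx]
  exact L.add_mem (h.memA _) (h.memB _)

lemma eq_zero_of_ker (h : Regular A D L S ν η lamH lamD LamD LamX i₁) {b : Fin p → ℝ} (hb : b ∈ L)
    (hA : A *ᵥ b = 0) (hD : D *ᵥ b = 0) : b = 0 := by
  have := h.rsc b hb 0 (fun _ _ => rfl)
  rw [hA, hD] at this
  simp only [l2_zero, sub_zero] at this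
  have h1 : l2 b ^ 2 ≤ 0 := by nlinarith [h.lamH_pos]
  exact l2_eq_zero (pow_eq_zero_iff two_ne_zero |>.1 (le_antisymm h1 (sq_nonneg _)))

/-- Strong convexity is tested at `β = 0` and a unit vector of `S`, where the quadratic form equals
`ν⁻¹`. -/
lemma nu_mul_lamH_le (h : Regular A D L S ν η lamH lamD LamD LamX i₁) : ν * lamH ≤ 1 := by
  obtain ⟨j, hj⟩ := h.nonempty
  have := h.rsc 0 L.zero_mem (Pi.single j 1) (fun i hi => by
    rw [Pi.single_eq_of_ne]; rintro rfl; exact hi hj)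
  have h1 : l2 (Pi.single j (1 : ℝ)) ^ 2 = 1 := by rw [l2_sq]; simp
  simp only [Matrix.mulVec_zero, l2_zero, sub_zero, h1] at this
  have hν := h.nu_pos
  have h2 : lamH ≤ ν⁻¹ := by linarith
  calc ν * lamH ≤ ν * ν⁻¹ := mul_le_mul_of_nonneg_left h2 hν.le
    _ = 1 := mul_inv_cancel₀ hν.ne'

/-- Strong convexity of the loss bounds `D b` by the energy. -/
lemma lamH_mul_sq_le (h : Regular A D L S ν η lamH lamD LamD LamX i₁) {b : Fin p → ℝ}
    (hb : b ∈ L) :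
    lamH * l2 (D *ᵥ b) ^ 2 ≤ l2 (A *ᵥ b) ^ 2 + ν⁻¹ * l2 (rows D Sᶜ *ᵥ b) ^ 2 := by
  have hν := h.nu_pos
  have hH := h.lamH_pos
  have hα := h.nu_mul_lamH_le
  have hB : (fun j : (Sᶜ : Finset (Fin m)) => (D *ᵥ b) j.1) = rows D Sᶜ *ᵥ b := rfl
  rw [l2_sq_split S, hB]
  set d := mask S (D *ᵥ b) with hd
  set E := l2 (rows D Sᶜ *ᵥ b) ^ 2 with hE
  -- Strong convexity is used with `γ` equal to `t` times the `S`-part of `D b`; the scale `t` is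
  -- free, and `λ_H‖b‖²` is discarded.
  have key : ∀ t : ℝ, lamH * (t ^ 2 * l2 d ^ 2) ≤
      l2 (A *ᵥ b) ^ 2 + ν⁻¹ * ((1 - t) ^ 2 * l2 d ^ 2 + E) := by
    intro t
    have h1 := h.rsc b hb (t • d) (fun j hj => by simp [hd, mask_of_notMem _ hj])
    have h2 : l2 (t • d - D *ᵥ b) ^ 2 = (1 - t) ^ 2 * l2 d ^ 2 + E := by
      rw [l2_sq_split S]
      have e1 : mask S (t • d - D *ᵥ b) = (t - 1) • d := by
        funext j
        by_cases hj : j ∈ S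
        · simp only [hd, Pi.smul_apply, mask_of_mem _ hj, Pi.sub_apply, smul_eq_mul]; ring
        · simp [hd, mask_of_notMem _ hj]
      have e2 : (fun j : (Sᶜ : Finset (Fin m)) => (t • d - D *ᵥ b) j.1)
          = -(rows D Sᶜ *ᵥ b) := by
        funext j
        have hj : j.1 ∉ S := Finset.mem_compl.1 j.2
        simp [hd, mask_of_notMem _ hj, rows_mulVec]
      rw [e1, e2, l2_smul, l2_neg, mul_pow, sq_abs]; ring
    rw [h2, l2_smul, mul_pow, sq_abs] at h1
    nlinarith [mul_nonneg hH.le (sq_nonneg (l2 b))]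
  have hE0 : 0 ≤ E := sq_nonneg _
  have hd0 : 0 ≤ l2 d ^ 2 := sq_nonneg _
  have hA0 := sq_nonneg (l2 (A *ᵥ b))
  generalize l2 d ^ 2 = x at *
  generalize l2 (A *ᵥ b) ^ 2 = a at *
  have hνi : ν * ν⁻¹ = 1 := mul_inv_cancel₀ hν.ne'
  have hνip : 0 < ν⁻¹ := inv_pos.2 hν
  set k := ν⁻¹ with hk
  have hHk : lamH ≤ k := by nlinarith
  clear_value k E
  have key' : ∀ t : ℝ, (lamH * t ^ 2 - k * (1 - t) ^ 2) * x ≤ a + k * E := by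
    intro t; nlinarith [key t]
  rcases hHk.eq_or_lt with he | hlt
  -- In the boundary case `λ_H = ν⁻¹` the coefficient `λ_H t² - k(1 - t)²` is linear in `t` and
  -- unbounded; one large `t` already forces the `S`-part to vanish.
  · have hx : x = 0 := by
      by_contra hne
      have hx : 0 < x := lt_of_le_of_ne hd0 (Ne.symm hne)
      have h1 := key' ((a + k * E) / (lamH * x) + 1)
      have h2 : (lamH * ((a + k * E) / (lamH * x) + 1) ^ 2
          - k * (1 - ((a + k * E) / (lamH * x) + 1)) ^ 2) * x = 2 * (a + k * E) + lamH * x := by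
        rw [← he]; field_simp; ring
      rw [h2] at h1
      nlinarith [mul_pos hH hx, mul_nonneg hνip.le hE0]
    rw [hx, he]; linarith
  · have hkl : 0 < k - lamH := sub_pos.2 hlt
    -- This `t` maximises `λ_H t² - k(1 - t)²`.
    have h1 := key' (k / (k - lamH))
    have h2 : (lamH * (k / (k - lamH)) ^ 2 - k * (1 - k / (k - lamH)) ^ 2)
        = lamH * k / (k - lamH) := by
      field_simp; ring
    rw [h2, div_mul_eq_mul_div, div_le_iff₀ hkl] at h1
    have h3 : k * (lamH * (x + E)) ≤ k * (a + k * E) := by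
      nlinarith [mul_nonneg hH.le hA0]
    exact le_of_mul_le_mul_left h3 hνip

end Regular

/-! ### Bounds for the responses to noise, damping and subgradients -/

namespace Regular
variable {n m p : ℕ} {A : Matrix (Fin n) (Fin p) ℝ} {D : Matrix (Fin m) (Fin p) ℝ}
  {L : Submodule ℝ (Fin p → ℝ)} {S : Finset (Fin m)} {ν η lamH lamD LamD LamX i₁ : ℝ}

lemma rows_mulVec_eq_zero {x : Fin p → ℝ} (hx : D *ᵥ x = 0) : rows D Sᶜ *ᵥ x = 0 := by
  funext j; rw [rows_mulVec, hx]; rfl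

lemma l2_rows_mulVec_le (x : Fin p → ℝ) : l2 (rows D Sᶜ *ᵥ x) ≤ l2 (D *ᵥ x) := by
  apply l2_le_of_sq_le_sq (l2_nonneg _)
  rw [l2_sq_split S (D *ᵥ x)]
  exact le_add_of_nonneg_left (sq_nonneg _)

lemma pinv_mulVec_mem (h : Regular A D L S ν η lamH lamD LamD LamX i₁) (y : Fin m → ℝ) :
    pinv D *ᵥ y ∈ L := by
  rw [pinv_eq_transpose_mul, ← Matrix.mulVec_mulVec]; exact h.memD _

lemma mulVec_pinv_mulVec (x : Fin p → ℝ) : D *ᵥ (pinv D *ᵥ (D *ᵥ x)) = D *ᵥ x := by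
  rw [Matrix.mulVec_mulVec, Matrix.mulVec_mulVec, mul_pinv_mul]

lemma lamD_le_LamD (h : Regular A D L S ν η lamH lamD LamD LamX i₁) {x : Fin p → ℝ}
    (hx : D *ᵥ x ≠ 0) : lamD ≤ LamD := by
  have h1 : l2 (D *ᵥ x) ≤ LamD * (lamD⁻¹ * l2 (D *ᵥ x)) := by
    conv_lhs => rw [← mulVec_pinv_mulVec]
    exact (h.normD _).trans (mul_le_mul_of_nonneg_left (h.pinvD _) h.LamD_pos.le)
  have h2 : 0 < l2 (D *ᵥ x) :=
    lt_of_le_of_ne (l2_nonneg _) fun h0 => hx (l2_eq_zero h0.symm)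
  have h3 : 1 ≤ LamD * lamD⁻¹ := by
    by_contra hc
    nlinarith
  rwa [← div_eq_mul_inv, one_le_div h.lamD_pos] at h3

lemma kerProj_mulVec_mem (h : Regular A D L S ν η lamH lamD LamD LamX i₁) {u : Fin p → ℝ}
    (hu : u ∈ L) : kerProj D *ᵥ u ∈ L := by
  rw [kerProj, Matrix.sub_mulVec, Matrix.one_mulVec, ← Matrix.mulVec_mulVec]
  exact L.sub_mem hu (h.pinv_mulVec_mem _)

lemma pinvK_mem (h : Regular A D L S ν η lamH lamD LamD LamX i₁) (y : Fin n → ℝ) :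
    pinv (A * kerProj D) *ᵥ y ∈ L ∧ D *ᵥ (pinv (A * kerProj D) *ᵥ y) = 0 := by
  rw [pinv_eq_transpose_mul, ← Matrix.mulVec_mulVec, Matrix.transpose_mul, kerProj_symm,
    ← Matrix.mulVec_mulVec]
  exact ⟨h.kerProj_mulVec_mem (h.memA _), mulVec_kerProj D _⟩

lemma mulVec_eq_of_ker {x : Fin p → ℝ} (hx : D *ᵥ x = 0) :
    (A * kerProj D) *ᵥ x = A *ᵥ x := by
  rw [← Matrix.mulVec_mulVec, kerProj_mulVec_of_ker D hx]

/-- Least squares over the kernel of `D`. -/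
lemma exists_leastSquares (h : Regular A D L S ν η lamH lamD LamD LamX i₁) (v : Fin n → ℝ) :
    ∃ x ∈ L, D *ᵥ x = 0 ∧ ∀ k, D *ᵥ k = 0 → (v - A *ᵥ x) ⬝ᵥ (A *ᵥ k) = 0 := by
  obtain ⟨h1, h2⟩ := h.pinvK_mem v
  refine ⟨_, h1, h2, fun k hk => ?_⟩
  rw [← mulVec_eq_of_ker (A := A) h2, ← mulVec_eq_of_ker (A := A) hk, ← transpose_mulVec_dot,
    Matrix.mulVec_sub, Matrix.mulVec_mulVec, Matrix.mulVec_mulVec, Matrix.mul_assoc,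
    transpose_mul_pinv, sub_self, zero_dotProduct]

/-- `A` is injective on `ℒ ∩ ker D`, so `x` is recovered from `A x` by the pseudoinverse of `A`
restricted to `ker D`. Its norm is the source of `1/λ₁`. -/
lemma l2_le_of_mem_ker (h : Regular A D L S ν η lamH lamD LamD LamX i₁) {x : Fin p → ℝ}
    (hx : x ∈ L) (hD : D *ᵥ x = 0) : l2 x ≤ i₁ * l2 (A *ᵥ x) := by
  obtain ⟨h1, h2⟩ := h.pinvK_mem (A *ᵥ x)
  have h3 : x - pinv (A * kerProj D) *ᵥ (A *ᵥ x) = 0 := by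
    refine h.eq_zero_of_ker (L.sub_mem hx h1) ?_ (by rw [Matrix.mulVec_sub, hD, h2, sub_zero])
    rw [Matrix.mulVec_sub, ← mulVec_eq_of_ker (A := A) h2, ← mulVec_eq_of_ker (A := A) hD,
      Matrix.mulVec_mulVec, Matrix.mulVec_mulVec, mul_pinv_mul, sub_self]
  rw [sub_eq_zero] at h3
  conv_lhs => rw [h3]
  exact h.pinvK _

section Noise
variable {b : Fin p → ℝ} {w : Fin n → ℝ}

lemma l2_rows_resp_le (h : Regular A D L S ν η lamH lamD LamD LamX i₁)
    (hr : Resp A (rows D Sᶜ) ν b (Aᵀ *ᵥ w)) :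
    l2 (rows D Sᶜ *ᵥ b) ≤ ν * (LamX / lamD * l2 w) :=
  (hr.l2_mulVec_le h.nu_pos h.LamX_pos.le (inv_nonneg.2 h.lamD_pos.le) h.normA h.pinvB).trans_eq
    (by rw [div_eq_mul_inv])

/-- Subtracting from `b` a suitable `x ∈ ker D` leaves `D b` and `B b` unchanged and makes `A(b -
x)` orthogonal to `A(ker D)`, hence at most `(Λ_X/λ_D)‖D b‖` in norm. Testing the normal equation
with `b - x` gives an energy `w · A(b - x)`, and strong convexity concludes. As the kernel part is
removed, no `1/λ₁` appears. -/
lemma l2_mulVec_resp_le (h : Regular A D L S ν η lamH lamD LamD LamX i₁)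
    (hb : b ∈ L) (hr : Resp A (rows D Sᶜ) ν b (Aᵀ *ᵥ w)) :
    l2 (D *ᵥ b) ≤ LamX / (lamH * lamD) * l2 w := by
  have hH := h.lamH_pos
  have hX := h.LamX_pos
  have hd := h.lamD_pos
  have hw := l2_nonneg w
  obtain ⟨x, hxL, hxD, hx⟩ := h.exists_leastSquares (A *ᵥ b)
  set r := pinv D *ᵥ (D *ᵥ b) with hrdef
  have hDr : D *ᵥ r = D *ᵥ b := mulVec_pinv_mulVec b
  set c := A *ᵥ (b - x) with hc
  have hc' : ∀ k, D *ᵥ k = 0 → c ⬝ᵥ (A *ᵥ k) = 0 := by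
    intro k hk; rw [hc, Matrix.mulVec_sub]; exact hx k hk
  have hcr : l2 c ^ 2 = c ⬝ᵥ (A *ᵥ r) := by
    have h0 := hc' (b - x - r) (by
      rw [Matrix.mulVec_sub, Matrix.mulVec_sub, hDr, hxD]; simp)
    rw [Matrix.mulVec_sub, dotProduct_sub, ← hc] at h0
    rw [l2_sq]; linarith
  have hcle : l2 c ≤ LamX * (lamD⁻¹ * l2 (D *ᵥ b)) := by
    refine le_trans ?_ ((h.normA r).trans (mul_le_mul_of_nonneg_left (h.pinvD _) hX.le))
    apply l2_le_of_sq_le (l2_nonneg _)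
    rw [hcr, mul_comm]; exact dot_le_l2 _ _
  have hBx : rows D Sᶜ *ᵥ (b - x) = rows D Sᶜ *ᵥ b := by
    rw [Matrix.mulVec_sub, rows_mulVec_eq_zero hxD, sub_zero]
  have hDx : D *ᵥ (b - x) = D *ᵥ b := by rw [Matrix.mulVec_sub, hxD, sub_zero]
  have hdot := hr.dot (b - x)
  rw [hBx, transpose_mulVec_dot, ← hc, ← l2_sq] at hdot
  have hAb : (A *ᵥ b) ⬝ᵥ c = l2 c ^ 2 := by
    have : A *ᵥ b = c + A *ᵥ x := by rw [hc, Matrix.mulVec_sub, sub_add_cancel]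
    rw [this, add_dotProduct, dotProduct_comm (A *ᵥ x), hc' x hxD, add_zero, l2_sq]
  rw [hAb] at hdot
  have hen := h.lamH_mul_sq_le (L.sub_mem hb hxL)
  rw [hBx, hDx, ← hc, hdot] at hen
  have h1 : lamH * l2 (D *ᵥ b) ^ 2 ≤ l2 w * (LamX * (lamD⁻¹ * l2 (D *ᵥ b))) :=
    hen.trans ((dot_le_l2 _ _).trans (mul_le_mul_of_nonneg_left hcle hw))
  apply l2_le_of_sq_le (by positivity)
  have h2 : l2 (D *ᵥ b) ^ 2 ≤ lamH⁻¹ * (l2 w * (LamX * (lamD⁻¹ * l2 (D *ᵥ b)))) := by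
    rw [← div_eq_inv_mul, le_div_iff₀ hH]; linarith
  refine h2.trans_eq ?_
  field_simp

/-- The part of the noise response in the kernel of `D`, tested against that kernel. -/
lemma dot_kernel_resp (hr : Resp A (rows D Sᶜ) ν b (Aᵀ *ᵥ w)) {k : Fin p → ℝ}
    (hk : D *ᵥ k = 0) :
    (A *ᵥ (kerProj D *ᵥ b)) ⬝ᵥ (A *ᵥ k) = (w - A *ᵥ (pinv D *ᵥ (D *ᵥ b))) ⬝ᵥ (A *ᵥ k) := by
  have h0 := hr.dot k
  rw [rows_mulVec_eq_zero hk, dotProduct_zero, mul_zero, add_zero, transpose_mulVec_dot] at h0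
  have h1 : kerProj D *ᵥ b = b - pinv D *ᵥ (D *ᵥ b) := by
    rw [kerProj, Matrix.sub_mulVec, Matrix.one_mulVec, Matrix.mulVec_mulVec]
  rw [h1, Matrix.mulVec_sub, sub_dotProduct, sub_dotProduct, h0]

lemma l2_sub_pinv_le (h : Regular A D L S ν η lamH lamD LamD LamX i₁)
    (hb : b ∈ L) (hr : Resp A (rows D Sᶜ) ν b (Aᵀ *ᵥ w)) :
    l2 (w - A *ᵥ (pinv D *ᵥ (D *ᵥ b))) ≤ (1 + LamX ^ 2 / (lamH * lamD ^ 2)) * l2 w := by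
  have hH := h.lamH_pos
  have hX := h.LamX_pos
  have hd := h.lamD_pos
  calc _ ≤ l2 w + l2 (A *ᵥ (pinv D *ᵥ (D *ᵥ b))) := l2_sub_le _ _
    _ ≤ l2 w + LamX * (lamD⁻¹ * (LamX / (lamH * lamD) * l2 w)) := by
        gcongr
        refine (h.normA _).trans (mul_le_mul_of_nonneg_left ?_ hX.le)
        exact (h.pinvD _).trans (mul_le_mul_of_nonneg_left (h.l2_mulVec_resp_le hb hr)
          (inv_nonneg.2 hd.le))
    _ = _ := by field_simp

/-- Testing with the kernel component itself eliminates the `B`-term, so its image under `A` is no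
longer than the residual `w - A D†D b`. -/
lemma l2_kerProj_resp_le (h : Regular A D L S ν η lamH lamD LamD LamX i₁)
    (hb : b ∈ L) (hr : Resp A (rows D Sᶜ) ν b (Aᵀ *ᵥ w)) :
    l2 (kerProj D *ᵥ b) ≤ i₁ * ((1 + LamX ^ 2 / (lamH * lamD ^ 2)) * l2 w) := by
  have hker := mulVec_kerProj D b
  refine (h.l2_le_of_mem_ker (h.kerProj_mulVec_mem hb) hker).trans
    (mul_le_mul_of_nonneg_left ?_ h.i₁_nonneg)
  refine le_trans ?_ (h.l2_sub_pinv_le hb hr)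
  apply l2_le_of_sq_le (l2_nonneg _)
  rw [l2_sq, dot_kernel_resp hr hker]
  exact dot_le_l2 _ _

lemma l2_resp_le (h : Regular A D L S ν η lamH lamD LamD LamX i₁)
    (b : Fin p → ℝ) :
    l2 b ≤ lamD⁻¹ * l2 (D *ᵥ b) + l2 (kerProj D *ᵥ b) := by
  have h1 : b = pinv D *ᵥ (D *ᵥ b) + kerProj D *ᵥ b := by
    rw [kerProj, Matrix.sub_mulVec, Matrix.one_mulVec, Matrix.mulVec_mulVec]; abel
  conv_lhs => rw [h1]
  exact (l2_add_le _ _).trans (add_le_add (h.pinvD _) le_rfl)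

lemma l2_mulVec_kerProj_rows_le (h : Regular A D L S ν η lamH lamD LamD LamX i₁)
    (x : Fin p → ℝ) :
    l2 (D *ᵥ (kerProj (rows D Sᶜ) *ᵥ x)) ≤ (1 + LamD / lamD) * l2 (D *ᵥ x) := by
  have hd := h.lamD_pos
  have hD := h.LamD_pos
  have h1 : kerProj (rows D Sᶜ) *ᵥ x = x - pinv (rows D Sᶜ) *ᵥ (rows D Sᶜ *ᵥ x) := by
    rw [kerProj, Matrix.sub_mulVec, Matrix.one_mulVec, Matrix.mulVec_mulVec]
  rw [h1, Matrix.mulVec_sub]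
  calc _ ≤ l2 (D *ᵥ x) + l2 (D *ᵥ (pinv (rows D Sᶜ) *ᵥ (rows D Sᶜ *ᵥ x))) := l2_sub_le _ _
    _ ≤ l2 (D *ᵥ x) + LamD * (lamD⁻¹ * l2 (D *ᵥ x)) := by
        gcongr
        refine (h.normD _).trans (mul_le_mul_of_nonneg_left ?_ hD.le)
        exact (h.pinvB _).trans
          (mul_le_mul_of_nonneg_left (l2_rows_mulVec_le x) (inv_nonneg.2 hd.le))
    _ = _ := by field_simp

end Noise

/-- Vectors of the ambient space are of the form `Aᵀ A h + Dᵀ x` with `D h = 0`. -/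
lemma exists_decomposition (h : Regular A D L S ν η lamH lamD LamD LamX i₁) {u : Fin p → ℝ}
    (hu : u ∈ L) : ∃ k x, D *ᵥ k = 0 ∧ u = Aᵀ *ᵥ (A *ᵥ k) + Dᵀ *ᵥ x ∧
      l2 x ≤ (lamD⁻¹ + LamX * lamD⁻¹ * i₁) * l2 u := by
  have hX := h.LamX_pos
  have hd := h.lamD_pos
  have hi := h.i₁_nonneg
  set K := A * kerProj D with hK
  -- With this choice `AᵀA k` and `u` have the same projection to `ker D` (`hPA`), so their
  -- difference lies in the row space of `D`.
  set k := pinv K *ᵥ ((pinv K)ᵀ *ᵥ u) with hk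
  obtain ⟨hkL, hkD⟩ := h.pinvK_mem ((pinv K)ᵀ *ᵥ u)
  obtain ⟨heL, heD⟩ := h.pinvK_mem (K *ᵥ u)
  rw [← hK] at hkL hkD heL heD
  have he : kerProj D *ᵥ u - pinv K *ᵥ (K *ᵥ u) = 0 := by
    refine h.eq_zero_of_ker (L.sub_mem (h.kerProj_mulVec_mem hu) heL) ?_ ?_
    · rw [Matrix.mulVec_sub, ← mulVec_eq_of_ker (A := A) heD, ← hK, Matrix.mulVec_mulVec, ← hK,
        Matrix.mulVec_mulVec, Matrix.mulVec_mulVec, mul_pinv_mul, sub_self]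
    · rw [Matrix.mulVec_sub, mulVec_kerProj, heD, sub_zero]
  rw [sub_eq_zero] at he
  have hAk : A *ᵥ k = (pinv K)ᵀ *ᵥ u := by
    rw [← mulVec_eq_of_ker (A := A) hkD, ← hK, Matrix.mulVec_mulVec, Matrix.mulVec_mulVec,
      mul_pinv_mul_pinv_transpose]
  have hPA : kerProj D *ᵥ (Aᵀ *ᵥ (A *ᵥ k)) = kerProj D *ᵥ u := by
    rw [hAk, he, Matrix.mulVec_mulVec, Matrix.mulVec_mulVec, Matrix.mulVec_mulVec, pinv_mul_eq, hK,
      Matrix.transpose_mul, kerProj_symm]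
  have hsplit : ∀ z : Fin p → ℝ, z = kerProj D *ᵥ z + Dᵀ *ᵥ ((pinv D)ᵀ *ᵥ z) := by
    intro z
    rw [Matrix.mulVec_mulVec, ← pinv_mul_eq, kerProj, Matrix.sub_mulVec, Matrix.one_mulVec]
    abel
  refine ⟨k, (pinv D)ᵀ *ᵥ (u - Aᵀ *ᵥ (A *ᵥ k)), hkD, ?_, ?_⟩
  · have h1 := hsplit (u - Aᵀ *ᵥ (A *ᵥ k))
    rw [Matrix.mulVec_sub (kerProj D), hPA, sub_self, zero_add] at h1
    rw [← h1]; abel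
  · have h1 := l2_transpose_le (inv_nonneg.2 hd.le) h.pinvD (u - Aᵀ *ᵥ (A *ᵥ k))
    have h2 : l2 (A *ᵥ k) ≤ i₁ * l2 u := by
      rw [hAk]; exact l2_transpose_le hi h.pinvK u
    have h3 := l2_transpose_le hX.le h.normA (A *ᵥ k)
    have h4 := l2_sub_le u (Aᵀ *ᵥ (A *ᵥ k))
    calc _ ≤ lamD⁻¹ * (l2 u + LamX * (i₁ * l2 u)) := by
          refine h1.trans (mul_le_mul_of_nonneg_left ?_ (inv_nonneg.2 hd.le))
          exact h4.trans (add_le_add le_rfl (h3.trans (mul_le_mul_of_nonneg_left h2 hX.le)))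
      _ = _ := by ring

/-- Irrepresentability controls the response outside `S`. -/
lemma abs_rows_resp_le (h : Regular A D L S ν η lamH lamD LamD LamX i₁) {u b : Fin p → ℝ}
    {v : Fin m → ℝ} {w : Fin n → ℝ} {M t : ℝ} (hu : u ∈ L) (hv : ∀ j ∈ S, |v j| ≤ M) (ht : 0 ≤ t)
    (hb : Resp A (rows D Sᶜ) ν b (u + Dᵀ *ᵥ mask S v - t • (Aᵀ *ᵥ w)))
    (j : (Sᶜ : Finset (Fin m))) :
    |(rows D Sᶜ *ᵥ b) j| ≤ ν * ((1 - η) * (M + (lamD⁻¹ + LamX * lamD⁻¹ * i₁) * l2 u)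
      + (lamD⁻¹ + LamX * lamD⁻¹ * i₁) * l2 u)
      + t * |(rows D Sᶜ *ᵥ (noiseResp A (rows D Sᶜ) ν *ᵥ w)) j| := by
  have hν := h.nu_pos
  obtain ⟨k, x, hkD, hux, hx⟩ := h.exists_decomposition hu
  set B := rows D Sᶜ with hB
  set X := (lamD⁻¹ + LamX * lamD⁻¹ * i₁) * l2 u with hX
  -- The `S`-coordinates of `x` are added to `v` and handled by irrepresentability; those outside
  -- `S` form `y` and are handled by the plain energy estimate for `b₃`.
  obtain ⟨b₁, hb₁, hb₁'⟩ := h.irr (v + x) (M + X) (fun i hi =>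
    (abs_add_le _ _).trans (add_le_add (hv i hi) ((abs_le_l2 x i).trans hx)))
  set y : (Sᶜ : Finset (Fin m)) → ℝ := fun i => x i.1 with hy
  have hBk : B *ᵥ k = 0 := rows_mulVec_eq_zero hkD
  -- The purpose of the decomposition: the part `AᵀA k` is answered by `k` itself, which `B` does
  -- not see.
  have hb₂ : Resp A B ν k (Aᵀ *ᵥ (A *ᵥ k)) := by unfold Resp; rw [hBk]; simp
  have hb₃ := resp_pinv_stacked A B hν 0 (√ν • y)
  set b₃ := pinv (stacked A B ν) *ᵥ Sum.elim 0 (√ν • y) with hb₃def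
  have hsq : √ν ≠ 0 := (Real.sqrt_pos.2 hν).ne'
  rw [Matrix.mulVec_zero, zero_add, Matrix.mulVec_smul, smul_smul, inv_mul_cancel₀ hsq,
    one_smul] at hb₃
  have hyl : l2 y ≤ X := by
    refine le_trans ?_ hx
    apply l2_le_of_sq_le_sq (l2_nonneg _)
    rw [l2_sq_split S x]
    exact le_add_of_nonneg_left (sq_nonneg _)
  have hX0 : 0 ≤ X := (l2_nonneg _).trans hyl
  have hb₃' : l2 (B *ᵥ b₃) ≤ ν * X := by
    apply l2_le_of_sq_le (by positivity)
    have h1 := hb₃.dot b₃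
    rw [transpose_mulVec_dot, ← l2_sq, ← l2_sq] at h1
    have h2 : ν⁻¹ * l2 (B *ᵥ b₃) ^ 2 ≤ X * l2 (B *ᵥ b₃) := by
      have := (dot_le_l2 y (B *ᵥ b₃)).trans (mul_le_mul_of_nonneg_right hyl (l2_nonneg _))
      nlinarith [sq_nonneg (l2 (A *ᵥ b₃))]
    rw [← div_eq_inv_mul, div_le_iff₀ hν] at h2
    linarith
  have hb₄ := resp_noiseResp A B hν w
  have hall := ((hb₁.add hb₂).add hb₃).add (hb₄.smul (-t))
  have hmask : mask S (v + x) = mask S v + mask S x := by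
    funext i
    by_cases hi : i ∈ S
    · simp [mask_of_mem _ hi]
    · simp [mask_of_notMem _ hi]
  have hrhs : Dᵀ *ᵥ mask S (v + x) + Aᵀ *ᵥ (A *ᵥ k) + Bᵀ *ᵥ y + (-t) • (Aᵀ *ᵥ w)
      = u + Dᵀ *ᵥ mask S v - t • (Aᵀ *ᵥ w) := by
    rw [hux, transpose_mulVec_split D S x, hmask, Matrix.mulVec_add]
    module
  rw [hrhs] at hall
  have hfin := congrFun (hb.unique hν hall) j
  simp only [Matrix.mulVec_add, Matrix.mulVec_smul, hBk, add_zero, Pi.add_apply, Pi.smul_apply,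
    smul_eq_mul] at hfin
  rw [hfin]
  have e1 := hb₁' j
  have e3 := (abs_le_l2 (B *ᵥ b₃) j).trans hb₃'
  have e4 : |(-t) * (B *ᵥ (noiseResp A B ν *ᵥ w)) j|
      = t * |(B *ᵥ (noiseResp A B ν *ᵥ w)) j| := by
    rw [abs_mul, abs_neg, abs_of_nonneg ht]
  calc _ ≤ |(B *ᵥ b₁) j| + |(B *ᵥ b₃) j| + |(-t) * (B *ᵥ (noiseResp A B ν *ᵥ w)) j| :=
        abs_add_three _ _ _
    _ ≤ ν * ((1 - η) * (M + X)) + ν * X + t * |(B *ᵥ (noiseResp A B ν *ᵥ w)) j| := by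
        rw [e4]; gcongr
    _ = _ := by ring

end Regular

/-! ### Differential inequalities with right derivatives -/

section RightDerivative
open Filter Topology Set

lemma le_of_right_deriv_le {f f' : ℝ → ℝ} {a b c : ℝ} (hab : a ≤ b) (hf : ContinuousOn f (Icc a b))
    (hf' : ∀ x ∈ Ico a b, HasDerivWithinAt f (f' x) (Ici x) x) (hc : ∀ x ∈ Ico a b, f' x ≤ c) :
    f b ≤ f a + c * (b - a) := by
  have hB : ∀ x : ℝ, HasDerivAt (fun x => f a + c * (x - a)) c x := fun x => by
    simpa using (((hasDerivAt_id x).sub_const a).const_mul c).const_add (f a)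
  exact image_le_of_deriv_right_le_deriv_boundary hf hf' (B := fun x => f a + c * (x - a))
    (B' := fun _ => c) (by simp) (fun x _ => (hB x).continuousAt.continuousWithinAt)
    (fun x _ => (hB x).hasDerivWithinAt) hc (right_mem_Icc.2 hab)

variable {ψ q : ℝ → ℝ} {a b c : ℝ}

lemma linear_decay (hab : a ≤ b) (hψ : ContinuousOn ψ (Icc a b))
    (hψ' : ∀ x ∈ Ico a b, HasDerivWithinAt ψ (-q x) (Ici x) x) (hq : ∀ x ∈ Ico a b, c ≤ q x) :
    ψ b ≤ ψ a - c * (b - a) := by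
  have := le_of_right_deriv_le hab hψ hψ' (c := -c) fun x hx => neg_le_neg (hq x hx)
  linarith

lemma exponential_decay (hab : a ≤ b) (hψ : ContinuousOn ψ (Icc a b))
    (hψ' : ∀ x ∈ Ico a b, HasDerivWithinAt ψ (-q x) (Ici x) x)
    (hq : ∀ x ∈ Ico a b, c * ψ x ≤ q x) :
    ψ b ≤ Real.exp (-(c * (b - a))) * ψ a := by
  have he : ∀ x : ℝ, HasDerivAt (fun x => Real.exp (c * (x - a))) (Real.exp (c * (x - a)) * c) x := by
    intro x
    simpa using (((hasDerivAt_id x).sub_const a).const_mul c).exp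
  have h := le_of_right_deriv_le (f := fun x => Real.exp (c * (x - a)) * ψ x) (c := 0) hab
    (ContinuousOn.mul (fun x _ => (he x).continuousAt.continuousWithinAt) hψ)
    (fun x hx => (he x).hasDerivWithinAt.mul (hψ' x hx)) (fun x hx => by
      have := mul_le_mul_of_nonneg_left (hq x hx) (Real.exp_pos (c * (x - a))).le
      linarith)
  simp only [sub_self, mul_zero, Real.exp_zero, one_mul, zero_mul, add_zero] at h
  rw [Real.exp_neg, ← div_eq_inv_mul, le_div_iff₀ (Real.exp_pos _)]
  linarith

/-- `1/ψ` grows at rate at least `c`. The inverse requires `ψ > 0`; under the negated conclusion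
this holds at `t`, and earlier by monotonicity. -/
lemma hyperbolic_decay {t : ℝ} (ht : 0 < t) (hc : 0 < c) (hψ : ContinuousOn ψ (Icc 0 t))
    (hψ' : ∀ x ∈ Ico 0 t, HasDerivWithinAt ψ (-q x) (Ici x) x)
    (hq : ∀ x ∈ Ico 0 t, c * ψ x ^ 2 ≤ q x) :
    ψ t ≤ 1 / (c * t) := by
  by_contra! hcon
  have hpos : 0 < ψ t := lt_trans (by positivity) hcon
  have hψpos : ∀ x ∈ Icc 0 t, 0 < ψ x := by
    intro x hx
    have := linear_decay (c := 0) hx.2 (hψ.mono (Icc_subset_Icc_left hx.1))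
      (fun y hy => hψ' y ⟨hx.1.trans hy.1, hy.2⟩)
      (fun y hy => (by positivity : 0 ≤ c * ψ y ^ 2).trans (hq y ⟨hx.1.trans hy.1, hy.2⟩))
    linarith
  have h := le_of_right_deriv_le (f := fun x => -(ψ x)⁻¹) (c := -c) ht.le
    (hψ.inv₀ fun x hx => (hψpos x hx).ne').neg
    (fun x hx => ((hψ' x hx).inv (hψpos x ⟨hx.1, hx.2.le⟩).ne').neg) (fun x hx => by
      have := hq x hx
      have h2 := hψpos x ⟨hx.1, hx.2.le⟩
      rw [neg_neg, neg_le_neg_iff, le_div_iff₀ (by positivity)]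
      exact this)
  have h0 := inv_pos.2 (hψpos 0 ⟨le_rfl, ht.le⟩)
  have h1 : c * t ≤ (ψ t)⁻¹ := by linarith
  have h2 : ψ t ≤ (c * t)⁻¹ := by
    rw [le_inv_comm₀ hpos (by positivity)]; exact h1
  rw [one_div] at hcon
  linarith

lemma hasDerivWithinAt_mulVec {k l : ℕ} {f : ℝ → Fin l → ℝ} {f' : Fin l → ℝ} {s : Set ℝ}
    {x : ℝ} (M : Matrix (Fin k) (Fin l) ℝ) (h : HasDerivWithinAt f f' s x) :
    HasDerivWithinAt (fun t => M *ᵥ f t) (M *ᵥ f') s x :=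
  (LinearMap.toContinuousLinearMap M.mulVecLin).hasFDerivAt.comp_hasDerivWithinAt x h

lemma hasDerivWithinAt_dot {k : ℕ} {f g : ℝ → Fin k → ℝ} {f' g' : Fin k → ℝ} {s : Set ℝ}
    {x : ℝ} (hf : HasDerivWithinAt f f' s x) (hg : HasDerivWithinAt g g' s x) :
    HasDerivWithinAt (fun t => f t ⬝ᵥ g t) (f' ⬝ᵥ g x + f x ⬝ᵥ g') s x := by
  rw [hasDerivWithinAt_pi] at hf hg
  have e : f' ⬝ᵥ g x + f x ⬝ᵥ g' = ∑ i, (f' i * g x i + f x i * g' i) :=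
    Finset.sum_add_distrib.symm
  rw [e]
  exact HasDerivWithinAt.fun_sum fun i _ => (hf i).mul (hg i)

lemma hasDerivWithinAt_l2_sq {k : ℕ} {f : ℝ → Fin k → ℝ} {f' : Fin k → ℝ} {s : Set ℝ}
    {x : ℝ} (hf : HasDerivWithinAt f f' s x) :
    HasDerivWithinAt (fun t => l2 (f t) ^ 2) (2 * (f x ⬝ᵥ f')) s x := by
  simp only [l2_sq]
  refine (hasDerivWithinAt_dot hf hf).congr_deriv ?_
  rw [dotProduct_comm f']; ring

/-- A function which is positive, or vanishes with positive derivative, is positive to the right. -/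
lemma eventually_pos_right {g : ℝ → ℝ} {g' t : ℝ} (hg : HasDerivWithinAt g g' (Ici t) t)
    (h : 0 < g t ∨ (g t = 0 ∧ 0 < g')) : ∀ᶠ s in 𝓝[>] t, 0 < g s := by
  rcases h with h | ⟨h0, h1⟩
  · exact (hg.continuousWithinAt.mono Ioi_subset_Ici_self).eventually (lt_mem_nhds h)
  · rw [hasDerivWithinAt_iff_tendsto_slope, Ici_sdiff_left] at hg
    filter_upwards [hg.eventually (lt_mem_nhds h1), self_mem_nhdsWithin] with s hs hst
    rw [slope_def_field, h0, sub_zero] at hs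
    exact (div_pos_iff_of_pos_right (sub_pos.2 hst)).1 hs

lemma right_deriv_eq_zero {r : ℝ → ℝ} {r' t σ : ℝ} (hr : HasDerivWithinAt r r' (Ici t) t)
    (h : ∀ᶠ s in 𝓝[>] t, r s = σ) : r' = 0 := by
  have ht : r t = σ := by
    have h1 : Tendsto r (𝓝[>] t) (𝓝 (r t)) := hr.continuousWithinAt.mono Ioi_subset_Ici_self
    have h2 : Tendsto r (𝓝[>] t) (𝓝 σ) :=
      tendsto_const_nhds.congr' (h.mono fun s hs => hs.symm)
    exact tendsto_nhds_unique h1 h2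
  rw [hasDerivWithinAt_iff_tendsto_slope, Ici_sdiff_left] at hr
  refine tendsto_nhds_unique hr (tendsto_const_nhds.congr' ?_)
  filter_upwards [h] with s hs
  rw [slope_def_field, hs, ht, sub_self, zero_div]

end RightDerivative

/-! ### Subgradients of the `ℓ¹` norm -/

section Subdifferential
variable {m : ℕ} {γ ρ : Fin m → ℝ}

lemma mem_subdiffL1_iff_coord (h : ρ ∈ subdiffL1 γ) (j : Fin m) :
    |ρ j| ≤ 1 ∧ γ j * ρ j = |γ j| := by
  have key : ∀ c : ℝ, |γ j| + ρ j * c ≤ |γ j + c| := by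
    intro c
    have h1 := h (γ + Pi.single j c)
    rw [add_sub_cancel_left, dotProduct_single] at h1
    have h2 : l1 (γ + Pi.single j c) = l1 γ - |γ j| + |γ j + c| := by
      unfold l1
      rw [← Finset.add_sum_erase _ _ (Finset.mem_univ j),
        ← Finset.add_sum_erase _ (fun i => |γ i|) (Finset.mem_univ j)]
      have : ∑ x ∈ Finset.univ.erase j, |(γ + Pi.single j c : Fin m → ℝ) x|
          = ∑ x ∈ Finset.univ.erase j, |γ x| := by
        refine Finset.sum_congr rfl fun i hi => ?_
        rw [Pi.add_apply, Pi.single_eq_of_ne (Finset.ne_of_mem_erase hi), add_zero]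
      rw [this, Pi.add_apply, Pi.single_eq_same]; ring
    rw [h2] at h1; linarith
  have hle : |ρ j| ≤ 1 := by
    have h1 := key 1
    have h2 := key (-1)
    have h3 := abs_add_le (γ j) 1
    have h4 := abs_add_le (γ j) (-1)
    simp only [abs_neg, abs_one] at h3 h4
    rw [abs_le]; constructor <;> linarith
  refine ⟨hle, le_antisymm ?_ ?_⟩
  · calc γ j * ρ j ≤ |γ j * ρ j| := le_abs_self _
      _ = |γ j| * |ρ j| := abs_mul _ _
      _ ≤ |γ j| * 1 := mul_le_mul_of_nonneg_left hle (abs_nonneg _)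
      _ = _ := mul_one _
  · have := key (-γ j)
    rw [add_neg_cancel, abs_zero] at this
    linarith

lemma subdiff_eq_one (h : ρ ∈ subdiffL1 γ) {j : Fin m} (hj : 0 < γ j) : ρ j = 1 := by
  have := (mem_subdiffL1_iff_coord h j).2
  rw [abs_of_pos hj] at this
  exact mul_left_cancel₀ hj.ne' (by rw [this, mul_one])

lemma subdiff_eq_neg_one (h : ρ ∈ subdiffL1 γ) {j : Fin m} (hj : γ j < 0) : ρ j = -1 := by
  have := (mem_subdiffL1_iff_coord h j).2
  rw [abs_of_neg hj] at this
  exact mul_left_cancel₀ hj.ne (by rw [this]; ring)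

lemma eq_zero_of_abs_subdiff_lt (h : ρ ∈ subdiffL1 γ) {j : Fin m} (hj : |ρ j| < 1) : γ j = 0 := by
  rcases lt_trichotomy (γ j) 0 with h1 | h1 | h1
  · rw [subdiff_eq_neg_one h h1] at hj; norm_num at hj
  · exact h1
  · rw [subdiff_eq_one h h1] at hj; norm_num at hj

end Subdifferential

/-! ### Solution paths and their integrated equations -/

/-- A solution of the differential inclusion, with `A = X / √n` and the scaled noise `w = ε / √n`,
together with its right derivatives. -/
structure IsPath {n m p : ℕ} (A : Matrix (Fin n) (Fin p) ℝ) (D : Matrix (Fin m) (Fin p) ℝ)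
    (ν κ : ℝ) (βs : Fin p → ℝ) (w : Fin n → ℝ) (ρ ρ' : ℝ → Fin m → ℝ) (β β' : ℝ → Fin p → ℝ)
    (γ γ' : ℝ → Fin m → ℝ) : Prop where
  rho_zero : ρ 0 = 0
  beta_zero : β 0 = 0
  gamma_zero : γ 0 = 0
  rho_cont : ContinuousOn ρ (Set.Ici 0)
  beta_cont : ContinuousOn β (Set.Ici 0)
  gamma_cont : ContinuousOn γ (Set.Ici 0)
  rho_deriv : ∀ t, 0 ≤ t → HasDerivWithinAt ρ (ρ' t) (Set.Ici t) t
  beta_deriv : ∀ t, 0 ≤ t → HasDerivWithinAt β (β' t) (Set.Ici t) t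
  gamma_deriv : ∀ t, 0 ≤ t → HasDerivWithinAt γ (γ' t) (Set.Ici t) t
  beta_eq : ∀ t, 0 ≤ t → κ⁻¹ • β' t
    = -(Aᵀ *ᵥ (A *ᵥ (β t - βs)) - Aᵀ *ᵥ w + ν⁻¹ • (Dᵀ *ᵥ (D *ᵥ β t - γ t)))
  gamma_eq : ∀ t, 0 ≤ t → ρ' t + κ⁻¹ • γ' t = -(ν⁻¹ • (γ t - D *ᵥ β t))
  subdiff : ∀ t, 0 ≤ t → ρ t ∈ subdiffL1 (γ t)

namespace IsPath
open Filter Topology Set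
variable {n m p : ℕ} {A : Matrix (Fin n) (Fin p) ℝ} {D : Matrix (Fin m) (Fin p) ℝ}
  {ν κ : ℝ} {βs : Fin p → ℝ} {w : Fin n → ℝ} {ρ ρ' : ℝ → Fin m → ℝ} {β β' : ℝ → Fin p → ℝ}
  {γ γ' : ℝ → Fin m → ℝ}

/-- In either case `γ_j` has a strict constant sign immediately after `t`, so `ρ_j` is constantly
`±1` there. This yields `γ · ρ' = 0` and `γ' · ρ' = 0`, on which both monotonicity formulas rest. -/
lemma rho_deriv_eq_zero (h : IsPath A D ν κ βs w ρ ρ' β β' γ γ') {t : ℝ} (ht : 0 ≤ t) {j : Fin m}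
    (hj : γ t j ≠ 0 ∨ γ' t j ≠ 0) : ρ' t j = 0 := by
  have hρ := hasDerivWithinAt_pi.1 (h.rho_deriv t ht) j
  have hγ := hasDerivWithinAt_pi.1 (h.gamma_deriv t ht) j
  have hcases : (0 < γ t j ∨ (γ t j = 0 ∧ 0 < γ' t j)) ∨
      (0 < -γ t j ∨ (-γ t j = 0 ∧ 0 < -γ' t j)) := by
    rcases lt_trichotomy (γ t j) 0 with h1 | h1 | h1
    · exact Or.inr (Or.inl (by linarith))
    · rcases hj with hj | hj
      · exact absurd h1 hj
      · rcases lt_or_gt_of_ne hj with h2 | h2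
        · exact Or.inr (Or.inr ⟨by linarith, by linarith⟩)
        · exact Or.inl (Or.inr ⟨h1, h2⟩)
    · exact Or.inl (Or.inl h1)
  rcases hcases with hc | hc
  · refine right_deriv_eq_zero (σ := 1) hρ ?_
    filter_upwards [eventually_pos_right hγ hc, self_mem_nhdsWithin] with s hs hst
    exact subdiff_eq_one (h.subdiff s (ht.trans (le_of_lt hst))) hs
  · refine right_deriv_eq_zero (σ := -1) hρ ?_
    filter_upwards [eventually_pos_right hγ.fun_neg hc, self_mem_nhdsWithin] with s hs hst
    exact subdiff_eq_neg_one (h.subdiff s (ht.trans (le_of_lt hst))) (by linarith)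

lemma gamma_dot_rho_deriv (h : IsPath A D ν κ βs w ρ ρ' β β' γ γ') {t : ℝ} (ht : 0 ≤ t) :
    γ t ⬝ᵥ ρ' t = 0 := by
  refine Finset.sum_eq_zero fun j _ => ?_
  by_cases hj : γ t j = 0
  · rw [hj, zero_mul]
  · rw [h.rho_deriv_eq_zero ht (Or.inl hj), mul_zero]

lemma gamma_deriv_dot_rho_deriv (h : IsPath A D ν κ βs w ρ ρ' β β' γ γ') {t : ℝ} (ht : 0 ≤ t) :
    γ' t ⬝ᵥ ρ' t = 0 := by
  refine Finset.sum_eq_zero fun j _ => ?_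
  by_cases hj : γ' t j = 0
  · rw [hj, zero_mul]
  · rw [h.rho_deriv_eq_zero ht (Or.inr hj), mul_zero]

lemma exists_primitive {k : ℕ} {f : ℝ → Fin k → ℝ} (hf : ContinuousOn f (Ici 0)) :
    ∃ F : ℝ → Fin k → ℝ, F 0 = 0 ∧ ContinuousOn F (Ici 0) ∧
      ∀ t, 0 ≤ t → HasDerivWithinAt F (f t) (Ici t) t := by
  -- Freezing `f` at its initial value for negative times makes it continuous on the whole line.
  have hc : Continuous fun s => f (max s 0) :=
    hf.comp_continuous (by fun_prop) fun s => le_max_right s 0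
  have hd : ∀ t, HasDerivAt (fun t => ∫ s in (0 : ℝ)..t, f (max s 0)) (f (max t 0)) t := fun t =>
    (hc.integral_hasStrictDerivAt 0 t).hasDerivAt
  refine ⟨fun t => ∫ s in (0 : ℝ)..t, f (max s 0), by simp,
    fun t _ => (hd t).continuousAt.continuousWithinAt, fun t ht => ?_⟩
  have := (hd t).hasDerivWithinAt (s := Ici t)
  rwa [max_eq_left ht] at this

/-- The integrated equations of motion. -/
lemma exists_integrated (h : IsPath A D ν κ βs w ρ ρ' β β' γ γ') :
    ∃ (I : ℝ → Fin p → ℝ) (G : ℝ → Fin m → ℝ),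
      (∀ t, 0 ≤ t → κ⁻¹ • β t = t • (Aᵀ *ᵥ w) - Aᵀ *ᵥ (A *ᵥ I t)
        - ν⁻¹ • (Dᵀ *ᵥ (D *ᵥ I t - G t))) ∧
      (∀ t, 0 ≤ t → ρ t + κ⁻¹ • γ t = -(ν⁻¹ • (G t - D *ᵥ I t))) ∧
      ∀ t, 0 ≤ t → ∀ j, (D *ᵥ βs) j = 0 → (∀ s ∈ Ico 0 t, γ s j = 0) → G t j = 0 := by
  obtain ⟨I, hI0, hIc, hI⟩ := exists_primitive (h.beta_cont.sub (continuousOn_const (c := βs)))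
  obtain ⟨G, hG0, hGc, hG⟩ :=
    exists_primitive (h.gamma_cont.sub (continuousOn_const (c := D *ᵥ βs)))
  have hcm : ∀ {k l : ℕ} (M : Matrix (Fin k) (Fin l) ℝ) {f : ℝ → Fin l → ℝ},
      ContinuousOn f (Ici 0) → ContinuousOn (fun t => M *ᵥ f t) (Ici 0) := fun M f hf =>
    (LinearMap.toContinuousLinearMap M.mulVecLin).continuous.comp_continuousOn hf
  refine ⟨I, G, fun t ht => ?_, fun t ht => ?_, fun t ht j hj hγ => ?_⟩
  · have hc : ContinuousOn (fun t => κ⁻¹ • β t - (t • (Aᵀ *ᵥ w) - Aᵀ *ᵥ (A *ᵥ I t)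
        - ν⁻¹ • (Dᵀ *ᵥ (D *ᵥ I t - G t)))) (Ici 0) := by
      exact (h.beta_cont.const_smul κ⁻¹).sub (((continuousOn_id.smul continuousOn_const).sub
        (hcm _ (hcm _ hIc))).sub (ContinuousOn.const_smul (hcm _ ((hcm _ hIc).sub hGc)) ν⁻¹))
    have hd : ∀ x ∈ Ico 0 t, HasDerivWithinAt (fun t => κ⁻¹ • β t - (t • (Aᵀ *ᵥ w)
        - Aᵀ *ᵥ (A *ᵥ I t) - ν⁻¹ • (Dᵀ *ᵥ (D *ᵥ I t - G t)))) 0 (Ici x) x := by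
      intro x hx
      have h1 := (h.beta_deriv x hx.1).const_smul κ⁻¹
      have h2 := ((hasDerivWithinAt_id x (Ici x)).smul_const (Aᵀ *ᵥ w))
      have h3 := hasDerivWithinAt_mulVec Aᵀ (hasDerivWithinAt_mulVec A (hI x hx.1))
      have h4 := (hasDerivWithinAt_mulVec Dᵀ
        ((hasDerivWithinAt_mulVec D (hI x hx.1)).sub (hG x hx.1))).const_smul ν⁻¹
      refine (h1.sub ((h2.sub h3).sub h4)).congr_deriv ?_
      rw [h.beta_eq x hx.1]
      simp only [Pi.sub_apply, Matrix.mulVec_sub, one_smul]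
      module
    have := constant_of_has_deriv_right_zero (hc.mono Icc_subset_Ici_self) hd t ⟨ht, le_rfl⟩
    simp only [h.beta_zero, hI0, hG0, Matrix.mulVec_zero, smul_zero, zero_smul, sub_self] at this
    exact sub_eq_zero.1 this
  · have hc : ContinuousOn (fun t => ρ t + κ⁻¹ • γ t + ν⁻¹ • (G t - D *ᵥ I t)) (Ici 0) :=
      (h.rho_cont.add (h.gamma_cont.const_smul κ⁻¹)).add
        (ContinuousOn.const_smul (hGc.sub (hcm D hIc)) ν⁻¹)
    have hd : ∀ x ∈ Ico 0 t, HasDerivWithinAt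
        (fun t => ρ t + κ⁻¹ • γ t + ν⁻¹ • (G t - D *ᵥ I t)) 0 (Ici x) x := by
      intro x hx
      have h1 := (h.rho_deriv x hx.1).add ((h.gamma_deriv x hx.1).const_smul κ⁻¹)
      have h4 := ((hG x hx.1).sub (hasDerivWithinAt_mulVec D (hI x hx.1))).const_smul ν⁻¹
      refine (h1.add h4).congr_deriv ?_
      rw [h.gamma_eq x hx.1]
      simp only [Pi.sub_apply, Matrix.mulVec_sub]
      module
    have := constant_of_has_deriv_right_zero (hc.mono Icc_subset_Ici_self) hd t ⟨ht, le_rfl⟩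
    simp only [h.rho_zero, h.gamma_zero, hI0, hG0, Matrix.mulVec_zero, smul_zero, sub_self,
      add_zero] at this
    exact eq_neg_of_add_eq_zero_left this
  · have hc : ContinuousOn (fun t => G t j) (Ici 0) := fun x hx =>
      (continuousWithinAt_pi.1 (hGc x hx)) j
    have hd : ∀ x ∈ Ico 0 t, HasDerivWithinAt (fun t => G t j) 0 (Ici x) x := by
      intro x hx
      refine (hasDerivWithinAt_pi.1 (hG x hx.1) j).congr_deriv ?_
      simp [hγ x hx, hj]
    have := constant_of_has_deriv_right_zero (hc.mono Icc_subset_Ici_self) hd t ⟨ht, le_rfl⟩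
    simpa [hG0] using this

/-- Off `S` the integral of `γ - D β⋆` vanishes, so `ρ` there is `ν⁻¹ B I` with `I = ∫ (β - β⋆)`.
Substituting this into the integrated `β`-equation eliminates `ρ` off `S`, and `-I` solves a normal
equation of the kind irrepresentability controls. -/
lemma exists_resp (h : IsPath A D ν κ βs w ρ ρ' β β' γ γ') {S : Finset (Fin m)}
    (hs : ∀ j ∉ S, (D *ᵥ βs) j = 0) {t : ℝ} (ht : 0 ≤ t)
    (hγ : ∀ s ∈ Ico 0 t, ∀ j ∉ S, γ s j = 0) (hγt : ∀ j ∉ S, γ t j = 0) :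
    ∃ b, Resp A (rows D Sᶜ) ν b
        (κ⁻¹ • β t + Dᵀ *ᵥ mask S (ρ t + κ⁻¹ • γ t) - t • (Aᵀ *ᵥ w)) ∧
      ∀ j : (Sᶜ : Finset (Fin m)), ρ t j.1 = -(ν⁻¹ * (rows D Sᶜ *ᵥ b) j) := by
  obtain ⟨I, G, h1, h2, h3⟩ := h.exists_integrated
  have h1 := h1 t ht
  have h2 := h2 t ht
  have hG : ∀ j : (Sᶜ : Finset (Fin m)), G t j.1 = 0 := fun j => by
    have hj := Finset.mem_compl.1 j.2
    exact h3 t ht j.1 (hs _ hj) fun s hs' => hγ s hs' _ hj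
  have hv : ∀ j : (Sᶜ : Finset (Fin m)), (ρ t + κ⁻¹ • γ t) j.1
      = ν⁻¹ * (rows D Sᶜ *ᵥ I t) j := by
    intro j
    rw [h2, rows_mulVec]
    simp [hG j]
  refine ⟨-I t, ?_, fun j => ?_⟩
  · have hsplit := transpose_mulVec_split D S (ρ t + κ⁻¹ • γ t)
    have hv' : (fun j : (Sᶜ : Finset (Fin m)) => (ρ t + κ⁻¹ • γ t) j.1)
        = ν⁻¹ • (rows D Sᶜ *ᵥ I t) := funext hv
    rw [hv', h2, Matrix.mulVec_smul] at hsplit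
    have h5 : ν⁻¹ • (Dᵀ *ᵥ (D *ᵥ I t - G t)) = Dᵀ *ᵥ -(ν⁻¹ • (G t - D *ᵥ I t)) := by
      simp only [Matrix.mulVec_neg, Matrix.mulVec_smul, Matrix.mulVec_sub]; module
    rw [h5, hsplit] at h1
    unfold Resp
    rw [h1, h2]
    simp only [Matrix.mulVec_neg, smul_neg]
    abel
  · have := hv j
    have hj := hγt j.1 (Finset.mem_compl.1 j.2)
    simp only [Pi.add_apply, Pi.smul_apply, hj, smul_zero, add_zero] at this
    rw [this, Matrix.mulVec_neg, Pi.neg_apply]; ring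

lemma beta_mem (h : IsPath A D ν κ βs w ρ ρ' β β' γ γ') (hκ : κ ≠ 0)
    {L : Submodule ℝ (Fin p → ℝ)} (hA : ∀ y, Aᵀ *ᵥ y ∈ L) (hD : ∀ y, Dᵀ *ᵥ y ∈ L) {t : ℝ}
    (ht : 0 ≤ t) : β t ∈ L := by
  obtain ⟨I, G, h1, -, -⟩ := h.exists_integrated
  have h2 : κ⁻¹ • β t ∈ L := by
    rw [h1 t ht]
    exact L.sub_mem (L.sub_mem (L.smul_mem _ (hA _)) (hA _)) (L.smul_mem _ (hD _))
  have h3 := L.smul_mem κ h2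
  rwa [smul_smul, mul_inv_cancel₀ hκ, one_smul] at h3

end IsPath

/-! ### Decay rates of a scalar Lyapunov function -/

section ScalarDecay
open Set
variable {ψ q d : ℝ → ℝ} {τ lamH s : ℝ}

/-- Hyperbolic decay on the first half of `[0, τ]` brings `ψ` down to `18s/(λ_H τ)`. On the second
half the dissipation is at least its final value `q τ`, and in total it cannot exceed what is left
of `ψ`. -/
lemma decay_sq_le (hτ : 0 < τ) (hH : 0 < lamH) (hs : 1 ≤ s) (hψ : ContinuousOn ψ (Icc 0 τ))
    (hψ' : ∀ x ∈ Ico 0 τ, HasDerivWithinAt ψ (-q x) (Ici x) x)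
    (hψ0 : ∀ x ∈ Icc 0 τ, 0 ≤ ψ x) (hqmono : ∀ x ∈ Icc 0 τ, q τ ≤ q x)
    (hψd : ∀ x ∈ Icc 0 τ, ψ x ^ 2 ≤ 9 * s * d x) (hdq : ∀ x ∈ Icc 0 τ, lamH * d x ≤ q x) :
    d τ ≤ 36 * s / (lamH * τ) ^ 2 := by
  have hs0 : 0 < s := by linarith
  have h2 : 0 < τ / 2 := by linarith
  have h3 : τ / 2 ≤ τ := by linarith
  have h4 := hyperbolic_decay (c := lamH / (9 * s)) (t := τ / 2) h2 (by positivity)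
    (hψ.mono (Icc_subset_Icc_right h3)) (fun x hx => hψ' x ⟨hx.1, hx.2.trans_le h3⟩)
    (fun x hx => by
      have hx' : x ∈ Icc 0 τ := ⟨hx.1, hx.2.le.trans h3⟩
      rw [div_mul_eq_mul_div, div_le_iff₀ (by positivity)]
      nlinarith [hψd x hx', hdq x hx'])
  have h5 := linear_decay (c := q τ) h3 (hψ.mono (Icc_subset_Icc_left h2.le))
    (fun x hx => hψ' x ⟨h2.le.trans hx.1, hx.2⟩) (fun x hx => hqmono x ⟨h2.le.trans hx.1, hx.2.le⟩)
  have h6 := hψ0 τ ⟨hτ.le, le_rfl⟩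
  have h7 := hdq τ ⟨hτ.le, le_rfl⟩
  have h8 : 1 / (lamH / (9 * s) * (τ / 2)) = 18 * s / (lamH * τ) := by field_simp; norm_num
  rw [h8] at h4
  have h9 : q τ * (τ / 2) ≤ 18 * s / (lamH * τ) := by linarith
  rw [le_div_iff₀ (by positivity)] at h9 ⊢
  nlinarith [mul_pos hH hτ, mul_le_mul_of_nonneg_right h7 (mul_pos (mul_pos hH hτ) hτ).le]

/-- Four regimes: hyperbolic decay to `3sG` in time `3/(λ_H G)`; exponential decay at rate `λ_H
G/3`, which removes the factor `s` in time `3 log s/(λ_H G)`; linear decay at rate `λ_H G²` for time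
`3/(λ_H G)`, until `2κψ < G²`; from then on `2κψ = d`, and decay at rate `2κλ_H` gains the factor
`R²` in time `log R/(κλ_H)`. -/
lemma decay_below_threshold {G κ R : ℝ} (hH : 0 < lamH) (hs : 1 ≤ s) (hG : 0 < G)
    (hκ : 0 < κ) (hR : 1 ≤ R) (hτ : (6 + 3 * Real.log s) / G + Real.log R / κ ≤ lamH * τ)
    (hψ : ContinuousOn ψ (Icc 0 τ))
    (hψ' : ∀ x ∈ Ico 0 τ, HasDerivWithinAt ψ (-q x) (Ici x) x)
    (hψ0 : ∀ x ∈ Icc 0 τ, 0 ≤ ψ x)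
    (hψd : ∀ x ∈ Icc 0 τ, ψ x ^ 2 ≤ 9 * s * d x) (hdq : ∀ x ∈ Icc 0 τ, lamH * d x ≤ q x)
    (hψG : ∀ x ∈ Icc 0 τ, G * ψ x ≤ 3 * d x) (hd0 : ∀ x ∈ Icc 0 τ, 0 ≤ d x)
    (hdψ : ∀ x ∈ Icc 0 τ, d x ≤ 2 * κ * ψ x)
    (hsmall : ∀ x ∈ Icc 0 τ, d x < G ^ 2 → 2 * κ * ψ x = d x) :
    d τ ≤ (G / R) ^ 2 := by
  have hs0 : 0 < s := by linarith
  have hls : 0 ≤ Real.log s := Real.log_nonneg hs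
  have hlR : 0 ≤ Real.log R := Real.log_nonneg hR
  set t₁ := 3 / (lamH * G) with ht₁
  set t₂ := t₁ + 3 * Real.log s / (lamH * G) with ht₂
  set t₃ := t₂ + 3 / (lamH * G) with ht₃
  have h01 : 0 < t₁ := by positivity
  have h12 : t₁ ≤ t₂ := le_add_of_nonneg_right (by positivity)
  have h23 : t₂ ≤ t₃ := le_add_of_nonneg_right (by positivity)
  have h3τ : Real.log R / (κ * lamH) ≤ τ - t₃ := by
    have e : t₃ + Real.log R / (κ * lamH)
        = ((6 + 3 * Real.log s) / G + Real.log R / κ) / lamH := by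
      rw [ht₃, ht₂, ht₁]; field_simp; ring
    have : t₃ + Real.log R / (κ * lamH) ≤ τ := by
      rw [e, div_le_iff₀ hH]; linarith
    linarith
  have h3τ' : t₃ ≤ τ := by
    have : 0 ≤ Real.log R / (κ * lamH) := by positivity
    linarith
  have hsub : ∀ {a b : ℝ}, 0 ≤ a → b ≤ τ → Icc a b ⊆ Icc 0 τ := fun ha hb =>
    Icc_subset_Icc ha hb
  have hder : ∀ {a b : ℝ}, 0 ≤ a → b ≤ τ → ∀ x ∈ Ico a b, HasDerivWithinAt ψ (-q x) (Ici x) x :=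
    fun ha hb x hx => hψ' x ⟨ha.trans hx.1, hx.2.trans_le hb⟩
  have hanti : ∀ {a b : ℝ}, 0 ≤ a → a ≤ b → b ≤ τ → ψ b ≤ ψ a := by
    intro a b ha hab hb
    have := linear_decay (c := 0) hab (hψ.mono (hsub ha hb)) (hder ha hb) (fun x hx => by
      have hx' := hsub ha hb ⟨hx.1, hx.2.le⟩
      exact (mul_nonneg hH.le (hd0 x hx')).trans (hdq x hx'))
    linarith
  have hA : ψ t₁ ≤ 3 * s * G := by
    have hle : t₁ ≤ τ := h12.trans (h23.trans h3τ')
    have := hyperbolic_decay (c := lamH / (9 * s)) (t := t₁) h01 (by positivity)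
      (hψ.mono (hsub le_rfl hle)) (hder le_rfl hle) (fun x hx => by
        have hx' := hsub le_rfl hle ⟨hx.1, hx.2.le⟩
        rw [div_mul_eq_mul_div, div_le_iff₀ (by positivity)]
        nlinarith [hψd x hx', hdq x hx'])
    refine this.trans_eq ?_
    rw [ht₁]; field_simp; norm_num
  have hB : ψ t₂ ≤ 3 * G := by
    have hle : t₂ ≤ τ := h23.trans h3τ'
    have := exponential_decay (c := lamH * G / 3) h12 (hψ.mono (hsub h01.le hle))
      (hder h01.le hle) (fun x hx => by
        have hx' := hsub h01.le hle ⟨hx.1, hx.2.le⟩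
        nlinarith [hψG x hx', hdq x hx'])
    have e : lamH * G / 3 * (t₂ - t₁) = Real.log s := by rw [ht₂]; field_simp; ring
    rw [e, Real.exp_neg, Real.exp_log hs0] at this
    calc ψ t₂ ≤ s⁻¹ * ψ t₁ := this
      _ ≤ s⁻¹ * (3 * s * G) := mul_le_mul_of_nonneg_left hA (by positivity)
      _ = 3 * G := by field_simp
  have h02 : 0 ≤ t₂ := h01.le.trans h12
  have h03 : 0 ≤ t₃ := h02.trans h23
  have hC : 2 * κ * ψ t₃ < G ^ 2 := by
    by_contra! hcon
    -- If `2κψ` were still at least `G²` at `t₃`, then `d ≥ G²` on the whole interval, because a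
    -- smaller `d` would equal `2κψ`. Linear decay would then consume all of `ψ`.
    have := linear_decay (c := lamH * G ^ 2) h23 (hψ.mono (hsub h02 h3τ')) (hder h02 h3τ')
      (fun x hx => by
        have hx' := hsub h02 h3τ' ⟨hx.1, hx.2.le⟩
        have h1 := hanti (h02.trans hx.1) hx.2.le h3τ'
        have h2 : G ^ 2 ≤ d x := by
          by_contra! hlt
          have := hsmall x hx' hlt
          nlinarith
        exact (mul_le_mul_of_nonneg_left h2 hH.le).trans (hdq x hx'))
    have e : lamH * G ^ 2 * (t₃ - t₂) = 3 * G := by rw [ht₃]; field_simp; ring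
    rw [e] at this
    have h0 : ψ t₃ ≤ 0 := by linarith
    nlinarith [pow_pos hG 2]
  have hD := exponential_decay (c := 2 * κ * lamH) h3τ' (hψ.mono (hsub h03 le_rfl))
    (hder h03 le_rfl) (fun x hx => by
      have hx' := hsub h03 le_rfl ⟨hx.1, hx.2.le⟩
      have h1 := hanti h03 hx.1 hx.2.le
      have h2 : d x < G ^ 2 := by nlinarith [hdψ x hx']
      have h3 := hsmall x hx' h2
      nlinarith [hdq x hx'])
  have hE : Real.exp (-(2 * κ * lamH * (τ - t₃))) ≤ (R ^ 2)⁻¹ := by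
    have hR0 : 0 < R := by linarith
    rw [← Real.exp_log (pow_pos hR0 2), ← Real.exp_neg, Real.exp_le_exp, Real.log_pow, neg_le_neg_iff]
    rw [div_le_iff₀ (by positivity)] at h3τ
    push_cast
    linarith
  have hτmem : τ ∈ Icc 0 τ := ⟨h03.trans h3τ', le_rfl⟩
  have hψ3 := hψ0 t₃ ⟨h03, h3τ'⟩
  calc d τ ≤ 2 * κ * ψ τ := hdψ τ hτmem
    _ ≤ 2 * κ * ((R ^ 2)⁻¹ * ψ t₃) := by
        refine mul_le_mul_of_nonneg_left (hD.trans ?_) (by positivity)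
        exact mul_le_mul_of_nonneg_right hE hψ3
    _ = (R ^ 2)⁻¹ * (2 * κ * ψ t₃) := by ring
    _ ≤ (R ^ 2)⁻¹ * G ^ 2 := mul_le_mul_of_nonneg_left hC.le (by positivity)
    _ = (G / R) ^ 2 := by rw [div_pow]; ring

end ScalarDecay

/-! ### Bregman distance and the Lyapunov function -/

section Bregman
variable {m : ℕ} {γ ρ γo : Fin m → ℝ}

lemma bregman_nonneg (h : ρ ∈ subdiffL1 γ) (j : Fin m) : 0 ≤ |γo j| - γo j * ρ j := by
  have h1 := (mem_subdiffL1_iff_coord h j).1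
  have h2 : γo j * ρ j ≤ |γo j| * |ρ j| := by rw [← abs_mul]; exact le_abs_self _
  nlinarith [abs_nonneg (γo j)]

/-- So close to `γo j`, the coordinate `γ j` has the same sign, which `ρ j` must equal. -/
lemma bregman_eq_zero (h : ρ ∈ subdiffL1 γ) {j : Fin m} (hj : |γ j - γo j| < |γo j|) :
    |γo j| - γo j * ρ j = 0 := by
  rcases lt_trichotomy (γo j) 0 with h1 | h1 | h1
  · rw [abs_of_neg h1, abs_lt] at hj
    rw [subdiff_eq_neg_one h (by linarith), abs_of_neg h1]; ring
  · rw [h1, abs_zero] at hj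
    exact absurd hj (not_lt.2 (abs_nonneg _))
  · rw [abs_of_pos h1, abs_lt] at hj
    rw [subdiff_eq_one h (by linarith), abs_of_pos h1]; ring

lemma bregman_le (h : ρ ∈ subdiffL1 γ) (j : Fin m) : |γo j| - γo j * ρ j ≤ 2 * |γo j| := by
  have h1 := (mem_subdiffL1_iff_coord h j).1
  have h2 : -(γo j * ρ j) ≤ |γo j| * |ρ j| := by rw [← abs_mul]; exact neg_le_abs _
  nlinarith [abs_nonneg (γo j)]

lemma bregman_le_abs (h : ρ ∈ subdiffL1 γ) (j : Fin m) :
    |γo j| - γo j * ρ j ≤ 2 * |γ j - γo j| := by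
  rcases lt_or_ge |γ j - γo j| |γo j| with hj | hj
  · rw [bregman_eq_zero h hj]; positivity
  · have := bregman_le (γo := γo) h j; linarith

lemma bregman_mul_le_sq (h : ρ ∈ subdiffL1 γ) {G : ℝ} {j : Fin m}
    (hj : γo j ≠ 0 → G ≤ |γo j|) : G * (|γo j| - γo j * ρ j) ≤ 2 * (γ j - γo j) ^ 2 := by
  rcases lt_or_ge |γ j - γo j| |γo j| with hlt | hge
  · rw [bregman_eq_zero h hlt]; nlinarith [sq_nonneg (γ j - γo j)]
  · by_cases h0 : γo j = 0
    · rw [h0]; simp; positivity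
    · have h1 := hj h0
      have h2 := bregman_le (γo := γo) h j
      rw [← sq_abs (γ j - γo j)]
      calc G * (|γo j| - γo j * ρ j) ≤ |γ j - γo j| * (2 * |γ j - γo j|) :=
            mul_le_mul (h1.trans hge) (h2.trans (by linarith)) (bregman_nonneg h j) (abs_nonneg _)
        _ = _ := by ring

end Bregman

/-- Twice the excess loss over the oracle `(βo, γo)`, when the gradient vanishes there. -/
def energy {n m p : ℕ} (A : Matrix (Fin n) (Fin p) ℝ) (D : Matrix (Fin m) (Fin p) ℝ) (ν : ℝ)
    (βo : Fin p → ℝ) (γo : Fin m → ℝ) (b : Fin p → ℝ) (g : Fin m → ℝ) : ℝ :=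
  l2 (A *ᵥ (b - βo)) ^ 2 + ν⁻¹ * l2 (g - γo - D *ᵥ (b - βo)) ^ 2

/-- The squared distance to the oracle. -/
def distSq {m p : ℕ} (βo : Fin p → ℝ) (γo : Fin m → ℝ) (b : Fin p → ℝ) (g : Fin m → ℝ) : ℝ :=
  l2 (b - βo) ^ 2 + l2 (g - γo) ^ 2

/-- The Lyapunov function: squared distance plus Bregman distance of the `ℓ¹` norm. -/
def potential {m p : ℕ} (κ : ℝ) (βo : Fin p → ℝ) (γo : Fin m → ℝ) (b : Fin p → ℝ)
    (g r : Fin m → ℝ) : ℝ :=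
  (2 * κ)⁻¹ * distSq βo γo b g + ∑ j, (|γo j| - γo j * r j)

lemma distSq_nonneg {m p : ℕ} (βo : Fin p → ℝ) (γo : Fin m → ℝ) (b : Fin p → ℝ) (g : Fin m → ℝ) :
    0 ≤ distSq βo γo b g := by unfold distSq; positivity

section PotentialBounds
variable {m p : ℕ} {κ : ℝ} {βo b : Fin p → ℝ} {γo g r : Fin m → ℝ}

lemma distSq_le_potential (hκ : 0 < κ) (h : r ∈ subdiffL1 g) :
    distSq βo γo b g ≤ 2 * κ * potential κ βo γo b g r := by
  have h1 : 0 ≤ ∑ j, (|γo j| - γo j * r j) := Finset.sum_nonneg fun j _ => bregman_nonneg h j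
  unfold potential
  rw [mul_add, ← mul_assoc, mul_inv_cancel₀ (by positivity), one_mul]
  exact le_add_of_nonneg_right (by positivity)

lemma potential_eq_of_lt {G : ℝ} (hκ : 0 < κ) (hG : 0 < G) (h : r ∈ subdiffL1 g)
    (hγo : ∀ j, γo j ≠ 0 → G ≤ |γo j|) (hlt : distSq βo γo b g < G ^ 2) :
    2 * κ * potential κ βo γo b g r = distSq βo γo b g := by
  have h1 : ∑ j, (|γo j| - γo j * r j) = 0 := by
    refine Finset.sum_eq_zero fun j _ => ?_
    by_cases h0 : γo j = 0
    · simp [h0]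
    · apply bregman_eq_zero h
      refine lt_of_lt_of_le ?_ (hγo j h0)
      apply lt_of_le_of_lt (abs_le_l2 (g - γo) j)
      apply lt_of_pow_lt_pow_left₀ 2 hG.le
      exact lt_of_le_of_lt (le_add_of_nonneg_left (sq_nonneg _)) hlt
  unfold potential
  rw [h1, add_zero, ← mul_assoc, mul_inv_cancel₀ (by positivity), one_mul]

lemma potential_mul_le {G : ℝ} (hGκ : G ≤ 2 * κ) (hκ : 0 < κ) (h : r ∈ subdiffL1 g)
    (hγo : ∀ j, γo j ≠ 0 → G ≤ |γo j|) :
    G * potential κ βo γo b g r ≤ 3 * distSq βo γo b g := by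
  have h1 : G * ∑ j, (|γo j| - γo j * r j) ≤ 2 * l2 (g - γo) ^ 2 := by
    rw [l2_sq_eq_sum, Finset.mul_sum, Finset.mul_sum]
    exact Finset.sum_le_sum fun j _ => bregman_mul_le_sq h (hγo j)
  have h2 : G * (2 * κ)⁻¹ ≤ 1 := by
    rw [← div_eq_mul_inv, div_le_one (by positivity)]; exact hGκ
  have h3 := mul_le_mul_of_nonneg_right h2 (distSq_nonneg βo γo b g)
  have h4 : l2 (g - γo) ^ 2 ≤ distSq βo γo b g := le_add_of_nonneg_left (sq_nonneg _)
  unfold potential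
  rw [mul_add, ← mul_assoc]
  linarith

/-- By Cauchy-Schwarz on `S` the Bregman part is at most `2√(s d)`, with `d` the squared distance.
The bound `√d ≤ 2κ` makes the quadratic part `d/(2κ)` at most `√d`, hence at most `√(s d)`. Together
they give the factor `3² = 9`. -/
lemma potential_sq_le (S : Finset (Fin m)) (hS : S.Nonempty) (hκ : 0 < κ) (h : r ∈ subdiffL1 g)
    (hγo : ∀ j ∉ S, γo j = 0) (hd : distSq βo γo b g ≤ (2 * κ) ^ 2) :
    potential κ βo γo b g r ^ 2 ≤ 9 * S.card * distSq βo γo b g := by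
  have hd0 := distSq_nonneg βo γo b g
  have hs : (1 : ℝ) ≤ S.card := by exact_mod_cast hS.card_pos
  set s : ℝ := (S.card : ℝ) with hsdef
  set x := √(s * distSq βo γo b g) with hx
  have hx0 : 0 ≤ x := Real.sqrt_nonneg _
  have hxsq : x ^ 2 = s * distSq βo γo b g := Real.sq_sqrt (by positivity)
  have h1 : ∑ j, (|γo j| - γo j * r j) ≤ 2 * x := by
    have e1 : ∑ j, (|γo j| - γo j * r j) = ∑ j ∈ S, (|γo j| - γo j * r j) := by
      symm
      apply Finset.sum_subset (Finset.subset_univ S)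
      intro j _ hj
      simp [hγo j hj]
    have e2 : ∑ j ∈ S, (|γo j| - γo j * r j) ≤ 2 * ∑ j ∈ S, |g j - γo j| := by
      rw [Finset.mul_sum]
      exact Finset.sum_le_sum fun j _ => bregman_le_abs h j
    have e3 : (∑ j ∈ S, |g j - γo j|) ≤ x := by
      apply abs_le_of_sq_le_sq' _ hx0 |>.2
      rw [hxsq]
      refine sq_sum_le_card_mul_sum_sq.trans ?_
      refine mul_le_mul_of_nonneg_left ?_ (by positivity)
      calc ∑ j ∈ S, |g j - γo j| ^ 2 ≤ ∑ j, |g j - γo j| ^ 2 :=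
            Finset.sum_le_sum_of_subset_of_nonneg (Finset.subset_univ S) fun _ _ _ => sq_nonneg _
        _ = l2 (g - γo) ^ 2 := by rw [l2_sq_eq_sum]; simp
        _ ≤ _ := le_add_of_nonneg_left (sq_nonneg _)
    rw [e1]; linarith
  have h2 : (2 * κ)⁻¹ * distSq βo γo b g ≤ x := by
    rw [← div_eq_inv_mul, div_le_iff₀ (by positivity)]
    apply abs_le_of_sq_le_sq' _ (by positivity) |>.2
    rw [mul_pow, hxsq]
    have : distSq βo γo b g ^ 2 ≤ distSq βo γo b g * (2 * κ) ^ 2 := by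
      rw [sq]; exact mul_le_mul_of_nonneg_left hd hd0
    nlinarith [mul_nonneg hd0 (sq_nonneg (2 * κ))]
  have h3 : 0 ≤ potential κ βo γo b g r :=
    add_nonneg (by positivity) (Finset.sum_nonneg fun j _ => bregman_nonneg h j)
  have h4 : potential κ βo γo b g r ≤ 3 * x := by unfold potential; linarith
  calc potential κ βo γo b g r ^ 2 ≤ (3 * x) ^ 2 := pow_le_pow_left₀ h3 h4 2
    _ = _ := by rw [mul_pow, hxsq]; ring

end PotentialBounds

/-! ### Energy and Lyapunov identities along a path -/

namespace IsPath
open Filter Topology Set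
variable {n m p : ℕ} {A : Matrix (Fin n) (Fin p) ℝ} {D : Matrix (Fin m) (Fin p) ℝ}
  {ν κ : ℝ} {βs βo : Fin p → ℝ} {γo : Fin m → ℝ} {w : Fin n → ℝ} {ρ ρ' : ℝ → Fin m → ℝ}
  {β β' : ℝ → Fin p → ℝ} {γ γ' : ℝ → Fin m → ℝ}

section
variable (h : IsPath A D ν κ βs w ρ ρ' β β' γ γ')
  (ho : Aᵀ *ᵥ (A *ᵥ (βo - βs)) - Aᵀ *ᵥ w + ν⁻¹ • (Dᵀ *ᵥ (D *ᵥ βo - γo)) = 0)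
include h ho

lemma beta_eq_oracle {t : ℝ} (ht : 0 ≤ t) : κ⁻¹ • β' t = -(Aᵀ *ᵥ (A *ᵥ (β t - βo)))
    + ν⁻¹ • (Dᵀ *ᵥ (γ t - γo - D *ᵥ (β t - βo))) := by
  rw [h.beta_eq t ht, ← sub_zero (-(Aᵀ *ᵥ (A *ᵥ (β t - βs)) - Aᵀ *ᵥ w
    + ν⁻¹ • (Dᵀ *ᵥ (D *ᵥ β t - γ t)))), ← neg_eq_zero.2 ho]
  simp only [Matrix.mulVec_sub]
  module

/-- Up to a constant, the quantity is twice the loss: the linear term comes from the `γ`-gradient at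
the oracle, which need not vanish off `S`. The dynamics dissipates `2κ⁻¹(‖β'‖² + ‖γ'‖²)`; `ρ'` does
not contribute, since `γ' · ρ' = 0`. -/
lemma energy_add_le {a t : ℝ} (hκ : 0 < κ) (ha : 0 ≤ a) (hat : a ≤ t) :
    energy A D ν βo γo (β t) (γ t) + 2 * (γ t ⬝ᵥ (ν⁻¹ • (γo - D *ᵥ βo)))
      ≤ energy A D ν βo γo (β a) (γ a) + 2 * (γ a ⬝ᵥ (ν⁻¹ • (γo - D *ᵥ βo))) := by
  set ξ := ν⁻¹ • (γo - D *ᵥ βo) with hξ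
  have hd : ∀ x, 0 ≤ x → HasDerivWithinAt
      (fun t => energy A D ν βo γo (β t) (γ t) + 2 * (γ t ⬝ᵥ ξ))
      (-(2 * κ⁻¹ * (β' x ⬝ᵥ β' x + γ' x ⬝ᵥ γ' x))) (Ici x) x := by
    intro x hx
    have h1 := hasDerivWithinAt_l2_sq (hasDerivWithinAt_mulVec A ((h.beta_deriv x hx).sub_const βo))
    have h2 := hasDerivWithinAt_l2_sq (((h.gamma_deriv x hx).sub_const γo).sub
      (hasDerivWithinAt_mulVec D ((h.beta_deriv x hx).sub_const βo)))
    have h3 := hasDerivWithinAt_dot (h.gamma_deriv x hx) (hasDerivWithinAt_const x (Ici x) ξ)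
    refine ((h1.add (h2.const_mul ν⁻¹)).add (h3.const_mul 2)).congr_deriv ?_
    have e1 := congrArg (fun v => v ⬝ᵥ β' x) (h.beta_eq_oracle ho hx)
    have e2 := congrArg (fun v => v ⬝ᵥ γ' x) (h.gamma_eq x hx)
    have e3 := h.gamma_deriv_dot_rho_deriv hx
    have e4 : ν⁻¹ • (γ x - D *ᵥ β x) = ν⁻¹ • (γ x - γo - D *ᵥ (β x - βo)) + ξ := by
      rw [hξ, Matrix.mulVec_sub]; module
    rw [e4] at e2
    simp only [add_dotProduct, smul_dotProduct, neg_dotProduct, transpose_mulVec_dot,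
      smul_eq_mul] at e1 e2
    rw [dotProduct_comm] at e3
    rw [dotProduct_zero, add_zero, dotProduct_comm (γ' x) ξ]
    simp only [Pi.sub_apply, dotProduct_sub]
    linear_combination 2 * e1 + 2 * e2 - 2 * e3
  have hc : ContinuousOn (fun t => energy A D ν βo γo (β t) (γ t) + 2 * (γ t ⬝ᵥ ξ)) (Ici 0) := by
    have c1 := h.beta_cont
    have c2 := h.gamma_cont
    have hl : ∀ {k : ℕ}, Continuous (fun v : Fin k → ℝ => l2 v ^ 2) := by
      intro k; simp only [l2_sq_eq_sum]; fun_prop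
    have hm : ∀ {k l : ℕ} (M : Matrix (Fin k) (Fin l) ℝ), Continuous fun v => M *ᵥ v := fun M =>
      (LinearMap.toContinuousLinearMap M.mulVecLin).continuous
    have hdot : Continuous fun v : Fin m → ℝ => v ⬝ᵥ ξ := by
      simp only [dotProduct]; fun_prop
    have k1 := c1.sub (continuousOn_const (c := βo))
    have k2 := c2.sub (continuousOn_const (c := γo))
    exact ((hl.comp_continuousOn ((hm A).comp_continuousOn k1)).add
      (continuousOn_const.mul (hl.comp_continuousOn
        (k2.sub ((hm D).comp_continuousOn k1))))).add
      (continuousOn_const.mul (hdot.comp_continuousOn c2))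
  have := le_of_right_deriv_le (c := 0) hat (hc.mono fun x hx => ha.trans hx.1)
    (fun x hx => hd x (ha.trans hx.1)) (fun x _ => by
      rw [neg_nonpos, ← l2_sq, ← l2_sq]
      have := inv_pos.2 hκ
      positivity)
  linarith

/-- The equations of motion are paired with the displacement from the oracle. Since `γ · ρ' = 0`,
the pairing of `ρ'` leaves `-γo · ρ'`, which is the derivative of the Bregman part. -/
lemma potential_hasDeriv {t : ℝ} (hκ : 0 < κ) (ht : 0 ≤ t)
    (hξ : (γ t - γo) ⬝ᵥ (ν⁻¹ • (γo - D *ᵥ βo)) = 0) :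
    HasDerivWithinAt (fun t => potential κ βo γo (β t) (γ t) (ρ t))
      (-energy A D ν βo γo (β t) (γ t)) (Ici t) t := by
  have h1 := hasDerivWithinAt_l2_sq ((h.beta_deriv t ht).sub_const βo)
  have h2 := hasDerivWithinAt_l2_sq ((h.gamma_deriv t ht).sub_const γo)
  have h3 := (hasDerivWithinAt_dot (hasDerivWithinAt_const t (Ici t) γo)
    (h.rho_deriv t ht)).const_sub (∑ j, |γo j|)
  have e0 : (fun t => potential κ βo γo (β t) (γ t) (ρ t)) = fun t =>
      (2 * κ)⁻¹ * (l2 (β t - βo) ^ 2 + l2 (γ t - γo) ^ 2) + (∑ j, |γo j| - γo ⬝ᵥ ρ t) := by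
    funext t
    rw [potential, distSq, Finset.sum_sub_distrib]; rfl
  rw [e0]
  refine (((h1.add h2).const_mul (2 * κ)⁻¹).add h3).congr_deriv ?_
  have e1 := congrArg (fun v => (β t - βo) ⬝ᵥ v) (h.beta_eq_oracle ho ht)
  have e2 := congrArg (fun v => (γ t - γo) ⬝ᵥ v) (h.gamma_eq t ht)
  have e3 := h.gamma_dot_rho_deriv ht
  have e4 : ν⁻¹ • (γ t - D *ᵥ β t)
      = ν⁻¹ • (γ t - γo - D *ᵥ (β t - βo)) + ν⁻¹ • (γo - D *ᵥ βo) := by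
    rw [Matrix.mulVec_sub]; module
  rw [e4] at e2
  simp only [dotProduct_add, dotProduct_smul, dotProduct_neg, dot_transpose_mulVec,
    smul_eq_mul] at e1 e2 hξ
  have e5 : (2 * κ)⁻¹ = κ⁻¹ / 2 := by field_simp
  rw [e5, zero_dotProduct, zero_add, energy, l2_sq, l2_sq]
  simp only [sub_dotProduct (γ t) γo (ρ' t)] at e2
  rw [sub_dotProduct (γ t - γo) (D *ᵥ (β t - βo))]
  linear_combination e1 + e2 - e3 - hξ

end

lemma potential_continuousOn (h : IsPath A D ν κ βs w ρ ρ' β β' γ γ') (βo : Fin p → ℝ)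
    (γo : Fin m → ℝ) : ContinuousOn (fun t => potential κ βo γo (β t) (γ t) (ρ t)) (Ici 0) := by
  have hl : ∀ {k : ℕ}, Continuous (fun v : Fin k → ℝ => l2 v ^ 2) := by
    intro k; simp only [l2_sq_eq_sum]; fun_prop
  have hb : Continuous fun v : Fin m → ℝ => ∑ j, (|γo j| - γo j * v j) := by fun_prop
  exact (continuousOn_const.mul ((hl.comp_continuousOn (h.beta_cont.sub continuousOn_const)).add
    (hl.comp_continuousOn (h.gamma_cont.sub continuousOn_const)))).add
    (hb.comp_continuousOn h.rho_cont)

/-- If the oracle dynamics keep `ρ` away from `±1` outside `S`, then `γ` is supported in `S`. -/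
lemma support_subset (h : IsPath A D ν κ βs w ρ ρ' β β' γ γ') {S : Finset (Fin m)} {τ : ℝ}
    (hstep : ∀ t ∈ Icc 0 τ, (∀ s ∈ Ico 0 t, ∀ j ∉ S, γ s j = 0) → (∀ j ∉ S, γ t j = 0) →
      ∀ j ∉ S, |ρ t j| < 1) :
    ∀ t ∈ Icc 0 τ, ∀ j ∉ S, γ t j = 0 := by
  by_contra! hcon
  obtain ⟨t₁, ht₁, j₁, hj₁, hne⟩ := hcon
  set bad : Set ℝ := {t | t ∈ Icc 0 τ ∧ ∃ j ∉ S, γ t j ≠ 0} with hbad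
  have hbne : bad.Nonempty := ⟨t₁, ht₁, j₁, hj₁, hne⟩
  have hbdd : BddBelow bad := ⟨0, fun t ht => ht.1.1⟩
  set t₀ := sInf bad with ht₀
  have h0 : 0 ≤ t₀ := le_csInf hbne fun t ht => ht.1.1
  have h1 : t₀ ≤ τ := (csInf_le hbdd ⟨ht₁, j₁, hj₁, hne⟩).trans ht₁.2
  have hbefore : ∀ s ∈ Ico 0 t₀, ∀ j ∉ S, γ s j = 0 := by
    intro s hs j hj
    by_contra hne
    exact absurd (csInf_le hbdd ⟨⟨hs.1, hs.2.le.trans h1⟩, j, hj, hne⟩) (not_le.2 hs.2)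
  have hγc : ∀ j, ContinuousOn (fun t => γ t j) (Ici 0) := fun j x hx =>
    continuousWithinAt_pi.1 (h.gamma_cont x hx) j
  have hρc : ∀ j, ContinuousOn (fun t => ρ t j) (Ici 0) := fun j x hx =>
    continuousWithinAt_pi.1 (h.rho_cont x hx) j
  have hat : ∀ j ∉ S, γ t₀ j = 0 := by
    intro j hj
    rcases h0.eq_or_lt with he | hlt
    · rw [← he, h.gamma_zero]; rfl
    · have heq : EqOn (fun t => γ t j) (fun _ => 0) (Ico 0 t₀) := fun s hs => hbefore s hs j hj
      exact heq.of_subset_closure ((hγc j).mono Icc_subset_Ici_self) continuousOn_const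
        Ico_subset_Icc_self (by rw [closure_Ico hlt.ne]) ⟨h0, le_rfl⟩
  have hρ := hstep t₀ ⟨h0, h1⟩ hbefore hat
  -- At `t₀` the path is still supported in `S` by continuity. The strict bound on `ρ` persists to
  -- the right and forces `γ = 0` there, although every right neighbourhood of `t₀` contains a bad
  -- time.
  have hev : ∀ᶠ s in 𝓝[≥] t₀, ∀ j ∉ S, |ρ s j| < 1 := by
    rw [eventually_all]
    intro j
    by_cases hj : j ∈ S
    · exact Eventually.of_forall fun s hs => absurd hj hs
    · have hc : ContinuousWithinAt (fun t => |ρ t j|) (Ici t₀) t₀ :=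
        ((hρc j).abs t₀ h0).mono (Ici_subset_Ici.2 h0)
      filter_upwards [hc.eventually (gt_mem_nhds (hρ j hj))] with s hs _ using hs
  obtain ⟨u, hu, hsub⟩ := mem_nhdsGE_iff_exists_Ico_subset.1 hev
  obtain ⟨t, ht, htu⟩ := exists_lt_of_csInf_lt hbne (show sInf bad < u from hu)
  have htge : t₀ ≤ t := csInf_le hbdd ht
  obtain ⟨j, hj, hne⟩ := ht.2
  exact hne (eq_zero_of_abs_subdiff_lt (h.subdiff t ht.1.1) (hsub ⟨htge, htu⟩ j hj))

end IsPath

/-! ### Nested projections, supports and signs -/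

section KerProj
variable {α β ι : Type*} [Fintype α] [Fintype β] [Fintype ι] [DecidableEq ι]

/-- The projection onto the larger kernel fixes the smaller one; transposing this identity between
symmetric matrices reverses the order. -/
lemma kerProj_mul_of_ker_le {Q₁ : Matrix α ι ℝ} {Q₂ : Matrix β ι ℝ}
    (h : ∀ x, Q₁ *ᵥ x = 0 → Q₂ *ᵥ x = 0) (x : ι → ℝ) :
    kerProj Q₁ *ᵥ (kerProj Q₂ *ᵥ x) = kerProj Q₁ *ᵥ x := by
  have h1 : kerProj Q₂ * kerProj Q₁ = kerProj Q₁ := by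
    refine Matrix.ext_of_mulVec_single fun i => ?_
    rw [← Matrix.mulVec_mulVec]
    exact kerProj_mulVec_of_ker Q₂ (h _ (mulVec_kerProj Q₁ _))
  have h2 := congrArg Matrix.transpose h1
  rw [Matrix.transpose_mul, kerProj_symm, kerProj_symm] at h2
  rw [Matrix.mulVec_mulVec, h2]

end KerProj

lemma mem_supp {m : ℕ} {v : Fin m → ℝ} {j : Fin m} : j ∈ supp v ↔ v j ≠ 0 := by simp [supp]

lemma l2_le_sqrt_card_mul {m : ℕ} {S : Finset (Fin m)} {v : Fin m → ℝ} {c : ℝ} (hc : 0 ≤ c)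
    (h0 : ∀ j ∉ S, v j = 0) (h : ∀ j, |v j| ≤ c) : l2 v ≤ √S.card * c := by
  apply l2_le_of_sq_le_sq (by positivity)
  rw [mul_pow, Real.sq_sqrt (Nat.cast_nonneg _), l2_sq_eq_sum]
  calc ∑ j, v j ^ 2 = ∑ j ∈ S, v j ^ 2 := by
        symm
        exact Finset.sum_subset (Finset.subset_univ S) fun j _ hj => by rw [h0 j hj]; simp
    _ ≤ ∑ _j ∈ S, c ^ 2 := Finset.sum_le_sum fun j _ => by
        rw [← sq_abs]; exact pow_le_pow_left₀ (abs_nonneg _) (h j) 2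
    _ = S.card * c ^ 2 := by simp

lemma sign_eq_of_abs_sub_lt {x y : ℝ} (h : |x - y| < |y|) : SignType.sign x = SignType.sign y := by
  rcases lt_trichotomy y 0 with h1 | h1 | h1
  · rw [abs_of_neg h1, abs_lt] at h
    rw [sign_neg h1, sign_neg (by linarith)]
  · rw [h1, abs_zero] at h
    exact absurd h (not_lt.2 (abs_nonneg _))
  · rw [abs_of_pos h1, abs_lt] at h
    rw [sign_pos h1, sign_pos (by linarith)]

/-! ### Deterministic consistency on the good noise event -/

namespace Regular
open Set
variable {n m p : ℕ} {A : Matrix (Fin n) (Fin p) ℝ} {D : Matrix (Fin m) (Fin p) ℝ}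
  {L : Submodule ℝ (Fin p → ℝ)} {S : Finset (Fin m)} {ν η lamH lamD LamD LamX i₁ : ℝ}
  {κ σ τ : ℝ} {βs βo : Fin p → ℝ} {γo : Fin m → ℝ} {w : Fin n → ℝ} {ρ ρ' : ℝ → Fin m → ℝ}
  {β β' : ℝ → Fin p → ℝ} {γ γ' : ℝ → Fin m → ℝ}

lemma kappaBound_eq (h : Regular A D L S ν η lamH lamD LamD LamX i₁) (hσ : 0 < σ) :
    ∃ a Z, 0 < Z ∧ 0 ≤ a ∧ a = lamD⁻¹ + LamX * lamD⁻¹ * i₁ ∧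
      Z = (1 + LamD) * l2 βs + 2 * σ / lamH * (LamX / lamD + LamX / lamD ^ 2
        + (lamH * lamD ^ 2 + LamX ^ 2) / lamD ^ 2 * i₁) ∧
      kappaBound lamD LamD LamX lamH i₁ ν σ η (l2 βs) = 4 / η * (1 + a)
        * (1 + √(2 * (1 + ν * LamX ^ 2 + LamD ^ 2) / (lamH * ν))) * Z := by
  have hH := h.lamH_pos
  have hX := h.LamX_pos
  have hd := h.lamD_pos
  have hD := h.LamD_pos
  have hi := h.i₁_nonneg
  have hb := l2_nonneg βs
  refine ⟨_, _, ?_, ?_, rfl, rfl, ?_⟩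
  · have : 0 < 2 * σ / lamH * (LamX / lamD + LamX / lamD ^ 2
        + (lamH * lamD ^ 2 + LamX ^ 2) / lamD ^ 2 * i₁) := by
      apply mul_pos (by positivity)
      have : 0 ≤ (lamH * lamD ^ 2 + LamX ^ 2) / lamD ^ 2 * i₁ := by positivity
      have : 0 < LamX / lamD + LamX / lamD ^ 2 := by positivity
      linarith
    have : 0 ≤ (1 + LamD) * l2 βs := by positivity
    linarith
  · positivity
  · unfold kappaBound
    have : 1 + 1 / lamD + LamX / lamD * i₁ = 1 + (lamD⁻¹ + LamX * lamD⁻¹ * i₁) := by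
      rw [one_div, div_eq_mul_inv]; ring
    rw [this]

section Oracle
variable (h : Regular A D L S ν η lamH lamD LamD LamX i₁) (hs : ∀ j ∉ S, (D *ᵥ βs) j = 0)
  (hβo : βo = βs + noiseResp A (rows D Sᶜ) ν *ᵥ w) (hγo : γo = mask S (D *ᵥ βo))
include h hs hβo hγo

/-- On `S`, `γo` agrees with `D βo`; off `S`, `D βo` reduces to `B b` because `D β⋆` vanishes there.
What remains is the normal equation of `b`. -/
lemma oracle_gradient :
    Aᵀ *ᵥ (A *ᵥ (βo - βs)) - Aᵀ *ᵥ w + ν⁻¹ • (Dᵀ *ᵥ (D *ᵥ βo - γo)) = 0 := by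
  set b := noiseResp A (rows D Sᶜ) ν *ᵥ w with hb
  have h1 := resp_noiseResp A (rows D Sᶜ) h.nu_pos w
  have h2 : βo - βs = b := by rw [hβo]; abel
  have h3 : mask S (D *ᵥ βo - γo) = 0 := by
    funext j
    by_cases hj : j ∈ S
    · rw [mask_of_mem _ hj, Pi.sub_apply, hγo, mask_of_mem _ hj, sub_self]; rfl
    · rw [mask_of_notMem _ hj]; rfl
  have h4 : (fun j : (Sᶜ : Finset (Fin m)) => (D *ᵥ βo - γo) j.1) = rows D Sᶜ *ᵥ b := by
    funext j
    have hj := Finset.mem_compl.1 j.2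
    rw [Pi.sub_apply, hγo, mask_of_notMem _ hj, hβo, Matrix.mulVec_add, Pi.add_apply, hs _ hj,
      rows_mulVec]
    ring
  rw [transpose_mulVec_split D S, h3, h4, h2, ← h1]
  simp only [Matrix.mulVec_zero, add_zero]
  abel

omit h hs hβo in
lemma dot_oracle_eq_zero {g : Fin m → ℝ} (hg : ∀ j ∉ S, g j = 0) :
    g ⬝ᵥ (ν⁻¹ • (γo - D *ᵥ βo)) = 0 := by
  refine Finset.sum_eq_zero fun j _ => ?_
  by_cases hj : j ∈ S
  · simp [hγo, mask_of_mem _ hj]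
  · rw [hg j hj, zero_mul]

-- The right-hand side is the last factor of `kappaBound`: `κ` has to dominate the size of the
-- oracle.
omit hs in
lemma l2_oracle_le (hw : l2 w ≤ 2 * σ) :
    l2 βo + l2 γo ≤ (1 + LamD) * l2 βs + 2 * σ / lamH * (LamX / lamD + LamX / lamD ^ 2
        + (lamH * lamD ^ 2 + LamX ^ 2) / lamD ^ 2 * i₁) := by
  have hH := h.lamH_pos
  have hX := h.LamX_pos
  have hd := h.lamD_pos
  have hi := h.i₁_nonneg
  set b := noiseResp A (rows D Sᶜ) ν *ᵥ w with hb
  have hbL : b ∈ L := h.noiseResp_mem w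
  have hbr := resp_noiseResp A (rows D Sᶜ) h.nu_pos w
  have h1 := h.l2_mulVec_resp_le hbL hbr
  have h2 := h.l2_kerProj_resp_le hbL hbr
  have h3 := h.l2_resp_le b
  have h4 : l2 βo ≤ l2 βs + l2 b := by rw [hβo]; exact l2_add_le _ _
  have h5 : l2 γo ≤ l2 (D *ᵥ βs) + l2 (D *ᵥ b) := by
    refine le_trans ?_ (l2_add_le _ _)
    rw [← Matrix.mulVec_add, ← hβo, hγo]
    apply l2_le_of_sq_le_sq (l2_nonneg _)
    rw [l2_sq_split S (D *ᵥ βo)]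
    exact le_add_of_nonneg_right (sq_nonneg _)
  have h6 := h.normD βs
  have h7 : lamD⁻¹ * l2 (D *ᵥ b) ≤ lamD⁻¹ * (LamX / (lamH * lamD) * l2 w) :=
    mul_le_mul_of_nonneg_left h1 (inv_nonneg.2 hd.le)
  have h8 : LamX / (lamH * lamD) * l2 w + lamD⁻¹ * (LamX / (lamH * lamD) * l2 w)
      + i₁ * ((1 + LamX ^ 2 / (lamH * lamD ^ 2)) * l2 w)
      = l2 w / lamH * (LamX / lamD + LamX / lamD ^ 2
        + (lamH * lamD ^ 2 + LamX ^ 2) / lamD ^ 2 * i₁) := by field_simp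
  have h9 : l2 w / lamH * (LamX / lamD + LamX / lamD ^ 2
        + (lamH * lamD ^ 2 + LamX ^ 2) / lamD ^ 2 * i₁) ≤ 2 * σ / lamH * (LamX / lamD
        + LamX / lamD ^ 2 + (lamH * lamD ^ 2 + LamX ^ 2) / lamD ^ 2 * i₁) := by
    gcongr
  linarith

end Oracle

section Paths
variable (h : Regular A D L S ν η lamH lamD LamD LamX i₁)
  (hP : IsPath A D ν κ βs w ρ ρ' β β' γ γ') (hs : ∀ j ∉ S, (D *ᵥ βs) j = 0)
  (hβo : βo = βs + noiseResp A (rows D Sᶜ) ν *ᵥ w) (hγo : γo = mask S (D *ᵥ βo))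
  (hβs : βs ∈ L) (hκ0 : 0 < κ)
include h hP hs hβo hγo hβs hκ0

omit hs in
lemma lamH_mul_distSq_le {t : ℝ} (ht : 0 ≤ t) (hγt : ∀ j ∉ S, γ t j = 0) :
    lamH * distSq βo γo (β t) (γ t) ≤ energy A D ν βo γo (β t) (γ t) := by
  have hβoL : βo ∈ L := by rw [hβo]; exact L.add_mem hβs (h.noiseResp_mem w)
  refine h.rsc _ (L.sub_mem (hP.beta_mem hκ0.ne' h.memA h.memD ht) hβoL) _ fun j hj => ?_
  rw [Pi.sub_apply, hγt j hj, hγo, mask_of_notMem _ hj, sub_zero]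

omit hβs in
lemma energy_le_energy {a t : ℝ} (ha : 0 ≤ a) (hat : a ≤ t) (hγa : ∀ j ∉ S, γ a j = 0)
    (hγt : ∀ j ∉ S, γ t j = 0) :
    energy A D ν βo γo (β t) (γ t) ≤ energy A D ν βo γo (β a) (γ a) := by
  have := hP.energy_add_le (h.oracle_gradient hs hβo hγo) hκ0 ha hat
  rwa [dot_oracle_eq_zero hγo hγa, dot_oracle_eq_zero hγo hγt, mul_zero, add_zero, add_zero] at this

/-- Energy monotonicity between times `0` and `t` needs the support of `γ` at these two times only,
and `γ 0 = 0`. The first factor is the square root of the ratio between an upper bound for the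
quadratic form and the convexity constant. -/
lemma distSq_le_condition {t : ℝ} (ht : 0 ≤ t) (hγt : ∀ j ∉ S, γ t j = 0) :
    √(distSq βo γo (β t) (γ t))
      ≤ √(2 * (1 + ν * LamX ^ 2 + LamD ^ 2) / (lamH * ν)) * (l2 βo + l2 γo) := by
  have hH := h.lamH_pos
  have hν := h.nu_pos
  have hX := h.LamX_pos
  have hD := h.LamD_pos
  have h0 := l2_nonneg βo
  have h0' := l2_nonneg γo
  have h1 := h.lamH_mul_distSq_le hP hβo hγo hβs hκ0 ht hγt
  have h2 := h.energy_le_energy hP hs hβo hγo hκ0 le_rfl ht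
    (fun j _ => by rw [hP.gamma_zero]; rfl) hγt
  have h3 : energy A D ν βo γo (β 0) (γ 0)
      ≤ 2 * (1 + ν * LamX ^ 2 + LamD ^ 2) / ν * (l2 βo ^ 2 + l2 γo ^ 2) := by
    rw [hP.beta_zero, hP.gamma_zero, energy]
    have e1 : l2 (A *ᵥ (0 - βo)) ≤ LamX * l2 βo := by
      have e : l2 (0 - βo) = l2 βo := by rw [zero_sub, l2_neg]
      exact e ▸ h.normA (0 - βo)
    have e2 : l2 ((0 : Fin m → ℝ) - γo - D *ᵥ (0 - βo)) ≤ l2 γo + LamD * l2 βo := by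
      have h5 : (0 : Fin m → ℝ) - γo - D *ᵥ (0 - βo) = D *ᵥ βo - γo := by
        rw [zero_sub, zero_sub, Matrix.mulVec_neg]; abel
      rw [h5]
      have := (l2_sub_le (D *ᵥ βo) γo).trans (add_le_add (h.normD βo) le_rfl)
      linarith
    have e3 := pow_le_pow_left₀ (l2_nonneg _) e1 2
    have e4 := pow_le_pow_left₀ (l2_nonneg _) e2 2
    have e5 : (l2 γo + LamD * l2 βo) ^ 2 ≤ 2 * (1 + LamD ^ 2) * (l2 βo ^ 2 + l2 γo ^ 2) := by
      nlinarith [sq_nonneg (l2 γo - LamD * l2 βo), sq_nonneg (l2 βo), sq_nonneg (LamD * l2 γo)]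
    have e6 : (LamX * l2 βo) ^ 2 ≤ 2 * LamX ^ 2 * (l2 βo ^ 2 + l2 γo ^ 2) := by
      nlinarith [sq_nonneg (LamX * l2 βo), sq_nonneg (LamX * l2 γo)]
    calc _ ≤ 2 * LamX ^ 2 * (l2 βo ^ 2 + l2 γo ^ 2)
          + ν⁻¹ * (2 * (1 + LamD ^ 2) * (l2 βo ^ 2 + l2 γo ^ 2)) := by
          gcongr
          · exact e3.trans e6
          · exact e4.trans e5
      _ = _ := by field_simp; ring
  have h4 : l2 βo ^ 2 + l2 γo ^ 2 ≤ (l2 βo + l2 γo) ^ 2 := by nlinarith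
  rw [← Real.sqrt_sq (add_nonneg h0 h0'), ← Real.sqrt_mul (by positivity)]
  apply Real.sqrt_le_sqrt
  have h5 : lamH * distSq βo γo (β t) (γ t)
      ≤ 2 * (1 + ν * LamX ^ 2 + LamD ^ 2) / ν * (l2 βo + l2 γo) ^ 2 :=
    h1.trans (h2.trans (h3.trans (mul_le_mul_of_nonneg_left h4 (by positivity))))
  calc distSq βo γo (β t) (γ t) ≤ 2 * (1 + ν * LamX ^ 2 + LamD ^ 2) / ν * (l2 βo + l2 γo) ^ 2
        / lamH := by rw [le_div_iff₀ hH]; linarith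
    _ = _ := by field_simp

end Paths

/-- What is needed of the noise: `b` is the deviation of the oracle from `β⋆`. -/
structure NoiseBound (A : Matrix (Fin n) (Fin p) ℝ) (D : Matrix (Fin m) (Fin p) ℝ)
    (S : Finset (Fin m)) (ν η lamH lamD LamD σ τ : ℝ) (w : Fin n → ℝ) : Prop where
  norm_le : l2 w ≤ 2 * σ
  rows_le : ∀ j, |(rows D Sᶜ *ᵥ (noiseResp A (rows D Sᶜ) ν *ᵥ w)) j| ≤ ν * (η / (4 * τ))
  mulVec_le : ∀ j, |(D *ᵥ (noiseResp A (rows D Sᶜ) ν *ᵥ w)) j| ≤ η / (4 * τ * lamH)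
  proj_le : ∀ j, |(D *ᵥ (kerProj (rows D Sᶜ) *ᵥ (noiseResp A (rows D Sᶜ) ν *ᵥ w))) j|
    ≤ (1 + LamD / lamD) * (η / (4 * τ * lamH))

section Consistency
variable (h : Regular A D L S ν η lamH lamD LamD LamX i₁)
  (hP : IsPath A D ν κ βs w ρ ρ' β β' γ γ') (hs : ∀ j ∉ S, (D *ᵥ βs) j = 0)
  (hβo : βo = βs + noiseResp A (rows D Sᶜ) ν *ᵥ w) (hγo : γo = mask S (D *ᵥ βo))
  (hβs : βs ∈ L) (hσ : 0 < σ) (hκ : kappaBound lamD LamD LamX lamH i₁ ν σ η (l2 βs) ≤ κ)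
  (hτ : 0 < τ) (hN : NoiseBound A D S ν η lamH lamD LamD σ τ w)
include h hP hs hβo hγo hβs hσ hκ hτ hN

omit hP hτ hβs hs in
lemma kappa_large : 0 < κ ∧ 4 * (1 + √(2 * (1 + ν * LamX ^ 2 + LamD ^ 2) / (lamH * ν)))
    * (l2 βo + l2 γo) ≤ κ ∧ 4 * (1 + (lamD⁻¹ + LamX * lamD⁻¹ * i₁))
    * (1 + √(2 * (1 + ν * LamX ^ 2 + LamD ^ 2) / (lamH * ν))) * (l2 βo + l2 γo) ≤ η * κ := by
  obtain ⟨a, Z, hZ, ha, hadef, hZdef, hk⟩ := h.kappaBound_eq (βs := βs) hσ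
  have hz := h.l2_oracle_le hβo hγo hN.norm_le
  rw [← hZdef] at hz
  rw [hk] at hκ
  rw [← hadef]
  set c := √(2 * (1 + ν * LamX ^ 2 + LamD ^ 2) / (lamH * ν)) with hc
  have hc0 : 0 ≤ c := Real.sqrt_nonneg _
  have hη := h.eta_pos
  have hη1 := h.eta_le
  have h0 : 0 ≤ l2 βo + l2 γo := add_nonneg (l2_nonneg _) (l2_nonneg _)
  have hκpos : 0 < κ := lt_of_lt_of_le (by positivity) hκ
  have h3 : 4 * (1 + a) * (1 + c) * (l2 βo + l2 γo) ≤ η * κ := by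
    calc _ ≤ 4 * (1 + a) * (1 + c) * Z := by gcongr
      _ = η * (4 / η * (1 + a) * (1 + c) * Z) := by field_simp
      _ ≤ η * κ := mul_le_mul_of_nonneg_left hκ hη.le
  refine ⟨hκpos, ?_, h3⟩
  calc 4 * (1 + c) * (l2 βo + l2 γo) ≤ 4 * (1 + a) * (1 + c) * (l2 βo + l2 γo) := by
        have : 0 ≤ 4 * a * (1 + c) * (l2 βo + l2 γo) := by positivity
        linarith
    _ ≤ η * κ := h3
    _ ≤ κ := by nlinarith

-- The continuation argument reduces the claim to `|ρ| < 1` off `S` at a time up to which `γ` has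
-- stayed in `S`; there `ρ` is a response, to which `abs_rows_resp_le` applies.
set_option maxHeartbeats 400000 in
lemma no_false_positives : ∀ t ∈ Icc 0 τ, ∀ j ∉ S, γ t j = 0 := by
  obtain ⟨hκ0, -, hk⟩ := h.kappa_large hβo hγo hσ hκ hN
  have hη := h.eta_pos
  have hη1 := h.eta_le
  have hν := h.nu_pos
  have hX := h.LamX_pos
  have hd := h.lamD_pos
  have hi := h.i₁_nonneg
  apply hP.support_subset
  intro t ht hbefore hγt j hj
  obtain ⟨b, hb, hρ⟩ := hP.exists_resp hs ht.1 hbefore hγt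
  set a := lamD⁻¹ + LamX * lamD⁻¹ * i₁ with ha
  have ha0 : 0 ≤ a := by positivity
  set c := √(2 * (1 + ν * LamX ^ 2 + LamD ^ 2) / (lamH * ν)) with hc
  have hc0 : 0 ≤ c := Real.sqrt_nonneg _
  have hdist := h.distSq_le_condition hP hs hβo hγo hβs hκ0 ht.1 hγt
  rw [← hc] at hdist
  have hdb : l2 (β t - βo) ≤ √(distSq βo γo (β t) (γ t)) :=
    Real.le_sqrt_of_sq_le (le_add_of_nonneg_right (sq_nonneg _))
  have hdg : l2 (γ t - γo) ≤ √(distSq βo γo (β t) (γ t)) :=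
    Real.le_sqrt_of_sq_le (le_add_of_nonneg_left (sq_nonneg _))
  have h0b := l2_nonneg βo
  have h0g := l2_nonneg γo
  set N := (1 + c) * (l2 βo + l2 γo) with hNdef
  have hβN : l2 (β t) ≤ N := by
    have := l2_add_le (β t - βo) βo
    rw [sub_add_cancel] at this
    nlinarith
  have hγN : l2 (γ t) ≤ N := by
    have := l2_add_le (γ t - γo) γo
    rw [sub_add_cancel] at this
    nlinarith
  have hN0 : 0 ≤ N := (l2_nonneg _).trans hβN
  have hv : ∀ i ∈ S, |(ρ t + κ⁻¹ • γ t) i| ≤ 1 + κ⁻¹ * N := by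
    intro i _
    refine (abs_add_le _ _).trans (add_le_add (mem_subdiffL1_iff_coord (hP.subdiff t ht.1) i).1 ?_)
    rw [Pi.smul_apply, smul_eq_mul, abs_mul, abs_of_pos (inv_pos.2 hκ0)]
    exact mul_le_mul_of_nonneg_left ((abs_le_l2 _ i).trans hγN) (inv_pos.2 hκ0).le
  have hu : κ⁻¹ • β t ∈ L := L.smul_mem _ (hP.beta_mem hκ0.ne' h.memA h.memD ht.1)
  have hmain := h.abs_rows_resp_le hu hv ht.1 hb ⟨j, Finset.mem_compl.2 hj⟩
  rw [← ha, l2_smul, abs_of_pos (inv_pos.2 hκ0)] at hmain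
  have hnoise : t * |(rows D Sᶜ *ᵥ (noiseResp A (rows D Sᶜ) ν *ᵥ w)) ⟨j, Finset.mem_compl.2 hj⟩|
      ≤ ν * (η / 4) := by
    calc _ ≤ τ * (ν * (η / (4 * τ))) := by
          refine mul_le_mul ht.2 (hN.rows_le _) (abs_nonneg _) hτ.le
      _ = _ := by field_simp
  have hρj := hρ ⟨j, Finset.mem_compl.2 hj⟩
  simp only at hρj
  rw [hρj, abs_neg, abs_mul, abs_of_pos (inv_pos.2 hν)]
  have hX1 : a * (κ⁻¹ * l2 (β t)) ≤ a * (κ⁻¹ * N) := by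
    have := inv_pos.2 hκ0
    gcongr
  have hk' : κ⁻¹ * N * (1 + a) ≤ η / 4 := by
    rw [mul_assoc, ← div_eq_inv_mul, div_le_iff₀ hκ0]
    have e : 4 * (1 + a) * (1 + c) * (l2 βo + l2 γo) = 4 * (N * (1 + a)) := by
      rw [hNdef]; ring
    linarith
  have hκi := inv_pos.2 hκ0
  set x := a * (κ⁻¹ * l2 (β t)) with hx
  set y := κ⁻¹ * N with hy
  have hy0 : 0 ≤ y := by positivity
  have hx0 : 0 ≤ x := mul_nonneg ha0 (mul_nonneg hκi.le (l2_nonneg _))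
  -- Of the irrepresentability margin `η`, damping uses at most `y + 2x ≤ 2y(1 + a) ≤ η/2` and noise
  -- `η/4`, so `η/4` is left over.
  have h1 : (1 - η) * (1 + y + x) + x ≤ 1 - η + η / 2 := by
    have e1 : (1 - η) * (y + x) ≤ y + x :=
      mul_le_of_le_one_left (add_nonneg hy0 hx0) (by linarith)
    have e2 : (1 - η) * (1 + y + x) = (1 - η) + (1 - η) * (y + x) := by ring
    have e3 : y * (1 + a) = y + a * y := by ring
    linarith
  calc _ ≤ ν⁻¹ * (ν * (1 - η + η / 2) + ν * (η / 4)) := by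
        refine mul_le_mul_of_nonneg_left (hmain.trans (add_le_add ?_ hnoise)) (inv_pos.2 hν).le
        exact mul_le_mul_of_nonneg_left h1 hν.le
    _ = 1 - η / 4 := by field_simp; ring
    _ < 1 := by linarith

/-- Properties of the Lyapunov function up to the time `τ`. -/
lemma lyapunov :
    ContinuousOn (fun t => potential κ βo γo (β t) (γ t) (ρ t)) (Icc 0 τ) ∧
    (∀ x ∈ Ico 0 τ, HasDerivWithinAt (fun t => potential κ βo γo (β t) (γ t) (ρ t))
      (-energy A D ν βo γo (β x) (γ x)) (Ici x) x) ∧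
    (∀ x ∈ Icc 0 τ, 0 ≤ potential κ βo γo (β x) (γ x) (ρ x)) ∧
    (∀ x ∈ Icc 0 τ, potential κ βo γo (β x) (γ x) (ρ x) ^ 2
      ≤ 9 * S.card * distSq βo γo (β x) (γ x)) ∧
    ∀ x ∈ Icc 0 τ, lamH * distSq βo γo (β x) (γ x) ≤ energy A D ν βo γo (β x) (γ x) := by
  obtain ⟨hκ0, hk, -⟩ := h.kappa_large hβo hγo hσ hκ hN
  have hsupp := h.no_false_positives hP hs hβo hγo hβs hσ hκ hτ hN
  have hγo0 : ∀ j ∉ S, γo j = 0 := fun j hj => by rw [hγo, mask_of_notMem _ hj]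
  refine ⟨(hP.potential_continuousOn βo γo).mono Icc_subset_Ici_self, fun x hx => ?_,
    fun x hx => ?_, fun x hx => ?_, fun x hx => ?_⟩
  · refine hP.potential_hasDeriv (h.oracle_gradient hs hβo hγo) hκ0 hx.1
      (dot_oracle_eq_zero hγo fun j hj => ?_)
    rw [Pi.sub_apply, hsupp x ⟨hx.1, hx.2.le⟩ j hj, hγo0 j hj, sub_zero]
  · have := distSq_le_potential (βo := βo) (γo := γo) (b := β x) hκ0 (hP.subdiff x hx.1)
    have h0 := distSq_nonneg βo γo (β x) (γ x)
    by_contra! hneg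
    nlinarith
  · refine potential_sq_le S h.nonempty hκ0 (hP.subdiff x hx.1) hγo0 ?_
    have h1 := h.distSq_le_condition hP hs hβo hγo hβs hκ0 hx.1 (hsupp x hx)
    have h0 : 0 ≤ l2 βo + l2 γo := add_nonneg (l2_nonneg _) (l2_nonneg _)
    have h2 : √(distSq βo γo (β x) (γ x)) ≤ 2 * κ := by nlinarith
    exact (Real.sqrt_le_left (by positivity)).1 h2
  · exact h.lamH_mul_distSq_le hP hβo hγo hβs hκ0 hx.1 (hsupp x hx)

lemma distSq_stopping_le :
    distSq βo γo (β τ) (γ τ) ≤ 36 * S.card / (lamH * τ) ^ 2 := by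
  obtain ⟨hκ0, -, -⟩ := h.kappa_large hβo hγo hσ hκ hN
  have hsupp := h.no_false_positives hP hs hβo hγo hβs hσ hκ hτ hN
  obtain ⟨h1, h2, h3, h4, h5⟩ := h.lyapunov hP hs hβo hγo hβs hσ hκ hτ hN
  have hcard : (1 : ℝ) ≤ S.card := by exact_mod_cast h.nonempty.card_pos
  refine decay_sq_le hτ h.lamH_pos hcard h1 h2 h3 (fun x hx => ?_) h4 h5
  exact h.energy_le_energy hP hs hβo hγo hκ0 hx.1 hx.2 (hsupp x hx) (hsupp τ ⟨hτ.le, le_rfl⟩)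

set_option maxHeartbeats 1000000 in
lemma sign_consistent (hsne : ∀ j ∈ S, (D *ᵥ βs) j ≠ 0)
    (hsig : ∀ j ∈ S, 2 * (LamD / lamD) / (lamH * τ) * (2 * Real.log S.card + 5
      + max 0 (Real.log (8 * LamD))) ≤ |(D *ᵥ βs) j|) (j : Fin m) :
    SignType.sign ((D *ᵥ revised D (β τ) (γ τ)) j) = SignType.sign ((D *ᵥ βs) j) := by
  have hcard : (1 : ℝ) ≤ S.card := by exact_mod_cast h.nonempty.card_pos
  obtain ⟨hκ0, hk, -⟩ := h.kappa_large hβo hγo hσ hκ hN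
  have hsupp := h.no_false_positives hP hs hβo hγo hβs hσ hκ hτ hN
  obtain ⟨h1, h2, h3, h4, h5⟩ := h.lyapunov hP hs hβo hγo hβs hσ hκ hτ hN
  have hH := h.lamH_pos
  have hD := h.LamD_pos
  have hd := h.lamD_pos
  obtain ⟨j₀, hj₀⟩ := h.nonempty
  have hr : 1 ≤ LamD / lamD := by
    rw [one_le_div hd]
    exact h.lamD_le_LamD fun h0 => hsne j₀ hj₀ (congrFun h0 j₀)
  set r := LamD / lamD with hrdef
  set u := 1 / (lamH * τ) with hu
  have hu0 : 0 < u := by positivity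
  have hls : 0 ≤ Real.log S.card := Real.log_nonneg hcard
  set lp := max 0 (Real.log (8 * LamD)) with hlp
  have hlp0 : 0 ≤ lp := le_max_left _ _
  set Γ := 2 * r / (lamH * τ) * (2 * Real.log S.card + 5 + lp) with hΓ
  have hΓu : Γ = 2 * r * u * (2 * Real.log S.card + 5 + lp) := by rw [hΓ, hu]; ring
  have hru : u ≤ r * u := le_mul_of_one_le_left hu0.le hr
  have hΓ1 : u * (4 * Real.log S.card + 10 + 2 * lp) ≤ Γ := by
    rw [hΓu]; nlinarith [mul_le_mul_of_nonneg_right hru (by positivity :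
      0 ≤ 2 * Real.log S.card + 5 + lp)]
  have hΓ2 : 10 * (r * u) ≤ Γ := by rw [hΓu]; nlinarith [mul_pos (hu0.trans_le hru) hu0]
  have hη1 := h.eta_le
  have hηu : η / (4 * τ * lamH) ≤ u / 4 := by
    rw [hu, div_le_iff₀ (by positivity)]
    have : 1 / (lamH * τ) / 4 * (4 * τ * lamH) = 1 := by field_simp
    rw [this]; exact hη1
  -- The noise shifts `D β⋆` by at most `u/4` in each coordinate, so `G` still bounds the oracle
  -- signal on `S` from below.
  set G := Γ - u / 4 with hG
  have hulog : 0 ≤ u * Real.log S.card := by positivity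
  have hulp : 0 ≤ u * lp := by positivity
  have hG0 : 0 < G := by nlinarith
  have hDo : ∀ i ∈ S, γo i = (D *ᵥ βs) i + (D *ᵥ (noiseResp A (rows D Sᶜ) ν *ᵥ w)) i := by
    intro i hi
    rw [hγo, mask_of_mem _ hi, hβo, Matrix.mulVec_add, Pi.add_apply]
  have hγoG : ∀ i ∈ S, G ≤ |γo i| := by
    intro i hi
    have e1 := hsig i hi
    have e2 := (hN.mulVec_le i).trans hηu
    have e3 := abs_sub_abs_le_abs_sub ((D *ᵥ βs) i)
      (-(D *ᵥ (noiseResp A (rows D Sᶜ) ν *ᵥ w)) i)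
    rw [sub_neg_eq_add, abs_neg] at e3
    rw [hDo i hi]; linarith
  have hγo' : ∀ i, γo i ≠ 0 → G ≤ |γo i| := by
    intro i hi
    by_cases hiS : i ∈ S
    · exact hγoG i hiS
    · exact absurd (by rw [hγo, mask_of_notMem _ hiS]) hi
  have hGκ : 4 * G ≤ κ := by
    have e1 := (hγoG j₀ hj₀).trans (abs_le_l2 γo j₀)
    have e2 := l2_nonneg βo
    have e3 := Real.sqrt_nonneg (2 * (1 + ν * LamX ^ 2 + LamD ^ 2) / (lamH * ν))
    nlinarith [mul_nonneg e3 (add_nonneg e2 (l2_nonneg γo))]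
  -- The factor `2` keeps every oracle coordinate on `S` nonzero in `γ τ`; the factor `8Λ_D` makes
  -- the error `G/8` after multiplication by `D`.
  set R := max 2 (8 * LamD) with hR
  have hR2 : 2 ≤ R := le_max_left _ _
  have hR8 : 8 * LamD ≤ R := le_max_right _ _
  have hlogR : Real.log R ≤ 1 + lp := by
    rcases le_total 2 (8 * LamD) with hle | hle
    · rw [hR, max_eq_right hle]
      linarith [le_max_right 0 (Real.log (8 * LamD))]
    · rw [hR, max_eq_left hle]
      linarith [Real.log_two_lt_d9]
  have htime : (6 + 3 * Real.log S.card) / G + Real.log R / κ ≤ lamH * τ := by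
    have e1 : Real.log R / κ ≤ (1 + lp) / 4 / G := by
      rw [div_div]
      exact div_le_div₀ (by positivity) hlogR (by positivity) hGκ
    have e2 : (6 + 3 * Real.log S.card) / G + (1 + lp) / 4 / G ≤ lamH * τ := by
      rw [← add_div, div_le_iff₀ hG0]
      have e3 : lamH * τ * u = 1 := by rw [hu]; field_simp
      have e4 : (6 + 3 * Real.log S.card + (1 + lp) / 4) * u ≤ G := by nlinarith
      have e5 := mul_le_mul_of_nonneg_left e4 (mul_pos hH hτ).le
      have e6 : lamH * τ * ((6 + 3 * Real.log S.card + (1 + lp) / 4) * u)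
          = 6 + 3 * Real.log S.card + (1 + lp) / 4 := by
        rw [mul_comm _ u, ← mul_assoc, e3, one_mul]
      linarith
    linarith
  have hfin := decay_below_threshold hH hcard hG0 hκ0 (by linarith : 1 ≤ R) htime h1 h2 h3 h4 h5
    (fun x hx => potential_mul_le (by linarith) hκ0 (hP.subdiff x hx.1) hγo')
    (fun x _ => distSq_nonneg _ _ _ _)
    (fun x hx => distSq_le_potential hκ0 (hP.subdiff x hx.1))
    (fun x hx hlt => potential_eq_of_lt hκ0 hG0 (hP.subdiff x hx.1) hγo' hlt)
  have hGR : G / R ≤ G / 2 := div_le_div_of_nonneg_left hG0.le (by norm_num) hR2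
  have hGR0 : 0 ≤ G / R := by positivity
  have hdγ : l2 (γ τ - γo) ≤ G / R :=
    l2_le_of_sq_le_sq hGR0 ((le_add_of_nonneg_left (sq_nonneg _)).trans hfin)
  have hdβ : l2 (β τ - βo) ≤ G / R :=
    l2_le_of_sq_le_sq hGR0 ((le_add_of_nonneg_right (sq_nonneg _)).trans hfin)
  have hsuppeq : supp (γ τ) = S := by
    ext i
    rw [mem_supp]
    refine ⟨fun hi => ?_, fun hi h0 => ?_⟩
    · by_contra hiS
      exact hi (hsupp τ ⟨hτ.le, le_rfl⟩ i hiS)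
    · have e1 := (abs_le_l2 (γ τ - γo) i).trans hdγ
      rw [Pi.sub_apply, h0, zero_sub, abs_neg] at e1
      linarith [hγoG i hi]
  rw [revised, hsuppeq]
  have hBs : rows D Sᶜ *ᵥ βs = 0 := by
    funext i; exact hs _ (Finset.mem_compl.1 i.2)
  by_cases hj : j ∈ S
  · apply sign_eq_of_abs_sub_lt
    refine lt_of_lt_of_le ?_ (hsig j hj)
    set b := noiseResp A (rows D Sᶜ) ν *ᵥ w with hb
    have e1 : (D *ᵥ (kerProj (rows D Sᶜ) *ᵥ β τ)) j - (D *ᵥ βs) j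
        = (D *ᵥ (kerProj (rows D Sᶜ) *ᵥ (β τ - βo))) j
          + (D *ᵥ (kerProj (rows D Sᶜ) *ᵥ b)) j := by
      have e2 : β τ - βo = β τ - βs - b := by rw [hβo]; abel
      rw [e2]
      simp only [Matrix.mulVec_sub, Pi.sub_apply, kerProj_mulVec_of_ker _ hBs]
      ring
    have e3 : |(D *ᵥ (kerProj (rows D Sᶜ) *ᵥ (β τ - βo))) j| ≤ G / 8 := by
      calc _ ≤ l2 (D *ᵥ (kerProj (rows D Sᶜ) *ᵥ (β τ - βo))) := abs_le_l2 _ _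
        _ ≤ LamD * l2 (kerProj (rows D Sᶜ) *ᵥ (β τ - βo)) := h.normD _
        _ ≤ LamD * (G / R) := by
            gcongr
            exact (l2_kerProj_le _ _).trans hdβ
        _ ≤ G / 8 := by
            rw [← mul_div_assoc, div_le_iff₀ (by linarith)]
            have := mul_le_mul_of_nonneg_left hR8 hG0.le
            linarith
    have e4 : |(D *ᵥ (kerProj (rows D Sᶜ) *ᵥ b)) j| ≤ (1 + r) * (u / 4) :=
      (hN.proj_le j).trans (mul_le_mul_of_nonneg_left hηu (by positivity))
    rw [e1]
    refine lt_of_le_of_lt ((abs_add_le _ _).trans (add_le_add e3 e4)) ?_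
    have e5 : (1 + r) * (u / 4) = u / 4 + r * u / 4 := by ring
    linarith
  · have e0 : (D *ᵥ (kerProj (rows D Sᶜ) *ᵥ β τ)) j = 0 :=
      congrFun (mulVec_kerProj (rows D Sᶜ) (β τ)) ⟨j, Finset.mem_compl.2 hj⟩
    rw [e0, hs j hj]

/-- With `P` the projection onto `ker D_T`, `T = (supp γ)ᶜ`, the error is `P(β - βo) + P b -
mismatch`. The first term is the distance to the oracle, and the last is zero once all of `S` is
selected. -/
lemma l2_consistent {E : ℝ}
    (hE : l2 (kerProj D *ᵥ (noiseResp A (rows D Sᶜ) ν *ᵥ w)) ≤ E)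
    (hsne : ∀ j ∈ S, (D *ᵥ βs) j ≠ 0) :
    l2 (revised D (β τ) (γ τ) - βs) ≤ 10 * √S.card / (lamH * τ) * (1 + LamD / lamD ^ 2) + E
        + 2 * l2 (mismatch D βs (γ τ)) ∧
    (S ⊆ supp (γ τ) → l2 (revised D (β τ) (γ τ) - βs)
      ≤ 10 * √S.card / (lamH * τ) * (1 + LamD / lamD ^ 2) + E) := by
  have hH := h.lamH_pos
  have hD := h.LamD_pos
  have hd := h.lamD_pos
  have hη1 := h.eta_le
  have hη := h.eta_pos
  have hsupp := h.no_false_positives hP hs hβo hγo hβs hσ hκ hτ hN τ ⟨hτ.le, le_rfl⟩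
  have hdist := h.distSq_stopping_le hP hs hβo hγo hβs hσ hκ hτ hN
  obtain ⟨j₀, hj₀⟩ := h.nonempty
  have hr : 1 ≤ LamD / lamD := by
    rw [one_le_div hd]
    exact h.lamD_le_LamD fun h0 => hsne j₀ hj₀ (congrFun h0 j₀)
  set b := noiseResp A (rows D Sᶜ) ν *ᵥ w with hb
  set T := (supp (γ τ))ᶜ with hT
  have hmis : mismatch D βs (γ τ) = pinv (rows D T) *ᵥ (rows D T *ᵥ βs) := by
    unfold mismatch
    congr 1
    funext j
    rw [rows_mulVec]
    by_cases h0 : (D *ᵥ βs) j.1 = 0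
    · simp [h0]
    · rw [if_pos (mem_supp.2 h0)]
  have hrev : revised D (β τ) (γ τ) - βs
      = kerProj (rows D T) *ᵥ (β τ - βo) + kerProj (rows D T) *ᵥ b - mismatch D βs (γ τ) := by
    have e1 : kerProj (rows D T) *ᵥ βs = βs - mismatch D βs (γ τ) := by
      rw [hmis, kerProj, Matrix.sub_mulVec, Matrix.one_mulVec, Matrix.mulVec_mulVec]
    have e2 : β τ - βo = β τ - βs - b := by rw [hβo]; abel
    rw [e2, revised, ← hT]
    simp only [Matrix.mulVec_sub, e1]
    abel
  have hδ : l2 (kerProj (rows D T) *ᵥ (β τ - βo)) ≤ 6 * √S.card / (lamH * τ) := by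
    refine (l2_kerProj_le _ _).trans ?_
    apply l2_le_of_sq_le_sq (by positivity)
    refine ((le_add_of_nonneg_right (sq_nonneg _)).trans hdist).trans_eq ?_
    have e : (6 * √(S.card : ℝ)) ^ 2 = 36 * S.card := by
      rw [mul_pow, Real.sq_sqrt (Nat.cast_nonneg _)]; norm_num
    rw [div_pow, e]
  have hkerT : ∀ x, rows D T *ᵥ x = 0 → rows D Sᶜ *ᵥ x = 0 := by
    intro x hx
    funext j
    have hjT : j.1 ∈ T := by
      rw [hT, Finset.mem_compl, mem_supp, not_not]
      exact hsupp j.1 (Finset.mem_compl.1 j.2)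
    exact congrFun hx ⟨j.1, hjT⟩
  -- Since `T ⊇ Sᶜ`, projecting first onto `ker D_{Sᶜ}` does not change the result. The random
  -- support `T` is thereby replaced by the fixed `S`, for which the noise bounds hold.
  have hPb : l2 (kerProj (rows D T) *ᵥ b) ≤ √S.card / (lamH * τ) * (LamD / lamD ^ 2) + E := by
    rw [← kerProj_mul_of_ker_le hkerT]
    refine (l2_kerProj_le _ _).trans ((h.l2_resp_le _).trans ?_)
    rw [kerProj_mul_of_ker_le (Q₁ := D) (fun x hx => rows_mulVec_eq_zero hx)]
    refine add_le_add ?_ hE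
    have e1 : l2 (D *ᵥ (kerProj (rows D Sᶜ) *ᵥ b))
        ≤ √S.card * ((1 + LamD / lamD) * (η / (4 * τ * lamH))) := by
      -- After the projection, `D b` is supported in `S`, so the coordinatewise bound costs `√s` and
      -- not `√m`.
      refine l2_le_sqrt_card_mul (by positivity) (fun j hj => ?_) hN.proj_le
      exact congrFun (mulVec_kerProj (rows D Sᶜ) b) ⟨j, Finset.mem_compl.2 hj⟩
    have e2 : (1 + LamD / lamD) * (η / (4 * τ * lamH)) ≤ (LamD / lamD) * (1 / (lamH * τ)) := by
      have e3 : η / (4 * τ * lamH) ≤ 1 / (lamH * τ) / 4 := by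
        rw [div_div, div_le_div_iff₀ (by positivity) (by positivity)]
        nlinarith [mul_pos hH hτ]
      have e4 : 0 < 1 / (lamH * τ) := by positivity
      have e5 : 0 ≤ η / (4 * τ * lamH) := by positivity
      nlinarith
    calc _ ≤ lamD⁻¹ * (√S.card * ((LamD / lamD) * (1 / (lamH * τ)))) := by
          gcongr
          exact e1.trans (by gcongr)
      _ = _ := by field_simp
  have hmain : l2 (revised D (β τ) (γ τ) - βs)
      ≤ 10 * √S.card / (lamH * τ) * (1 + LamD / lamD ^ 2) + E + l2 (mismatch D βs (γ τ)) := by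
    rw [hrev]
    refine (l2_sub_le _ _).trans (add_le_add ((l2_add_le _ _).trans ?_) le_rfl)
    have e1 : 0 ≤ √S.card / (lamH * τ) := by positivity
    have e2 : 0 ≤ √S.card / (lamH * τ) * (LamD / lamD ^ 2) := by positivity
    have e3 : 10 * √S.card / (lamH * τ) * (1 + LamD / lamD ^ 2)
        = 10 * (√S.card / (lamH * τ)) + 10 * (√S.card / (lamH * τ) * (LamD / lamD ^ 2)) := by ring
    have e4 : 6 * √S.card / (lamH * τ) = 6 * (√S.card / (lamH * τ)) := by ring
    linarith
  refine ⟨by linarith [l2_nonneg (mismatch D βs (γ τ))], fun hsub => ?_⟩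
  have h0 : rows D T *ᵥ βs = 0 := by
    funext j
    have hj : j.1 ∉ supp (γ τ) := Finset.mem_compl.1 j.2
    exact hs j.1 fun hjS => hj (hsub hjS)
  rw [hmis, h0, Matrix.mulVec_zero, l2_zero, add_zero] at hmain
  exact hmain

end Consistency
end Regular

/-! ### From the assumptions of the theorem to regular designs and paths -/

section Translation
variable {n m p : ℕ} (X : Matrix (Fin n) (Fin p) ℝ) (D : Matrix (Fin m) (Fin p) ℝ)

/-- The scaled design matrix `X / √n`. -/
def scaled : Matrix (Fin n) (Fin p) ℝ := (√(n : ℝ))⁻¹ • X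

lemma inv_sqrt_mul_inv_sqrt (n : ℕ) : (√(n : ℝ))⁻¹ * (√(n : ℝ))⁻¹ = (n : ℝ)⁻¹ := by
  rw [← mul_inv, Real.mul_self_sqrt (Nat.cast_nonneg _)]

lemma scaledTranspose_mulVec (y : Fin n → ℝ) :
    scaledTranspose X *ᵥ y = (scaled X)ᵀ *ᵥ ((√(n : ℝ))⁻¹ • y) := by
  rw [scaledTranspose, scaled, Matrix.transpose_smul, Matrix.smul_mulVec, Matrix.smul_mulVec,
    Matrix.mulVec_smul, smul_smul, inv_sqrt_mul_inv_sqrt]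

lemma scaledTranspose_mul : scaledTranspose X * X = (scaled X)ᵀ * scaled X := by
  rw [scaledTranspose, scaled, Matrix.transpose_smul, Matrix.smul_mul, Matrix.smul_mul,
    Matrix.mul_smul, smul_smul, inv_sqrt_mul_inv_sqrt]

lemma scaled_transpose_mem_ambient (y : Fin n → ℝ) : (scaled X)ᵀ *ᵥ y ∈ ambient X D := by
  refine Submodule.mem_sup_left ⟨(√(n : ℝ))⁻¹ • y, ?_⟩
  rw [Matrix.mulVecLin_apply, scaled, Matrix.transpose_smul, Matrix.smul_mulVec,
    Matrix.mulVec_smul]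

lemma transpose_mem_ambient (y : Fin m → ℝ) : Dᵀ *ᵥ y ∈ ambient X D :=
  Submodule.mem_sup_right ⟨y, rfl⟩

lemma l2_scaled_mulVec_le {c : ℝ} (hc : 0 ≤ c) (h : maxSing (scaledTranspose X * X) ≤ c ^ 2)
    (x : Fin p → ℝ) : l2 (scaled X *ᵥ x) ≤ c * l2 x := by
  apply l2_le_of_sq_le_sq (mul_nonneg hc (l2_nonneg _))
  have h1 := l2_mulVec_le_maxSing (scaledTranspose X * X) x
  have h2 : l2 (scaled X *ᵥ x) ^ 2 = ((scaledTranspose X * X) *ᵥ x) ⬝ᵥ x := by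
    rw [l2_sq, scaledTranspose_mul, ← Matrix.mulVec_mulVec, transpose_mulVec_dot]
  have h3 := l2_nonneg x
  calc _ ≤ l2 ((scaledTranspose X * X) *ᵥ x) * l2 x := h2 ▸ dot_le_l2 _ _
    _ ≤ c ^ 2 * l2 x * l2 x := by gcongr; exact h1.trans (by gcongr)
    _ = _ := by ring

lemma hessOracle_eq (ν : ℝ) (S : Finset (Fin m)) : hessOracle X D ν S
    = Matrix.fromBlocks ((scaled X)ᵀ * scaled X + ν⁻¹ • (Dᵀ * D)) (-(ν⁻¹ • (rows D S)ᵀ))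
      (-(ν⁻¹ • rows D S)) (ν⁻¹ • 1) := by
  rw [← scaledTranspose_mul]
  ext i j
  rcases i with i | i <;> rcases j with j | j
  · simp [hessOracle, hess]
  · simp [hessOracle, hess, rows]
  · simp [hessOracle, hess, rows]
  · rcases eq_or_ne i j with rfl | hij
    · simp [hessOracle, hess]
    · simp [hessOracle, hess, hij, Subtype.coe_injective.ne hij]

lemma hessOracle_mulVec (ν : ℝ) (S : Finset (Fin m)) (b : Fin p → ℝ) (g : S → ℝ) :
    hessOracle X D ν S *ᵥ Sum.elim b g
      = Sum.elim ((scaled X)ᵀ *ᵥ (scaled X *ᵥ b) + ν⁻¹ • (Dᵀ *ᵥ (D *ᵥ b))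
        - ν⁻¹ • ((rows D S)ᵀ *ᵥ g)) (ν⁻¹ • (g - rows D S *ᵥ b)) := by
  rw [hessOracle_eq, Matrix.fromBlocks_mulVec]
  simp only [Sum.elim_comp_inl, Sum.elim_comp_inr, Matrix.add_mulVec, Matrix.smul_mulVec,
    Matrix.neg_mulVec, Matrix.one_mulVec, ← Matrix.mulVec_mulVec]
  rw [smul_sub, neg_add_eq_sub, ← sub_eq_add_neg]

lemma hessOracle_symm (ν : ℝ) (S : Finset (Fin m)) :
    (hessOracle X D ν S)ᵀ = hessOracle X D ν S := by
  rw [hessOracle_eq, Matrix.fromBlocks_transpose]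
  simp

lemma hessCross_mulVec (ν : ℝ) (S : Finset (Fin m)) (b : Fin p → ℝ) (g : S → ℝ) :
    hessCross X D ν S *ᵥ Sum.elim b g = -(ν⁻¹ • (rows D Sᶜ *ᵥ b)) := by
  have h : hessCross X D ν S = Matrix.fromCols (-(ν⁻¹ • rows D Sᶜ)) 0 := by
    ext i j
    rcases j with j | j
    · simp [hessCross, hess, rows]
    · have hij : i.1 ≠ j.1 := fun e => Finset.mem_compl.1 i.2 (e ▸ j.2)
      simp [hessCross, hess, hij]
  rw [h, Matrix.fromCols_mulVec]
  simp [Matrix.neg_mulVec, Matrix.smul_mulVec]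

variable {D} in
lemma rows_transpose_mulVec_mask (S : Finset (Fin m)) (v : Fin m → ℝ) :
    (rows D S)ᵀ *ᵥ (fun j : S => v j.1) = Dᵀ *ᵥ mask S v := by
  funext i
  simp only [Matrix.mulVec, dotProduct, Matrix.transpose_apply]
  have h : ∑ j : S, rows D S j i * v j.1 = ∑ j ∈ S, D j i * v j :=
    Finset.sum_coe_sort S (fun j => D j i * v j)
  rw [h, ← Finset.sum_subset (Finset.subset_univ S)]
  · exact Finset.sum_congr rfl fun j hj => by rw [mask_of_mem v hj]
  · intro j _ hj
    rw [mask_of_notMem v hj, mul_zero]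

lemma dot_of_support {S : Finset (Fin m)} {g : Fin m → ℝ} (hg : ∀ j ∉ S, g j = 0)
    (v : Fin m → ℝ) : g ⬝ᵥ v = (fun j : S => g j.1) ⬝ᵥ (fun j : S => v j.1) := by
  have h : ∑ j : S, g j.1 * v j.1 = ∑ j ∈ S, g j * v j := Finset.sum_coe_sort S fun j => g j * v j
  simp only [dotProduct]
  rw [h]
  exact (Finset.sum_subset (Finset.subset_univ S) fun j _ hj => by rw [hg j hj, zero_mul]).symm

lemma l2_sq_sumElim {α β : Type*} [Fintype α] [Fintype β] (b : α → ℝ) (g : β → ℝ) :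
    l2 (Sum.elim b g) ^ 2 = l2 b ^ 2 + l2 g ^ 2 := by
  simp [l2_sq_eq_sum]

lemma RSCLoss.strong_convexity {X : Matrix (Fin n) (Fin p) ℝ} {D : Matrix (Fin m) (Fin p) ℝ}
    {ν lamH : ℝ} {S : Finset (Fin m)} (h : RSCLoss X D ν S lamH) {b : Fin p → ℝ}
    (hb : b ∈ ambient X D) {g : Fin m → ℝ} (hg : ∀ j ∉ S, g j = 0) :
    lamH * (l2 b ^ 2 + l2 g ^ 2) ≤ l2 (scaled X *ᵥ b) ^ 2 + ν⁻¹ * l2 (g - D *ᵥ b) ^ 2 := by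
  have h1 := h b hb (fun j => g j.1)
  rw [hessOracle_mulVec, l2_sq_sumElim, l2_sq (fun j : S => g j.1), ← dot_of_support hg, ← l2_sq,
    sumElim_dotProduct_sumElim, rows_transpose_mulVec_mask] at h1
  refine h1.trans_eq ?_
  have h2 : mask S g = g := by
    funext j
    by_cases hj : j ∈ S
    · rw [mask_of_mem _ hj]
    · rw [mask_of_notMem _ hj, hg j hj]
  have h3 : (fun j : S => g j.1) ⬝ᵥ (rows D S *ᵥ b) = g ⬝ᵥ (D *ᵥ b) :=
    (dot_of_support hg (D *ᵥ b)).symm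
  have h4 : (fun j : S => g j.1) ⬝ᵥ (fun j : S => g j.1) = g ⬝ᵥ g := (dot_of_support hg _).symm
  rw [h2]
  simp only [l2_sq, dotProduct_add, dotProduct_sub, dotProduct_smul, dot_transpose_mulVec,
    sub_dotProduct, smul_eq_mul, h3, h4, dotProduct_comm (D *ᵥ b) g]
  ring

/-- The residual `e` lies in `ker H`. Its `β`-part splits into a vector of `ℒ` and one killed by `X`
and `D`; strong convexity on the former forces the `γ`-part of `e` to vanish. Thus `e` is orthogonal
to `(0, r)` as well as to the range of `H`, and so to itself. -/
lemma RSCLoss.hessOracle_mulVec_pinv {X : Matrix (Fin n) (Fin p) ℝ}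
    {D : Matrix (Fin m) (Fin p) ℝ} {ν lamH : ℝ} {S : Finset (Fin m)} (h : RSCLoss X D ν S lamH)
    (hν : 0 < ν) (hH : 0 < lamH) (r : S → ℝ) :
    hessOracle X D ν S *ᵥ (pinv (hessOracle X D ν S) *ᵥ Sum.elim (0 : Fin p → ℝ) r)
      = Sum.elim (0 : Fin p → ℝ) r := by
  set H := hessOracle X D ν S with hHdef
  set y : Fin p ⊕ S → ℝ := Sum.elim 0 r with hy
  set e := y - H *ᵥ (pinv H *ᵥ y) with he
  have hHe : H *ᵥ e = 0 := by
    have h1 : Hᵀ *ᵥ (H *ᵥ (pinv H *ᵥ y)) = Hᵀ *ᵥ y := by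
      rw [Matrix.mulVec_mulVec, Matrix.mulVec_mulVec, Matrix.mul_assoc, transpose_mul_pinv]
    rw [hessOracle_symm] at h1
    rw [he, Matrix.mulVec_sub, h1, sub_self]
  set Z := stacked (scaled X) D ν with hZ
  set k := kerProj Z *ᵥ (e ∘ Sum.inl) with hk
  set a := pinv Z *ᵥ (Z *ᵥ (e ∘ Sum.inl)) with ha
  have hka : e ∘ Sum.inl = a + k := by
    rw [hk, ha, kerProj, Matrix.sub_mulVec, Matrix.one_mulVec, Matrix.mulVec_mulVec]; abel
  have haL : a ∈ ambient X D := by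
    obtain ⟨y', x', hyx⟩ := exists_pinv_stacked (scaled X) D (ν := ν) (Z *ᵥ (e ∘ Sum.inl))
    rw [ha, hyx]
    exact Submodule.add_mem _ (scaled_transpose_mem_ambient X D _) (transpose_mem_ambient X D _)
  have hkZ : Z *ᵥ k = 0 := mulVec_kerProj Z _
  rw [hZ, stacked, Matrix.fromRows_mulVec] at hkZ
  have hkA : scaled X *ᵥ k = 0 := by
    funext i; exact congrFun hkZ (Sum.inl i)
  have hkD : D *ᵥ k = 0 := by
    have h1 : ((√ν)⁻¹ • D) *ᵥ k = 0 := by funext i; exact congrFun hkZ (Sum.inr i)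
    rw [Matrix.smul_mulVec] at h1
    exact (smul_eq_zero.1 h1).resolve_left (inv_pos.2 (Real.sqrt_pos.2 hν)).ne'
  have hHk : H *ᵥ Sum.elim k (0 : S → ℝ) = 0 := by
    have hkS : rows D S *ᵥ k = 0 := by funext j; exact congrFun hkD j.1
    rw [hHdef, hessOracle_mulVec, hkA, hkD, hkS]
    simp
  have hsplit : e = Sum.elim a (e ∘ Sum.inr) + Sum.elim k (0 : S → ℝ) := by
    funext i
    rcases i with i | i
    · exact congrFun hka i
    · simp
  have hHa : H *ᵥ Sum.elim a (e ∘ Sum.inr) = 0 := by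
    have h1 := hHe
    rwa [hsplit, Matrix.mulVec_add, hHk, add_zero] at h1
  have he2 : e ∘ Sum.inr = 0 := by
    have h1 := h a haL (e ∘ Sum.inr)
    rw [← hHdef, hHa, dotProduct_zero, l2_sq_sumElim] at h1
    have h2 : l2 (e ∘ Sum.inr) ^ 2 = 0 := by
      have h3 := sq_nonneg (l2 a)
      have h4 := sq_nonneg (l2 (e ∘ Sum.inr))
      nlinarith
    exact l2_eq_zero (pow_eq_zero_iff two_ne_zero |>.1 h2)
  have he0 : l2 e ^ 2 = 0 := by
    have h1 : e ⬝ᵥ (H *ᵥ (pinv H *ᵥ y)) = 0 := by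
      rw [← hessOracle_symm X D ν S] at hHdef
      rw [hHdef, dot_transpose_mulVec, hHe, zero_dotProduct]
    have h2 : e ⬝ᵥ y = 0 := by
      rw [← Sum.elim_comp_inl_inr e, he2, hy, sumElim_dotProduct_sumElim]
      simp
    rw [l2_sq]
    conv_lhs => enter [2]; rw [he]
    rw [dotProduct_sub, h1, h2, sub_zero]
  have := l2_eq_zero (pow_eq_zero_iff two_ne_zero |>.1 he0)
  exact (sub_eq_zero.1 this).symm

/-- Writing `H†(0, r) = (b, g)`, the second block gives `g = D_S b + ν r`. Eliminating `g` from the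
first block cancels the rows of `S` and leaves the normal equation with `B` alone. -/
lemma IRR.exists_resp {X : Matrix (Fin n) (Fin p) ℝ} {D : Matrix (Fin m) (Fin p) ℝ}
    {ν lamH η : ℝ} {S : Finset (Fin m)} (h : IRR X D ν S η) (hR : RSCLoss X D ν S lamH)
    (hν : 0 < ν) (hH : 0 < lamH) (hS : S.Nonempty) {v : Fin m → ℝ} {M : ℝ}
    (hv : ∀ j ∈ S, |v j| ≤ M) :
    ∃ b, Resp (scaled X) (rows D Sᶜ) ν b (Dᵀ *ᵥ mask S v) ∧
      ∀ j, |(rows D Sᶜ *ᵥ b) j| ≤ ν * ((1 - η) * M) := by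
  obtain ⟨j₀, hj₀⟩ := hS
  have hM : 0 ≤ M := (abs_nonneg _).trans (hv j₀ hj₀)
  -- If `M = 0`, division by zero gives `r = 0`, consistent with `v = 0` on `S`.
  set r : S → ℝ := fun j => v j.1 / M with hr
  have hrv : (fun j : S => v j.1) = M • r := by
    funext j
    rcases hM.eq_or_lt with h0 | h0
    · have := hv j.1 j.2
      rw [← h0] at this
      simp [← h0, abs_nonpos_iff.1 this]
    · simp only [hr, Pi.smul_apply, smul_eq_mul]; field_simp
  have hr1 : ∀ j, r j ∈ Set.Icc (-1 : ℝ) 1 := by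
    intro j
    rw [Set.mem_Icc, ← abs_le, hr, abs_div, abs_of_nonneg hM]
    exact div_le_one_of_le₀ (hv j.1 j.2) hM
  set z := pinv (hessOracle X D ν S) *ᵥ Sum.elim (0 : Fin p → ℝ) r with hz
  have hHz := hR.hessOracle_mulVec_pinv hν hH r
  have hcross := h r hr1
  rw [← hz] at hHz
  rw [← Matrix.mulVec_mulVec, ← hz] at hcross
  set b := z ∘ Sum.inl with hb
  set g := z ∘ Sum.inr with hg
  have hzbg : z = Sum.elim b g := (Sum.elim_comp_inl_inr z).symm
  rw [hzbg, hessOracle_mulVec] at hHz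
  rw [hzbg, hessCross_mulVec, norm_neg] at hcross
  have h1 : (scaled X)ᵀ *ᵥ (scaled X *ᵥ b) + ν⁻¹ • (Dᵀ *ᵥ (D *ᵥ b))
      - ν⁻¹ • ((rows D S)ᵀ *ᵥ g) = 0 := by funext i; exact congrFun hHz (Sum.inl i)
  have h2 : ν⁻¹ • (g - rows D S *ᵥ b) = r := by funext i; exact congrFun hHz (Sum.inr i)
  have h3 : Resp (scaled X) (rows D Sᶜ) ν b ((rows D S)ᵀ *ᵥ r) := by
    have h4 : Dᵀ *ᵥ (D *ᵥ b)
        = (rows D Sᶜ)ᵀ *ᵥ (rows D Sᶜ *ᵥ b) + (rows D S)ᵀ *ᵥ (rows D S *ᵥ b) := by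
      rw [transpose_mulVec_split D S, ← rows_transpose_mulVec_mask]; rfl
    unfold Resp
    rw [← h2, Matrix.mulVec_smul, Matrix.mulVec_sub, smul_sub, ← sub_eq_zero, ← h1, h4, smul_add]
    abel
  refine ⟨M • b, ?_, fun j => ?_⟩
  · rw [← rows_transpose_mulVec_mask, hrv, Matrix.mulVec_smul]
    exact h3.smul M
  · have h5 := (norm_le_pi_norm (ν⁻¹ • (rows D Sᶜ *ᵥ b)) j).trans hcross
    rw [Pi.smul_apply, smul_eq_mul, Real.norm_eq_abs, abs_mul, abs_of_pos (inv_pos.2 hν),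
      inv_mul_le_iff₀ hν] at h5
    rw [Matrix.mulVec_smul, Pi.smul_apply, smul_eq_mul, abs_mul, abs_of_nonneg hM]
    calc _ ≤ M * (ν * (1 - η)) := mul_le_mul_of_nonneg_left h5 hM
      _ = _ := by ring

variable {X D} in
theorem regular_of_assumptions {S : Finset (Fin m)} (hS : S.Nonempty) {lamD LamD LamX : ℝ}
    (hlamD : 0 < lamD) (hLamD : 0 < LamD) (hLamX : 0 < LamX)
    (hminD : ENNReal.ofReal lamD ≤ min (minPosSing D) (minPosSing (rows D Sᶜ)))
    (hmaxD : maxSing D ≤ LamD) (hmaxX : maxSing (scaledTranspose X * X) ≤ LamX ^ 2)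
    {ν lamH η : ℝ} (hν : 0 < ν) (hlamH : 0 < lamH) (hR : RSCLoss X D ν S lamH)
    (hη : η ∈ Set.Ioc (0 : ℝ) 1) (hI : IRR X D ν S η) :
    Regular (scaled X) D (ambient X D) S ν η lamH lamD LamD LamX (invLamOne X D) where
  nonempty := hS
  nu_pos := hν
  eta_pos := hη.1
  eta_le := hη.2
  lamH_pos := hlamH
  lamD_pos := hlamD
  LamD_pos := hLamD
  LamX_pos := hLamX
  i₁_nonneg := ENNReal.toReal_nonneg
  normA := l2_scaled_mulVec_le X hLamX.le hmaxX
  normD x := (l2_mulVec_le_maxSing D x).trans (mul_le_mul_of_nonneg_right hmaxD (l2_nonneg _))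
  pinvD := l2_pinv_le_of_le_minPosSing D hlamD (hminD.trans (min_le_left _ _))
  pinvB := l2_pinv_le_of_le_minPosSing _ hlamD (hminD.trans (min_le_right _ _))
  pinvK y := by
    rw [scaled, Matrix.smul_mul]
    exact l2_pinv_le _ y
  memA := scaled_transpose_mem_ambient X D
  memD := transpose_mem_ambient X D
  rsc _ hb _ hg := hR.strong_convexity hb hg
  irr _ _ hv := hI.exists_resp hR hν hlamH hS hv

variable {X D} in
theorem IsSplitLBISS.exists_isPath {βs : Fin p → ℝ} {e : Fin n → ℝ} {ν κ : ℝ}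
    {ρ : ℝ → Fin m → ℝ} {β : ℝ → Fin p → ℝ} {γ : ℝ → Fin m → ℝ}
    (h : IsSplitLBISS X D (X *ᵥ βs + e) ν κ ρ β γ) :
    ∃ ρ' β' γ', IsPath (scaled X) D ν κ βs ((√(n : ℝ))⁻¹ • e) ρ ρ' β β' γ γ' := by
  obtain ⟨h1, h2, h3, ρ', β', γ', hρ, hβ, hγ, ht⟩ := h
  refine ⟨ρ', β', γ', h1, h2, h3, hρ.1, hβ.1, hγ.1, fun t h0 => (hρ.2 t h0).1,
    fun t h0 => (hβ.2 t h0).1, fun t h0 => (hγ.2 t h0).1, fun t h0 => ?_,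
    fun t h0 => (ht t h0).2.1, fun t h0 => (ht t h0).2.2⟩
  rw [(ht t h0).1, gradBeta, scaledTranspose_mulVec]
  congr 2
  rw [← Matrix.mulVec_sub, scaled, Matrix.smul_mulVec, ← smul_sub, Matrix.mulVec_sub]
  congr 2
  abel

end Translation

/-! ### Gaussian integrals -/

section Gaussian

lemma lintegral_exp_mul_gaussianReal (t : ℝ) :
    ∫⁻ x, ENNReal.ofReal (Real.exp (t * x)) ∂(gaussianReal 0 1)
      = ENNReal.ofReal (Real.exp (t ^ 2 / 2)) := by
  rw [← ofReal_integral_eq_lintegral_ofReal (integrable_exp_mul_gaussianReal t)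
    (ae_of_all _ fun x => (Real.exp_pos _).le)]
  have h := congrFun (mgf_fun_id_gaussianReal (μ := 0) (v := 1)) t
  simp only [mgf] at h
  rw [h]
  simp

/-- The weight `3/8` is chosen so that `(1 - 2 · 3/8)^(-1/2)` equals exactly `2`. -/
lemma lintegral_exp_sq_gaussianReal :
    ∫⁻ x, ENNReal.ofReal (Real.exp (3 / 8 * x ^ 2)) ∂(gaussianReal 0 1) = 2 := by
  rw [gaussianReal_of_var_ne_zero 0 one_ne_zero,
    lintegral_withDensity_eq_lintegral_mul _ (measurable_gaussianPDF 0 1) (by fun_prop)]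
  have h1 : ∀ x : ℝ, (gaussianPDF 0 1 * fun x => ENNReal.ofReal (Real.exp (3 / 8 * x ^ 2))) x
      = ENNReal.ofReal ((√(2 * Real.pi))⁻¹ * Real.exp (-(1 / 8) * x ^ 2)) := by
    intro x
    rw [Pi.mul_apply, gaussianPDF, ← ENNReal.ofReal_mul (gaussianPDFReal_nonneg 0 1 x),
      gaussianPDFReal_def]
    congr 1
    simp only [NNReal.coe_one, mul_one, sub_zero]
    rw [mul_assoc, ← Real.exp_add]
    congr 2; ring
  have h2 : ∫ x : ℝ, (√(2 * Real.pi))⁻¹ * Real.exp (-(1 / 8) * x ^ 2) = 2 := by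
    rw [integral_const_mul, integral_gaussian]
    have hpi := Real.pi_pos
    have h3 : √(Real.pi / (1 / 8)) = 2 * √(2 * Real.pi) := by
      rw [show Real.pi / (1 / 8) = 2 ^ 2 * (2 * Real.pi) by ring, Real.sqrt_mul (by norm_num),
        Real.sqrt_sq (by norm_num)]
    have h4 : 0 < √(2 * Real.pi) := Real.sqrt_pos.2 (by positivity)
    rw [h3]; field_simp
  simp_rw [h1]
  rw [← ofReal_integral_eq_lintegral_ofReal
    ((integrable_exp_neg_mul_sq (by norm_num)).const_mul _)
    (ae_of_all _ fun x => by positivity), h2]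
  simp

end Gaussian

/-! ### Sub-Gaussian tail bounds -/

section Tail
variable {Ω : Type*} [MeasurableSpace Ω] {μ : Measure Ω}

/-- The moment generating function of the square of a sub-Gaussian variable. -/
lemma lintegral_exp_sq_le [SFinite μ] {Y : Ω → ℝ} (hY : Measurable Y) {σ : ℝ} (hσ : 0 < σ)
    (h : HasSubgaussianMGF Y (σ ^ 2).toNNReal μ) :
    ∫⁻ ω, ENNReal.ofReal (Real.exp (3 / (8 * σ ^ 2) * Y ω ^ 2)) ∂μ ≤ 2 := by
  -- An auxiliary standard Gaussian `g` linearises the square: `exp(a²Y²/2) = E exp(aYg)`. After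
  -- exchanging the integrals, sub-Gaussianity of `Y` leaves `E exp(3g²/8) = 2`.
  set a := √(3 / (4 * σ ^ 2)) with ha
  have ha2 : a ^ 2 = 3 / (4 * σ ^ 2) := Real.sq_sqrt (by positivity)
  have h1 : ∀ ω, ENNReal.ofReal (Real.exp (3 / (8 * σ ^ 2) * Y ω ^ 2))
      = ∫⁻ x, ENNReal.ofReal (Real.exp (a * Y ω * x)) ∂(gaussianReal 0 1) := by
    intro ω
    rw [lintegral_exp_mul_gaussianReal, mul_pow, ha2]
    congr 2; ring
  simp_rw [h1]
  rw [lintegral_lintegral_swap (by fun_prop), ← lintegral_exp_sq_gaussianReal]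
  refine lintegral_mono fun x => ?_
  have h2 : ∀ ω, a * Y ω * x = a * x * Y ω := fun ω => by ring
  simp_rw [h2]
  rw [← ofReal_integral_eq_lintegral_ofReal (h.integrable_exp_mul _)
    (ae_of_all _ fun ω => (Real.exp_pos _).le)]
  refine ENNReal.ofReal_le_ofReal ((h.mgf_le (a * x)).trans_eq ?_)
  rw [Real.coe_toNNReal _ (sq_nonneg σ), mul_pow, ha2]
  congr 1; field_simp; ring

/-- Chernoff's bound for `∑ ε_i²` at level `4σ²n` with parameter `3/(8σ²)` gives `exp(-3n/2) · 2ⁿ`,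
and `3/2 - log 2 ≥ 4/5`. -/
lemma measureReal_l2_noise_le [IsProbabilityMeasure μ] {n : ℕ} {ε : Fin n → Ω → ℝ}
    (hεm : ∀ i, Measurable (ε i)) (hεind : iIndepFun ε μ) {σ : ℝ} (hσ : 0 < σ)
    (hε : ∀ i, HasSubgaussianMGF (ε i) (σ ^ 2).toNNReal μ) :
    μ.real {ω | 2 * σ * √n ≤ l2 (fun i => ε i ω)} ≤ Real.exp (-(4 * n) / 5) := by
  set s := 3 / (8 * σ ^ 2) with hs
  have hs0 : 0 ≤ s := by positivity
  have hmY : ∀ i, Measurable (fun ω => ε i ω ^ 2) := fun i => (hεm i).pow_const 2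
  have hind : iIndepFun (fun i ω => ε i ω ^ 2) μ :=
    hεind.comp (fun _ x => x ^ 2) fun _ => by fun_prop
  have hlin : ∀ i, ∫⁻ ω, ENNReal.ofReal (Real.exp (s * ε i ω ^ 2)) ∂μ ≤ 2 :=
    fun i => lintegral_exp_sq_le (hεm i) hσ (hε i)
  have hint : ∀ i, Integrable (fun ω => Real.exp (s * ε i ω ^ 2)) μ := by
    intro i
    refine ⟨by fun_prop, ?_⟩
    rw [hasFiniteIntegral_iff_ofReal (ae_of_all _ fun ω => (Real.exp_pos _).le)]
    exact (hlin i).trans_lt (by simp)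
  have hmgf : ∀ i, mgf (fun ω => ε i ω ^ 2) μ s ≤ 2 := by
    intro i
    rw [mgf, integral_eq_lintegral_of_nonneg_ae (ae_of_all _ fun ω => (Real.exp_pos _).le)
      (hint i).aestronglyMeasurable]
    exact ENNReal.toReal_le_of_le_ofReal (by norm_num) (by simpa using hlin i)
  have hcher := measure_ge_le_exp_mul_mgf (μ := μ) (X := ∑ i, fun ω => ε i ω ^ 2)
    (4 * σ ^ 2 * n) hs0 (hind.integrable_exp_mul_sum hmY fun i _ => hint i)
  rw [hind.mgf_sum hmY] at hcher
  have hprod : ∏ i, mgf (fun ω => ε i ω ^ 2) μ s ≤ 2 ^ n := by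
    calc _ ≤ ∏ _i : Fin n, (2 : ℝ) :=
          Finset.prod_le_prod (fun i _ => mgf_nonneg) fun i _ => hmgf i
      _ = 2 ^ n := by simp
  have hset : {ω | 2 * σ * √n ≤ l2 (fun i => ε i ω)}
      ⊆ {ω | 4 * σ ^ 2 * n ≤ (∑ i, fun ω => ε i ω ^ 2) ω} := by
    intro ω hω
    have h1 := pow_le_pow_left₀ (by positivity) (Set.mem_ofPred_eq ▸ hω : 2 * σ * √n ≤ _) 2
    rw [l2_sq_eq_sum, mul_pow, mul_pow, Real.sq_sqrt (Nat.cast_nonneg _)] at h1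
    rw [Set.mem_ofPred_eq, Finset.sum_apply]
    linarith
  refine (measureReal_mono hset).trans (hcher.trans ?_)
  calc _ ≤ Real.exp (-s * (4 * σ ^ 2 * n)) * 2 ^ n :=
        mul_le_mul_of_nonneg_left hprod (Real.exp_pos _).le
    _ = Real.exp (-(3 / 2) * n + n * Real.log 2) := by
        rw [Real.exp_add, Real.exp_nat_mul, Real.exp_log two_pos]
        congr 2
        rw [hs]; field_simp; ring
    _ ≤ _ := by
        refine Real.exp_le_exp.2 ?_
        have h1 := Real.log_two_lt_d9
        have h2 : (n : ℝ) * Real.log 2 ≤ n * 0.7 := by gcongr; linarith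
        linarith

/-- A linear combination of independent sub-Gaussian variables with coefficient vector of norm at
most `c`. -/
lemma measureReal_abs_dot_noise_le [IsProbabilityMeasure μ] {n : ℕ} {ε : Fin n → Ω → ℝ}
    (hεind : iIndepFun ε μ) {σ : ℝ} (hσ : 0 < σ)
    (hε : ∀ i, HasSubgaussianMGF (ε i) (σ ^ 2).toNNReal μ) {v : Fin n → ℝ} {c : ℝ} (hc : 0 < c)
    (hv : l2 v ≤ c) {m : ℕ} (hm : 1 ≤ m) :
    μ.real {ω | 2 * c * σ * √(Real.log m) ≤ |v ⬝ᵥ fun i => ε i ω|} ≤ 2 / (m : ℝ) ^ 2 := by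
  have hm0 : (0 : ℝ) < m := by exact_mod_cast hm
  have hlog : 0 ≤ Real.log m := Real.log_nonneg (by exact_mod_cast hm)
  set C : ℝ≥0 := ⟨c ^ 2 * σ ^ 2, by positivity⟩ with hC
  have hsub : HasSubgaussianMGF (fun ω => v ⬝ᵥ fun i => ε i ω) C μ := by
    have h1 := HasSubgaussianMGF.sum_of_iIndepFun (s := Finset.univ)
      (hεind.comp (fun i x => v i * x) fun i => by fun_prop)
      (fun i _ => (hε i).const_mul (v i))
    refine ⟨h1.integrable_exp_mul, fun t => (h1.mgf_le t).trans (Real.exp_le_exp.2 ?_)⟩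
    have h2 : ((∑ i, (⟨v i ^ 2, sq_nonneg (v i)⟩ * (σ ^ 2).toNNReal) : ℝ≥0) : ℝ)
        = l2 v ^ 2 * σ ^ 2 := by
      rw [NNReal.coe_sum, l2_sq_eq_sum, Finset.sum_mul]
      refine Finset.sum_congr rfl fun i _ => ?_
      change v i ^ 2 * ((σ ^ 2).toNNReal : ℝ) = _
      rw [Real.coe_toNNReal _ (sq_nonneg σ)]
    have h3 := l2_nonneg v
    rw [h2]
    change l2 v ^ 2 * σ ^ 2 * t ^ 2 / 2 ≤ c ^ 2 * σ ^ 2 * t ^ 2 / 2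
    gcongr
  have hthr : 0 ≤ 2 * c * σ * √(Real.log m) := by positivity
  have hval : Real.exp (-(2 * c * σ * √(Real.log m)) ^ 2 / (2 * C)) = 1 / (m : ℝ) ^ 2 := by
    have h1 : -(2 * c * σ * √(Real.log m)) ^ 2 / (2 * (C : ℝ)) = -(2 * Real.log m) := by
      change -(2 * c * σ * √(Real.log m)) ^ 2 / (2 * (c ^ 2 * σ ^ 2)) = _
      rw [mul_pow, Real.sq_sqrt hlog]
      field_simp
    rw [h1, Real.exp_neg, two_mul, Real.exp_add, Real.exp_log hm0]
    field_simp
  have hup := hsub.measure_ge_le hthr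
  have hlow := hsub.neg.measure_ge_le hthr
  rw [hval] at hup hlow
  calc _ ≤ μ.real ({ω | 2 * c * σ * √(Real.log m) ≤ v ⬝ᵥ fun i => ε i ω}
        ∪ {ω | 2 * c * σ * √(Real.log m) ≤ (-fun ω => v ⬝ᵥ fun i => ε i ω) ω}) := by
        refine measureReal_mono fun ω hω => ?_
        rcases le_abs.1 (Set.mem_ofPred_eq ▸ hω : _ ≤ |v ⬝ᵥ fun i => ε i ω|) with h | h
        · exact Or.inl h
        · exact Or.inr h
    _ ≤ 1 / (m : ℝ) ^ 2 + 1 / (m : ℝ) ^ 2 := (measureReal_union_le _ _).trans (add_le_add hup hlow)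
    _ = _ := by ring

lemma measureReal_exists_abs_mulVec_noise_le [IsProbabilityMeasure μ] {n : ℕ} {ε : Fin n → Ω → ℝ}
    (hεind : iIndepFun ε μ) {σ : ℝ} (hσ : 0 < σ)
    (hε : ∀ i, HasSubgaussianMGF (ε i) (σ ^ 2).toNNReal μ) {α : Type*} [Fintype α]
    {Q : Matrix α (Fin n) ℝ} {c : ℝ} (hc : 0 < c) (hQ : ∀ x, l2 (Q *ᵥ x) ≤ c * l2 x)
    {m : ℕ} (hm : 1 ≤ m) :
    μ.real {ω | ∃ j, 2 * c * σ * √(Real.log m) ≤ |(Q *ᵥ fun i => ε i ω) j|}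
      ≤ 2 * Fintype.card α / (m : ℝ) ^ 2 := by
  rw [Set.ofPred_exists]
  refine (measureReal_iUnion_fintype_le _).trans ?_
  calc _ ≤ ∑ _j : α, 2 / (m : ℝ) ^ 2 := Finset.sum_le_sum fun j _ =>
        measureReal_abs_dot_noise_le hεind hσ hε hc (l2_row_le hc.le hQ j) hm
    _ = _ := by rw [Finset.sum_const, nsmul_eq_mul, Finset.card_univ]; ring

end Tail

/-- Orthogonal coordinates on a subspace. -/
lemma exists_coordinates {n : ℕ} (V : Submodule ℝ (Fin n → ℝ)) :
    ∃ E : Matrix (Fin (Module.finrank ℝ V)) (Fin n) ℝ, (∀ x, l2 (E *ᵥ x) ≤ l2 x) ∧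
      ∀ u ∈ V, ∀ z, u ⬝ᵥ z = (E *ᵥ u) ⬝ᵥ (E *ᵥ z) := by
  set V' := V.map (WithLp.linearEquiv 2 ℝ (Fin n → ℝ)).symm.toLinearMap with hV'
  have hfr : Module.finrank ℝ V' = Module.finrank ℝ V := LinearEquiv.finrank_map_eq _ _
  let b := (stdOrthonormalBasis ℝ V').reindex (finCongr hfr)
  have hdot : ∀ u ∈ V, ∀ z, u ⬝ᵥ z
      = (Matrix.of (fun i => (b i : EuclideanSpace ℝ (Fin n)).ofLp) *ᵥ u)
        ⬝ᵥ (Matrix.of (fun i => (b i : EuclideanSpace ℝ (Fin n)).ofLp) *ᵥ z) := by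
    intro u hu z
    have huV : (WithLp.toLp 2 u : EuclideanSpace ℝ (Fin n)) ∈ V' := ⟨u, hu, rfl⟩
    have h1 := congrArg (Subtype.val) (b.sum_repr' ⟨_, huV⟩)
    have h2 : u = ∑ i, ((b i : EuclideanSpace ℝ (Fin n)).ofLp ⬝ᵥ u)
        • (b i : EuclideanSpace ℝ (Fin n)).ofLp := by
      have h3 := congrArg WithLp.ofLp h1
      simp only [Submodule.coe_sum, Submodule.coe_smul, Submodule.coe_inner, WithLp.ofLp_sum,
        WithLp.ofLp_smul] at h3
      refine h3.symm.trans (Finset.sum_congr rfl fun i _ => ?_)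
      rw [dot_eq_inner]
    conv_lhs => rw [h2]
    rw [sum_dotProduct]
    exact Finset.sum_congr rfl fun i _ => by rw [smul_dotProduct, smul_eq_mul]; rfl
  refine ⟨Matrix.of (fun i => (b i : EuclideanSpace ℝ (Fin n)).ofLp), fun x => ?_, hdot⟩
  set E := Matrix.of (fun i => (b i : EuclideanSpace ℝ (Fin n)).ofLp) with hE
  have hmem : Eᵀ *ᵥ (E *ᵥ x) ∈ V := by
    rw [Matrix.mulVec_eq_sum]
    refine V.sum_mem fun i _ => ?_
    rw [op_smul_eq_smul]
    have h1 : ((b i : EuclideanSpace ℝ (Fin n)).ofLp) ∈ V := by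
      obtain ⟨y, hy, hyb⟩ := (b i).2
      rw [← hyb]; exact hy
    exact V.smul_mem _ h1
  set u := Eᵀ *ᵥ (E *ᵥ x) with hu
  have h1 : l2 (E *ᵥ x) ^ 2 = u ⬝ᵥ x := by rw [hu, transpose_mulVec_dot, l2_sq]
  have h2 : l2 u ≤ l2 x := by
    apply l2_le_of_sq_le (l2_nonneg _)
    have h3 : l2 u ^ 2 = u ⬝ᵥ x := by
      rw [hdot u hmem x, dotProduct_comm, ← transpose_mulVec_dot, ← hu, l2_sq]
    rw [h3, mul_comm]
    exact dot_le_l2 _ _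
  apply l2_le_of_sq_le_sq (l2_nonneg _)
  rw [h1]
  calc u ⬝ᵥ x ≤ l2 u * l2 x := dot_le_l2 _ _
    _ ≤ l2 x * l2 x := mul_le_mul_of_nonneg_right h2 (l2_nonneg _)
    _ = l2 x ^ 2 := (sq _).symm

/-! ### Arithmetic of the stopping time and of the bounds -/

section Constants
variable {n m : ℕ} {lamD LamX lamH σ η : ℝ}

lemma tauBar_pos (hn : 1 ≤ n) (hm : 2 ≤ m) (hd : 0 < lamD) (hX : 0 < LamX) (hσ : 0 < σ)
    (hη : 0 < η) : 0 < tauBar n m lamD LamX σ η := by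
  have hn0 : (0 : ℝ) < n := by exact_mod_cast hn
  have hlog : 0 < Real.log m := Real.log_pos (by exact_mod_cast hm)
  have := Real.sqrt_pos.2 (div_pos hn0 hlog)
  unfold tauBar
  positivity

/-- `τ̄` is calibrated to make `η/(4τ̄)` equal to `Λ_X/λ_D` times `2σ√(log m/n)`, the level of the
noise maxima. -/
lemma inv_tauBar :
    (tauBar n m lamD LamX σ η)⁻¹
      = 4 / η * (LamX / lamD) * (2 * σ * √(Real.log m) / √n) := by
  unfold tauBar
  rw [Real.sqrt_div (Nat.cast_nonneg _), mul_inv, mul_inv, inv_div, inv_div, inv_div]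
  ring

lemma signalBound_eq {s : ℕ} {LamD : ℝ} (hm : 1 ≤ m) :
    signalBound n m s lamD LamD LamX lamH σ η
      = 2 * (LamD / lamD) / (lamH * tauBar n m lamD LamX σ η)
        * (2 * Real.log s + 5 + max 0 (Real.log (8 * LamD))) := by
  rw [div_eq_mul_inv _ (lamH * _), mul_inv, inv_tauBar, signalBound,
    Real.sqrt_div (Real.log_nonneg (by exact_mod_cast hm))]
  simp only [div_eq_mul_inv, mul_inv, sq]
  ring

lemma le_errorBound {s r : ℕ} {LamD i₁ : ℝ} (hη : 0 < η) (hm : 1 ≤ m)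
    (hd : 0 < lamD) (hX : 0 < LamX) (hH : 0 < lamH) (hσ : 0 < σ) :
    10 * √s / (lamH * tauBar n m lamD LamX σ η) * (1 + LamD / lamD ^ 2)
      + i₁ * (√r * ((1 + LamX ^ 2 / (lamH * lamD ^ 2)) * (2 * σ * √(Real.log m) / √n)))
      ≤ errorBound n m s r lamD LamD LamX lamH i₁ σ η := by
  have hlog : 0 ≤ Real.log m := Real.log_nonneg (by exact_mod_cast hm)
  rw [div_eq_mul_inv _ (lamH * _), mul_inv, inv_tauBar, errorBound,
    Real.sqrt_div (by positivity), Real.sqrt_div (by positivity),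
    Real.sqrt_mul (Nat.cast_nonneg _), Real.sqrt_mul (Nat.cast_nonneg _)]
  refine add_le_add (le_of_eq ?_) ?_
  · generalize √(n : ℝ) = x
    simp only [div_eq_mul_inv]
    generalize x⁻¹ = x
    field_simp
    ring
  · generalize hx : √(n : ℝ) = x
    have hx0 : 0 ≤ x := hx ▸ Real.sqrt_nonneg _
    have h1 : 2 * σ / lamH * (LamX / lamD ^ 2 + (lamH * lamD ^ 2 + LamX ^ 2) / lamD ^ 2 * i₁)
        * (√r * √(Real.log m) / x)
        = 2 * σ / lamH * (LamX / lamD ^ 2) * (√r * √(Real.log m) / x)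
        + i₁ * (√r * ((1 + LamX ^ 2 / (lamH * lamD ^ 2)) * (2 * σ * √(Real.log m) / x))) := by
      simp only [div_eq_mul_inv]
      generalize x⁻¹ = x
      field_simp
    rw [h1]
    exact le_add_of_nonneg_left (by positivity)

end Constants

/-! ### Probability of the good noise events -/

section NoiseEvents
variable {Ω : Type*} [MeasurableSpace Ω] {μ : Measure Ω} [IsProbabilityMeasure μ] {n m p : ℕ}
  {ε : Fin n → Ω → ℝ} {σ : ℝ}

lemma one_sub_le_measureReal {G : Set Ω} {P : Ω → Prop} {δ : ℝ}
    (hG : ∀ ω, P ω → ω ∈ G) (hP : μ.real {ω | ¬P ω} ≤ δ) : 1 - δ ≤ μ.real G := by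
  have h1 : μ.real Set.univ ≤ μ.real (G ∪ {ω | ¬P ω}) := by
    refine measureReal_mono fun ω _ => ?_
    by_cases h : P ω
    · exact Or.inl (hG ω h)
    · exact Or.inr h
  have h2 := measureReal_union_le (μ := μ) G {ω | ¬P ω}
  rw [probReal_univ] at h1
  linarith

lemma measureReal_not_and_le {P Q : Ω → Prop} {a b : ℝ} (hP : μ.real {ω | ¬P ω} ≤ a)
    (hQ : μ.real {ω | ¬Q ω} ≤ b) : μ.real {ω | ¬(P ω ∧ Q ω)} ≤ a + b := by
  refine le_trans (measureReal_mono ?_) ((measureReal_union_le _ _).trans (add_le_add hP hQ))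
  intro ω hω
  by_cases h : P ω
  · exact Or.inr fun hq => hω ⟨h, hq⟩
  · exact Or.inl h

lemma abs_mulVec_scaled_noise_le (hn : 1 ≤ n) (hm : 1 ≤ m) (hεind : iIndepFun ε μ) (hσ : 0 < σ)
    (hε : ∀ i, HasSubgaussianMGF (ε i) (σ ^ 2).toNNReal μ) {α : Type*} [Fintype α]
    {Q : Matrix α (Fin n) ℝ} {c : ℝ} (hc : 0 < c) (hQ : ∀ x, l2 (Q *ᵥ x) ≤ c * l2 x) :
    μ.real {ω | ¬∀ j, |(Q *ᵥ ((√(n : ℝ))⁻¹ • fun i => ε i ω)) j|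
        ≤ c * (2 * σ * √(Real.log m) / √n)} ≤ 2 * Fintype.card α / (m : ℝ) ^ 2 := by
  have hn0 : (0 : ℝ) < √n := Real.sqrt_pos.2 (by exact_mod_cast hn)
  refine (measureReal_mono fun ω hω => ?_).trans
    (measureReal_exists_abs_mulVec_noise_le hεind hσ hε hc hQ hm)
  by_contra hcon
  refine hω fun j => ?_
  have h1 : |(Q *ᵥ fun i => ε i ω) j| ≤ 2 * c * σ * √(Real.log m) := by
    by_contra h
    exact hcon ⟨j, (not_le.1 h).le⟩
  rw [Matrix.mulVec_smul, Pi.smul_apply, smul_eq_mul, abs_mul, abs_of_pos (inv_pos.2 hn0),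
    inv_mul_le_iff₀ hn0]
  refine h1.trans_eq ?_
  field_simp

namespace Regular
variable {A : Matrix (Fin n) (Fin p) ℝ} {D : Matrix (Fin m) (Fin p) ℝ}
  {L : Submodule ℝ (Fin p → ℝ)} {S : Finset (Fin m)} {ν η lamH lamD LamD LamX i₁ : ℝ}

lemma noiseBound_of_event (h : Regular A D L S ν η lamH lamD LamD LamX i₁)
    (hn : 1 ≤ n) (hm : 2 ≤ m) (hεm : ∀ i, Measurable (ε i)) (hεind : iIndepFun ε μ) (hσ : 0 < σ)
    (hε : ∀ i, HasSubgaussianMGF (ε i) (σ ^ 2).toNNReal μ) :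
    μ.real {ω | ¬NoiseBound A D S ν η lamH lamD LamD σ (tauBar n m lamD LamX σ η)
      ((√(n : ℝ))⁻¹ • fun i => ε i ω)} ≤ Real.exp (-(4 * n) / 5) + 6 / m := by
  have hn0 : (0 : ℝ) < √n := Real.sqrt_pos.2 (by exact_mod_cast hn)
  have hm0 : (0 : ℝ) < m := by positivity
  have hm1 : 1 ≤ m := by omega
  have hX := h.LamX_pos
  have hd := h.lamD_pos
  have hD := h.LamD_pos
  have hH := h.lamH_pos
  have hν := h.nu_pos
  have hη := h.eta_pos
  set T := noiseResp A (rows D Sᶜ) ν with hT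
  set τ := tauBar n m lamD LamX σ η with hτ
  set N := 2 * σ * √(Real.log m) / √n with hN
  have hτN : η / (4 * τ) = LamX / lamD * N := by
    rw [div_eq_mul_inv, mul_inv, hτ, inv_tauBar, ← hN]; field_simp
  have hτN' : η / (4 * τ * lamH) = LamX / (lamH * lamD) * N := by
    rw [← div_div, hτN]; field_simp
  have hTx : ∀ x, T *ᵥ x ∈ L ∧ Resp A (rows D Sᶜ) ν (T *ᵥ x) (Aᵀ *ᵥ x) := fun x =>
    ⟨h.noiseResp_mem x, resp_noiseResp A (rows D Sᶜ) hν x⟩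
  have e1 : ∀ x, l2 ((rows D Sᶜ * T) *ᵥ x) ≤ ν * (LamX / lamD) * l2 x := fun x => by
    rw [← Matrix.mulVec_mulVec, mul_assoc]
    exact h.l2_rows_resp_le (hTx x).2
  have e2 : ∀ x, l2 ((D * T) *ᵥ x) ≤ LamX / (lamH * lamD) * l2 x := fun x => by
    rw [← Matrix.mulVec_mulVec]
    exact h.l2_mulVec_resp_le (hTx x).1 (hTx x).2
  have e3 : ∀ x, l2 ((D * (kerProj (rows D Sᶜ) * T)) *ᵥ x)
      ≤ (1 + LamD / lamD) * (LamX / (lamH * lamD)) * l2 x := fun x => by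
    rw [← Matrix.mulVec_mulVec, ← Matrix.mulVec_mulVec, mul_assoc]
    refine (h.l2_mulVec_kerProj_rows_le _).trans (mul_le_mul_of_nonneg_left ?_ (by positivity))
    exact h.l2_mulVec_resp_le (hTx x).1 (hTx x).2
  have f0 : μ.real {ω | ¬l2 ((√(n : ℝ))⁻¹ • fun i => ε i ω) ≤ 2 * σ}
      ≤ Real.exp (-(4 * n) / 5) := by
    refine (measureReal_mono fun ω hω => ?_).trans (measureReal_l2_noise_le hεm hεind hσ hε)
    have h1 : ¬l2 ((√(n : ℝ))⁻¹ • fun i => ε i ω) ≤ 2 * σ := hω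
    rw [l2_smul, abs_of_pos (inv_pos.2 hn0), inv_mul_le_iff₀ hn0, not_le] at h1
    change 2 * σ * √n ≤ l2 (fun i => ε i ω)
    linarith
  have f1 := abs_mulVec_scaled_noise_le hn hm1 hεind hσ hε (by positivity) e1
  have f2 := abs_mulVec_scaled_noise_le hn hm1 hεind hσ hε (by positivity) e2
  have f3 := abs_mulVec_scaled_noise_le hn hm1 hεind hσ hε (by positivity) e3
  have hcard : 2 * (m : ℝ) / (m : ℝ) ^ 2 = 2 / m := by field_simp
  rw [Fintype.card_fin, hcard] at f2 f3
  have f1' : 2 * (Fintype.card (Sᶜ : Finset (Fin m)) : ℝ) / (m : ℝ) ^ 2 ≤ 2 / m := by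
    rw [← hcard]
    gcongr
    rw [Fintype.card_coe]
    simpa using Finset.card_le_univ Sᶜ
  -- Three families of at most `m` linear statistics, each failing with probability at most `2/m²`,
  -- add up to `6/m`.
  have hall := measureReal_not_and_le f0 (measureReal_not_and_le (f1.trans f1')
    (measureReal_not_and_le f2 f3))
  refine le_trans (measureReal_mono ?_) (hall.trans_eq (by ring))
  intro ω hω hgood
  apply hω
  obtain ⟨g0, g1, g2, g3⟩ := hgood
  refine ⟨g0, fun j => ?_, fun j => ?_, fun j => ?_⟩
  · rw [Matrix.mulVec_mulVec, hτN, ← mul_assoc]; exact g1 j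
  · rw [Matrix.mulVec_mulVec, hτN']; exact g2 j
  · rw [Matrix.mulVec_mulVec, Matrix.mulVec_mulVec, hτN', ← mul_assoc, Matrix.mul_assoc]
    exact g3 j

/-- The component of the response in the kernel of `D` is controlled by the coordinates of the
noise on the image of this kernel. -/
lemma exists_kernel_coordinates (h : Regular A D L S ν η lamH lamD LamD LamX i₁)
    {V : Submodule ℝ (Fin n → ℝ)} (hV : ∀ k, D *ᵥ k = 0 → A *ᵥ k ∈ V) :
    ∃ Q : Matrix (Fin (Module.finrank ℝ V)) (Fin n) ℝ,
      (∀ x, l2 (Q *ᵥ x) ≤ (1 + LamX ^ 2 / (lamH * lamD ^ 2)) * l2 x) ∧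
      ∀ w, l2 (kerProj D *ᵥ (noiseResp A (rows D Sᶜ) ν *ᵥ w)) ≤ i₁ * l2 (Q *ᵥ w) := by
  obtain ⟨E, hE, hdot⟩ := exists_coordinates V
  set T := noiseResp A (rows D Sᶜ) ν with hT
  have hQ : ∀ w, (E * (1 - A * (pinv D * (D * T)))) *ᵥ w
      = E *ᵥ (w - A *ᵥ (pinv D *ᵥ (D *ᵥ (T *ᵥ w)))) := fun w => by
    simp only [← Matrix.mulVec_mulVec, Matrix.sub_mulVec, Matrix.one_mulVec]
  refine ⟨E * (1 - A * (pinv D * (D * T))), fun x => ?_, fun w => ?_⟩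
  · rw [hQ]
    exact (hE _).trans (h.l2_sub_pinv_le (h.noiseResp_mem x)
      (resp_noiseResp A (rows D Sᶜ) h.nu_pos x))
  · rw [hQ]
    have hker := mulVec_kerProj D (T *ᵥ w)
    refine (h.l2_le_of_mem_ker (h.kerProj_mulVec_mem (h.noiseResp_mem w)) hker).trans
      (mul_le_mul_of_nonneg_left ?_ h.i₁_nonneg)
    -- The residual `w - A D†D b` is paired only with vectors of `A(ker D) ⊆ V`, so just its
    -- coordinates on `V` matter.
    apply l2_le_of_sq_le (l2_nonneg _)
    rw [l2_sq, dot_kernel_resp (resp_noiseResp A (rows D Sᶜ) h.nu_pos w) hker, dotProduct_comm,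
      hdot _ (hV _ hker), mul_comm]
    exact (dot_le_l2 _ _).trans (mul_le_mul_of_nonneg_right (hE _) (l2_nonneg _))

lemma kernel_of_event (h : Regular A D L S ν η lamH lamD LamD LamX i₁)
    (hn : 1 ≤ n) (hm : 1 ≤ m) (hεind : iIndepFun ε μ) (hσ : 0 < σ)
    (hε : ∀ i, HasSubgaussianMGF (ε i) (σ ^ 2).toNNReal μ)
    {V : Submodule ℝ (Fin n → ℝ)} (hV : ∀ k, D *ᵥ k = 0 → A *ᵥ k ∈ V) :
    μ.real {ω | ¬l2 (kerProj D *ᵥ (noiseResp A (rows D Sᶜ) ν *ᵥ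
        ((√(n : ℝ))⁻¹ • fun i => ε i ω))) ≤ i₁ * (√(Module.finrank ℝ V)
          * ((1 + LamX ^ 2 / (lamH * lamD ^ 2)) * (2 * σ * √(Real.log m) / √n)))}
      ≤ 2 * Module.finrank ℝ V / (m : ℝ) ^ 2 := by
  have hH := h.lamH_pos
  have hd := h.lamD_pos
  obtain ⟨Q, hQ, hw⟩ := h.exists_kernel_coordinates hV
  have h1 := abs_mulVec_scaled_noise_le hn hm hεind hσ hε (by positivity) hQ
  rw [Fintype.card_fin] at h1
  refine le_trans (measureReal_mono ?_) h1
  intro ω hω hgood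
  apply hω
  refine (hw _).trans (mul_le_mul_of_nonneg_left ?_ h.i₁_nonneg)
  have h2 := l2_le_sqrt_card_mul (S := Finset.univ) (by positivity)
    (fun j hj => absurd (Finset.mem_univ j) hj) hgood
  simpa using h2

end Regular
end NoiseEvents

end SplitLBISS

end

/-! ### The consistency theorem -/

theorem mainTheorem4
    {Ω : Type*} [MeasurableSpace Ω] (μ : Measure Ω) [IsProbabilityMeasure μ]
    -- dimensions, design matrix, transformation and true parameter
    (n m p : ℕ) (hn : 1 ≤ n) (hm : 2 ≤ m)
    (X : Matrix (Fin n) (Fin p) ℝ) (D : Matrix (Fin m) (Fin p) ℝ) (βs : Fin p → ℝ)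
    (S : Finset (Fin m)) (hS : S = SplitLBISS.supp (D *ᵥ βs)) (hSne : S.Nonempty)
    (hβs : βs ∈ SplitLBISS.ambient X D)
    -- i.i.d. sub-Gaussian noise with parameter `σ ^ 2`
    (σ : ℝ) (hσ : 0 < σ) (ε : Fin n → Ω → ℝ) (hεm : ∀ i, Measurable (ε i))
    (hεind : iIndepFun ε μ) (hεid : ∀ i j, IdentDistrib (ε i) (ε j) μ μ)
    (hεsub : ∀ i, HasSubgaussianMGF (ε i) (σ ^ 2).toNNReal μ)
    -- constants bounding the singular values
    (lamD LamD LamX : ℝ) (hlamD : 0 < lamD) (hLamD : 0 < LamD) (hLamX : 0 < LamX)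
    (hminD : ENNReal.ofReal lamD ≤
      min (SplitLBISS.minPosSing D) (SplitLBISS.minPosSing (SplitLBISS.rows D Sᶜ)))
    (hmaxD : SplitLBISS.maxSing D ≤ LamD)
    (hmaxX : SplitLBISS.maxSing (SplitLBISS.scaledTranspose X * X) ≤ LamX ^ 2)
    -- restricted strong convexity, with the constant `C` it yields, and irrepresentability
    (ν : ℝ) (hν : 0 < ν) (hRSC : SplitLBISS.RSC X D S)
    (C lamH : ℝ) (hC : 0 < C) (hlamH : lamH = C / (1 + ν))
    (hRSCν : SplitLBISS.RSCLoss X D ν S lamH)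
    (η : ℝ) (hη : η ∈ Set.Ioc (0 : ℝ) 1) (hIRR : SplitLBISS.IRR X D ν S η)
    -- the damping parameter, and the solution path for the data `y = X βs + ε`
    (κ : ℝ)
    (hκ : SplitLBISS.kappaBound lamD LamD LamX lamH (SplitLBISS.invLamOne X D) ν σ η
      (SplitLBISS.l2 βs) ≤ κ)
    (ρ : Ω → ℝ → Fin m → ℝ) (β : Ω → ℝ → Fin p → ℝ) (γ : Ω → ℝ → Fin m → ℝ)
    (hsol : ∀ ω, SplitLBISS.IsSplitLBISS X D (X *ᵥ βs + fun i => ε i ω) ν κ (ρ ω) (β ω) (γ ω))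
    (τ : ℝ) (hτ : τ = SplitLBISS.tauBar n m lamD LamX σ η)
    (βt : Ω → Fin p → ℝ) (hβt : ∀ ω, βt ω = SplitLBISS.revised D (β ω τ) (γ ω τ)) :
    -- sign consistency
    (SplitLBISS.signalBound n m S.card lamD LamD LamX lamH σ η
        ≤ S.inf' hSne (fun j => |(D *ᵥ βs) j|) →
      1 - 8 / (m : ℝ) - 3 * Real.exp (-(4 * n) / 5) ≤
        μ.real {ω | ∀ j, SignType.sign ((D *ᵥ βt ω) j) = SignType.sign ((D *ᵥ βs) j)}) ∧
    -- `ℓ²` consistency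
    (1 - 8 / (m : ℝ) - 2 * (SplitLBISS.rPrime X D : ℝ) / (m : ℝ) ^ 2
        - 3 * Real.exp (-(4 * n) / 5) ≤
      μ.real {ω |
        SplitLBISS.l2 (βt ω - βs) ≤
          SplitLBISS.errorBound n m S.card (SplitLBISS.rPrime X D) lamD LamD LamX lamH
              (SplitLBISS.invLamOne X D) σ η
            + 2 * SplitLBISS.l2 (SplitLBISS.mismatch D βs (γ ω τ)) ∧
        (S ⊆ SplitLBISS.supp (γ ω τ) →
          SplitLBISS.l2 (βt ω - βs) ≤
            SplitLBISS.errorBound n m S.card (SplitLBISS.rPrime X D) lamD LamD LamX lamH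
              (SplitLBISS.invLamOne X D) σ η)}) := by
  have hlam : 0 < lamH := by rw [hlamH]; positivity
  have h := SplitLBISS.regular_of_assumptions hSne hlamD hLamD hLamX hminD hmaxD hmaxX hν hlam
    hRSCν hη hIRR
  have hm1 : 1 ≤ m := by omega
  have hm0 : (0 : ℝ) < m := by positivity
  have hτ0 : 0 < τ := hτ ▸ SplitLBISS.tauBar_pos hn hm hlamD hLamX hσ hη.1
  have hs : ∀ j ∉ S, (D *ᵥ βs) j = 0 := fun j hj => by
    by_contra h0
    exact hj (hS ▸ SplitLBISS.mem_supp.2 h0)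
  have hsne : ∀ j ∈ S, (D *ᵥ βs) j ≠ 0 := fun j hj => SplitLBISS.mem_supp.1 (hS ▸ hj)
  have hnoise := h.noiseBound_of_event hn hm hεm hεind hσ hεsub
  rw [← hτ] at hnoise
  have hexp := Real.exp_pos (-(4 * n) / 5 : ℝ)
  -- The noise event fails with probability at most `6/m + e^{-4n/5}`; the stated `8/m + 3e^{-4n/5}`
  -- is weaker.
  have h68 : (6 : ℝ) / m ≤ 8 / m := by gcongr; norm_num
  refine ⟨fun hsig => ?_, ?_⟩
  · rw [SplitLBISS.signalBound_eq hm1, ← hτ] at hsig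
    refine le_trans (by linarith) (SplitLBISS.one_sub_le_measureReal ?_ hnoise)
    intro ω hN j
    obtain ⟨ρ', β', γ', hP⟩ := (hsol ω).exists_isPath
    rw [hβt]
    exact h.sign_consistent hP hs rfl rfl hβs hσ hκ hτ0 hN hsne
      (fun i hi => hsig.trans (Finset.inf'_le _ hi)) j
  -- The dimension of this `V` is `r'`; it contains `A k` for `k ∈ ker D`, because `A k = X(k/√n)`.
  · have hker := h.kernel_of_event (V := (LinearMap.ker D.mulVecLin).map X.mulVecLin) hn hm1 hεind
      hσ hεsub fun k hk => ⟨(√(n : ℝ))⁻¹ • k, by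
        simp [hk], by
        rw [Matrix.mulVecLin_apply, SplitLBISS.scaled, Matrix.smul_mulVec, Matrix.mulVec_smul]⟩
    have hboth := SplitLBISS.measureReal_not_and_le hnoise hker
    refine le_trans ?_ (SplitLBISS.one_sub_le_measureReal ?_ hboth)
    · rw [← SplitLBISS.rPrime]
      linarith
    rintro ω ⟨hN, hE⟩
    obtain ⟨ρ', β', γ', hP⟩ := (hsol ω).exists_isPath
    have herr := SplitLBISS.le_errorBound (n := n) (s := S.card) (r := SplitLBISS.rPrime X D)
      (LamD := LamD) (i₁ := SplitLBISS.invLamOne X D) hη.1 hm1 hlamD hLamX hlam hσ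
    rw [← hτ] at herr
    have hfin := h.l2_consistent hP hs rfl rfl hβs hσ hκ hτ0 hN hE hsne
    rw [← hβt] at hfin
    exact ⟨hfin.1.trans (add_le_add herr le_rfl), fun hsub => (hfin.2 hsub).trans herr⟩
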